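/- Let $\mathbb{H}^3=\{(x,y,z)\in\mathbb{R}^3 : z>0\}$ carry the hyperbolic metric $z^{-2}(dx^2+dy^2+dz^2)$, and use cylindrical coordinates $(x,y,z)=(r\cos\theta_3,\,r\sin\theta_3,\,z)$. Orient $\mathbb{H}^3$ so that the frame $(\partial_r,\partial_z,\partial_{\theta_3})$ is positive (equivalently, by $-dx\wedge dy\wedge dz$), and let $*$ be the Hodge star of the metric and this orientation. Let $0<c_1<c_2$, $p_1=(0,0,c_1)$, $p_2=(0,0,c_2)$, and $M=\mathbb{H}^3\setminus\{p_1,p_2\}$. For $p\in\mathbb{H}^3$ let $\Gamma_p$ be the fundamental solution of the hyperbolic Laplacian with pole $p$, normalized by $\Delta\Gamma_p=-2\pi\delta_p$ and tending to $0$ at infinity: that is, $\Gamma_p$ is smooth and harmonic on $\mathbb{H}^3\setminus\{p\}$, $\rho\,\Gamma_p\to\tfrac12$ at $p$, where $\rho$ is the hyperbolic distance to $p$, and $\Gamma_p\to 0$ at infinity. Such $\Gamma_{p_1},\Gamma_{p_2}$ exist. Put $V=1+\Gamma_{p_1}+\Gamma_{p_2}$ and $$f_c(r,z)=\frac{c^2-r^2-z^2}{2\sqrt{(c^2+r^2+z^2)^2-4c^2z^2}},\qquad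 f=f_{c_1}+f_{c_2}.$$ Let $U=\mathbb{H}^3\setminus\{z\text{-axis}\}$ and $$U_1=U\cup\{(0,0,z):0<z<c_1\},\quad U_2=U\cup\{(0,0,z):c_1<z<c_2\},\quad U_3=U\cup\{(0,0,z):z>c_2\},$$ so that $M=U_1\cup U_2\cup U_3$. Then $$d(f\,d\theta_3)=*dV\quad\text{on }U,$$ and the one-forms $$\omega_1=i(-1+f)\,d\theta_3,\qquad \omega_2=i f\,d\theta_3,\qquad \omega_3=i(1+f)\,d\theta_3,$$ extended by $0$ to the points of the axis, are smooth on $U_1,U_2,U_3$ respectively. Moreover, there is a smooth principal $\mathrm{U}(1)$-bundle $X_0\to M$ with class $\tfrac1{2\pi}[*dV]$, meaning that some connection on $X_0$ has curvature $i(*dV+d\eta)$ with a smooth real one-form $\eta$ on $M$. For every such bundle $X_0$ there is a global connection $\omega$ on $X_0$ (a smooth $\mathrm{U}(1)$-invariant $i\mathbb{R}$-valued one-form on the total space that restricts to the Maurer–Cartan form on every fibre) whose curvature is $i\,(*dV)$ on all of $M$, and for each $j\in\{1,2,3\}$ there is a smooth equivariant trivialization of $X_0$ over $U_j$, with angular fibre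 coordinate $\theta_1$, in which $$\omega=\omega_j+i\,d\theta_1 .$$ -/

import Mathlib

open Set Filter Topology
open scoped Manifold ContDiff

noncomputable section

namespace MonopoleConnection

/-! ### Hyperbolic three-space in the upper half-space model -/

/-- Euclidean three-space, with coordinates `x 0`, `x 1`, `x 2` for `x`, `y`, `z`. -/
abbrev E3 : Type := EuclideanSpace ℝ (Fin 3)

/-- Upper half-space `z > 0`. -/
def H3 : Set E3 := {x | 0 < x 2}

/-- The hyperbolic metric `z⁻² (dx² + dy² + dz²)` at the point `x`. -/
def hypMetric (x v w : E3) : ℝ := (x 2 ^ 2)⁻¹ * inner ℝ v w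

/-- The hyperbolic distance, `2 arsinh (|x - y| / (2 √(x₃ y₃)))`. -/
def hypDist (x y : E3) : ℝ := 2 * Real.arsinh (dist x y / (2 * √(x 2 * y 2)))

/-- The Laplace-Beltrami operator of the hyperbolic metric, `z² (u_xx + u_yy + u_zz) - z u_z`. -/
def hypLaplacian (u : E3 → ℝ) (x : E3) : ℝ :=
  x 2 ^ 2 * Laplacian.laplacian u x - x 2 * fderiv ℝ u x (EuclideanSpace.single 2 1)

/-- `Γ` is the fundamental solution of the hyperbolic Laplacian with pole `p`, normalized by
`ΔΓ = -2π δ_p`: it is harmonic away from `p`, behaves like `1 / (2ρ)` at the pole, where `ρ` is the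
distance to `p` (in dimension three `Δ (1 / (4πρ))` contributes `-δ_p`), and tends to `0` at
infinity.  The values of `Γ` outside `H3 \ {p}` are irrelevant. -/
structure IsFundamentalSolution (p : E3) (Γ : E3 → ℝ) : Prop where
  smooth : ContDiffOn ℝ ∞ Γ (H3 \ {p})
  harmonic : ∀ x ∈ H3 \ {p}, hypLaplacian Γ x = 0
  pole : Tendsto (fun x => hypDist p x * Γ x) (𝓝[≠] p) (𝓝 (1 / 2))
  decay : ∀ ε > 0, ∃ K ⊆ H3, IsCompact K ∧ ∀ x ∈ H3 \ K, |Γ x| < ε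

/-! ### Differential forms -/

/-- A field of covectors, as a differential form of degree one. -/
def oneForm {F : Type*} [NormedAddCommGroup F] [NormedSpace ℝ F] (α : E3 → E3 →L[ℝ] F) :
    E3 → E3 [⋀^Fin 1]→L[ℝ] F :=
  fun x => ContinuousAlternatingMap.ofSubsingleton ℝ E3 F 0 (α x)

/-- The exterior derivative of a one-form. -/
def dOne {F : Type*} [NormedAddCommGroup F] [NormedSpace ℝ F] (α : E3 → E3 →L[ℝ] F) :
    E3 → E3 [⋀^Fin 2]→L[ℝ] F :=
  extDeriv (oneForm α)

/-- The form `dx ∧ dy ∧ dz`. -/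
def detForm : E3 [⋀^Fin 3]→L[ℝ] ℝ :=
  { Matrix.detRowAlternating.compLinearMap (WithLp.linearEquiv 2 ℝ (Fin 3 → ℝ)).toLinearMap with
    cont := by
      change Continuous fun v : Fin 3 → E3 => Matrix.det (fun i j => v i j)
      refine Continuous.matrix_det ?_
      fun_prop }

/-- The volume form of the hyperbolic metric, for the orientation in which the cylindrical frame
`∂/∂r, ∂/∂z, ∂/∂θ₃` is positive.  This is the orientation opposite to `dx ∧ dy ∧ dz`. -/
def hypVol (x : E3) : E3 [⋀^Fin 3]→L[ℝ] ℝ := (-(x 2 ^ 3)⁻¹) • detForm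

theorem hypVol_apply (x : E3) (v : Fin 3 → E3) :
    hypVol x v = -(x 2 ^ 3)⁻¹ * Matrix.det (Matrix.of fun i j => v i j) := rfl

/-- The hyperbolic volume form takes the value `1` on the orthonormal frame
`z ∂/∂x, z ∂/∂z, z ∂/∂y`. -/
theorem hypVol_frame {x : E3} (hx : x ∈ H3) :
    hypVol x ![x 2 • EuclideanSpace.single 0 1, x 2 • EuclideanSpace.single 2 1,
      x 2 • EuclideanSpace.single 1 1] = 1 := by
  have h : x 2 ≠ 0 := ne_of_gt hx
  rw [hypVol_apply, Matrix.det_fin_three]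
  simp
  field_simp

/-- The vector dual to a covector with respect to the hyperbolic metric. -/
def hypSharp (x : E3) (α : E3 →L[ℝ] ℝ) : E3 :=
  x 2 ^ 2 • (InnerProductSpace.toDual ℝ E3).symm α

theorem hypMetric_hypSharp {x : E3} (hx : x ∈ H3) (α : E3 →L[ℝ] ℝ) (v : E3) :
    hypMetric x (hypSharp x α) v = α v := by
  have h : x 2 ≠ 0 := ne_of_gt hx
  simp only [hypMetric, hypSharp, inner_smul_left, InnerProductSpace.toDual_symm_apply]
  simp
  field_simp

/-- The Hodge star of the hyperbolic metric on covectors: contraction of the volume form with the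
metric dual. -/
def hypStar (x : E3) (α : E3 →L[ℝ] ℝ) : E3 [⋀^Fin 2]→L[ℝ] ℝ :=
  (hypVol x).curryLeft (hypSharp x α)

/-- The two-form `*dV`. -/
def starD (V : E3 → ℝ) (x : E3) : E3 [⋀^Fin 2]→L[ℝ] ℝ := hypStar x (fderiv ℝ V x)

/-- Multiplication by `i`, as a map from real numbers to imaginary numbers. -/
def iMul : ℝ →L[ℝ] ℂ := Complex.I • Complex.ofRealCLM

/-! ### The two-monopole data -/

/-- The point `(0, 0, c)`. -/
def axisPoint (c : ℝ) : E3 := !₂[0, 0, c]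

/-- `V = 1 + Γ₁ + Γ₂`. -/
def potential (Γ₁ Γ₂ : E3 → ℝ) (x : E3) : ℝ := 1 + Γ₁ x + Γ₂ x

/-- The base `H3` minus the two monopole points. -/
def M (c₁ c₂ : ℝ) : Set E3 := H3 \ {axisPoint c₁, axisPoint c₂}

/-- The complement of the `z`-axis in `H3`. -/
def U : Set E3 := {x ∈ H3 | ¬ (x 0 = 0 ∧ x 1 = 0)}

def U₁ (c₁ : ℝ) : Set E3 := U ∪ {x | ∃ z, 0 < z ∧ z < c₁ ∧ x = axisPoint z}

def U₂ (c₁ c₂ : ℝ) : Set E3 := U ∪ {x | ∃ z, c₁ < z ∧ z < c₂ ∧ x = axisPoint z}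

def U₃ (c₂ : ℝ) : Set E3 := U ∪ {x | ∃ z, c₂ < z ∧ x = axisPoint z}

/-- The cylindrical radius. -/
def cylR (x : E3) : ℝ := √(x 0 ^ 2 + x 1 ^ 2)

/-- `f_c` as a function of the cylindrical coordinates `r`, `z`. -/
def fc (c r z : ℝ) : ℝ :=
  (c ^ 2 - r ^ 2 - z ^ 2) / (2 * √((c ^ 2 + r ^ 2 + z ^ 2) ^ 2 - 4 * c ^ 2 * z ^ 2))

/-- `f = f_{c₁} + f_{c₂}`. -/
def f (c₁ c₂ : ℝ) (x : E3) : ℝ := fc c₁ (cylR x) (x 2) + fc c₂ (cylR x) (x 2)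

/-- The angular form `dθ₃ = (x dy - y dx) / (x² + y²)`, with the value `0` on the axis.  A form
`h dθ₃` therefore vanishes on the axis, which is the value there of its continuous extension
whenever `h` is smooth and vanishes on that part of the axis. -/
def dθ₃ (x : E3) : E3 →L[ℝ] ℝ :=
  (x 0 ^ 2 + x 1 ^ 2)⁻¹ • (x 0 • EuclideanSpace.proj 1 - x 1 • EuclideanSpace.proj 0)

/-- The imaginary one-form `i (k + f) dθ₃`. -/
def gaugeForm (c₁ c₂ k : ℝ) (x : E3) : E3 →L[ℝ] ℂ := iMul.comp ((k + f c₁ c₂ x) • dθ₃ x)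

/-! ### Principal U(1)-bundles and connections -/

/-- The model of a four-manifold, as `ℝ³ × ℝ`. -/
abbrev H4 : Type := ModelProd (EuclideanSpace ℝ (Fin 3)) (EuclideanSpace ℝ (Fin 1))

abbrev J4 : ModelWithCorners ℝ (EuclideanSpace ℝ (Fin 3) × EuclideanSpace ℝ (Fin 1)) H4 :=
  (𝓡 3).prod (𝓡 1)

/-- A smooth section, over `W`, of the projection `π`. -/
structure IsSection {P : Type} [TopologicalSpace P] [ChartedSpace H4 P] (π : P → E3) (W : Set E3)
    (s : E3 → P) : Prop where
  smooth : ContMDiffOn (𝓡 3) J4 ∞ s W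
  proj : ∀ x ∈ W, π (s x) = x

/-- `τ : π⁻¹(W) → U(1)` is the fibre component of a smooth equivariant trivialization
`p ↦ (π p, τ p)` of `π⁻¹(W)` as `W × U(1)`; the inverse is `(x, g) ↦ g • s x`. -/
structure IsTrivialization {P : Type} [TopologicalSpace P] [ChartedSpace H4 P] [MulAction Circle P]
    (π : P → E3) (W : Set E3) (s : E3 → P) (τ : P → Circle) : Prop where
  isSection : IsSection π W s
  smooth : ContMDiffOn J4 (𝓡 1) ∞ τ (π ⁻¹' W)
  apply_smul : ∀ x ∈ W, ∀ g : Circle, τ (g • s x) = g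
  smul_apply : ∀ p ∈ π ⁻¹' W, τ p • s (π p) = p

/-- A smooth principal U(1)-bundle over an open set `B` of `ℝ³`.  (The group is abelian, so that
its action may be written on the left.) -/
structure U1Bundle (B : Set E3) where
  Total : Type
  [top : TopologicalSpace Total]
  [charted : ChartedSpace H4 Total]
  [manifold : IsManifold J4 ∞ Total]
  [action : MulAction Circle Total]
  proj : Total → E3
  proj_mem : ∀ p, proj p ∈ B
  smooth_proj : ContMDiff J4 (𝓡 3) ∞ proj
  smooth_smul : ContMDiff ((𝓡 1).prod J4) J4 ∞ (fun q : Circle × Total => q.1 • q.2)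
  proj_smul : ∀ (g : Circle) (p : Total), proj (g • p) = proj p
  locally_trivial : ∀ x ∈ B, ∃ W, IsOpen W ∧ x ∈ W ∧ W ⊆ B ∧
    ∃ s τ, IsTrivialization proj W s τ

attribute [instance] U1Bundle.top U1Bundle.charted U1Bundle.manifold U1Bundle.action

/-- The imaginary one-form `τ⁻¹ dτ` of a circle-valued function `τ`, that is, `i dθ₁` for
`τ = exp (i θ₁)`. -/
def angularForm {P : Type} [TopologicalSpace P] [ChartedSpace H4 P] (τ : P → Circle) (p : P) :
    TangentSpace J4 p →L[ℝ] ℂ :=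
  let dτ : TangentSpace J4 p →L[ℝ] ℂ := mfderiv J4 𝓘(ℝ, ℂ) (fun q => (τ q : ℂ)) p
  (τ p : ℂ)⁻¹ • dτ

/-- A connection one-form on the total space, with values in the imaginary numbers. -/
structure Connection {B : Set E3} (X : U1Bundle B) where
  form : ∀ p : X.Total, TangentSpace J4 p →L[ℝ] ℂ
  imaginary : ∀ p v, (form p v).re = 0
  /-- Smoothness, as a function on the tangent bundle. -/
  smooth : ContMDiff J4.tangent 𝓘(ℝ, ℂ) ∞ (fun v : TangentBundle J4 X.Total => form v.proj v.snd)
  /-- On each fibre, parametrized by `t ↦ exp (i t) • p`, the form is `i dt`. -/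
  vertical : ∀ (p : X.Total) (t : ℝ), form (Circle.exp t • p)
    (mfderiv 𝓘(ℝ, ℝ) J4 (fun u : ℝ => Circle.exp u • p) t (1 : ℝ)) = Complex.I
  invariant : ∀ (g : Circle) (p : X.Total) (v : TangentSpace J4 p),
    form (g • p) (mfderiv J4 J4 (fun q : X.Total => g • q) p v) = form p v

namespace Connection

variable {B : Set E3} {X : U1Bundle B}

/-- The pullback of the connection form by a map from the base. -/
def pullback (A : Connection X) (s : E3 → X.Total) (x : E3) : E3 →L[ℝ] ℂ :=
  (A.form (s x)).comp (mfderiv (𝓡 3) J4 s x)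

/-- The curvature of the connection, as a form on the base, is `i F`: the pullback of the
connection form by any smooth local section has exterior derivative `i F`. -/
def HasCurvature (A : Connection X) (F : E3 → E3 [⋀^Fin 2]→L[ℝ] ℝ) : Prop :=
  ∀ W, IsOpen W → W ⊆ B → ∀ s, IsSection X.proj W s →
    ∀ x ∈ W, dOne (A.pullback s) x = iMul.compContinuousAlternatingMap (F x)

/-- In the trivialization `p ↦ (π p, τ p)` over `W`, with `τ = exp (i θ₁)`, the connection form is
`α + i dθ₁`. -/
def HasLocalForm (A : Connection X) (W : Set E3) (τ : X.Total → Circle) (α : E3 → E3 →L[ℝ] ℂ) :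
    Prop :=
  ∀ p ∈ X.proj ⁻¹' W, ∀ v : TangentSpace J4 p,
    A.form p v = α (X.proj p) (mfderiv J4 (𝓡 3) X.proj p v) + angularForm τ p v

end Connection

/-- The characteristic class of `X` is `(1 / 2π) [F]`, in the sense of Chern-Weil theory and with
the sign convention that curvature `i F` represents `(1 / 2π) [F]`: the curvature of a connection
on `X` is `i F` up to an exact form.  (The second cohomology of `ℝ³`, or of a half-space, minus
finitely many points has no torsion, so the integral class is determined by its real image.) -/
def U1Bundle.HasClass {B : Set E3} (X : U1Bundle B) (F : E3 → E3 [⋀^Fin 2]→L[ℝ] ℝ) : Prop :=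
  ∃ (A : Connection X) (η : E3 → E3 →L[ℝ] ℝ), ContDiffOn ℝ ∞ η B ∧
    A.HasCurvature (fun x => F x + dOne η x)

end MonopoleConnection

end

open Set Filter Topology
open scoped Manifold ContDiff

noncomputable section

namespace MonopoleConnection

/-! ### One-forms -/

section Forms

variable {F : Type*} [NormedAddCommGroup F] [NormedSpace ℝ F]

/-! Write `N = c² + r² + z²` and `D² = N² - 4c²z²`. If ρ is the distance to `(0, 0, c)`, then `N =
2cz cosh ρ` and `D = 2cz sinh ρ`, so `(coth ρ - 1) / 2` is `green c = (N / D - 1) / 2`. It is a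
fundamental solution by computation, and the only one by a maximum principle
(`IsFundamentalSolution.eqOn_green`). The potential is therefore explicit.

Off the axis `f_c` is conjugate to Γ: `∂_r f_c = -(r/z) ∂_z Γ` and `∂_z f_c = (r/z) ∂_r Γ`, which is
the equation `d(f_c dθ₃) = *dΓ`. On the axis `f_c` equals 1/2 below the pole and -1/2 above it, up
to smooth multiples of r². So f takes the values 1, 0, -1 on the three intervals of the axis, and
the constants -1, 0, 1 are the ones that remove the singularity of dθ₃. The curvature identity then
extends to each patch, because U is dense (`dOne_gaugeForm`).

The three forms differ by integer multiples of `i dθ₃`, the logarithmic differentials of powers of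
`exp (i θ₃)`. These powers glue trivial bundles over the patches to a bundle on which the three
forms define one connection; this gives existence (`hasClass_gluingData`).

Conversely, on a bundle carrying a connection with curvature `i(*dV + dη)`, subtracting `iη`
corrects the curvature (`Connection.hasCurvature_subBase`). Over a patch the connection and the
gauge form then have the same differential, so for a local section s the difference of `s*A` and the
gauge form is closed. A primitive of it supplies the phase that rotates s into a section along which
the connection pulls back exactly to the gauge form. Such sections are unique up to a constant, and
the patches are star-shaped about points of the axis, so continuation along rays yields one over the
whole patch (`exists_isFlatSection`). Its trivialization has the required local form. -/

theorem dOne_apply {α : E3 → E3 →L[ℝ] F} {x : E3} (h : DifferentiableAt ℝ α x) (v : Fin 2 → E3) :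
    dOne α x v = fderiv ℝ α x (v 0) (v 1) - fderiv ℝ α x (v 1) (v 0) := by
  have h1 : DifferentiableAt ℝ (oneForm α) x :=
    (ContinuousAlternatingMap.ofSubsingletonLIE (𝕜 := ℝ) (E := E3) (F := F)
      (0 : Fin 1)).toContinuousLinearEquiv.differentiableAt.comp x h
  rw [dOne, extDeriv_apply h1, Fin.sum_univ_two]
  have key : ∀ w : Fin 1 → E3, ∀ u, fderiv ℝ (fun y => oneForm α y w) x u = fderiv ℝ α x u (w 0) := by
    intro w u
    change fderiv ℝ (fun y => α y (w 0)) x u = _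
    rw [fderiv_clm_apply h (differentiableAt_const _)]
    simp
  rw [key, key]
  simp [Fin.removeNth, sub_eq_add_neg]

theorem HasFDerivAt.div_real {E : Type*} [NormedAddCommGroup E] [NormedSpace ℝ E] {a b : E → ℝ}
    {a' b' : E →L[ℝ] ℝ} {x : E} (ha : HasFDerivAt a a' x) (hb : HasFDerivAt b b' x) (h : b x ≠ 0) :
    HasFDerivAt (fun y => a y / b y) ((b x)⁻¹ • a' - (a x / b x ^ 2) • b') x := by
  simp only [div_eq_mul_inv]
  refine (ha.mul ((hasDerivAt_inv h).comp_hasFDerivAt x hb)).congr_fderiv ?_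
  ext v
  simp
  field_simp
  ring

end Forms

/-! ### Coordinates -/

/-- The coordinate functionals. -/
abbrev coord (i : Fin 3) : E3 →L[ℝ] ℝ := EuclideanSpace.proj i

theorem hasFDerivAt_coord (i : Fin 3) (x : E3) : HasFDerivAt (fun y : E3 => y i) (coord i) x :=
  (coord i).hasFDerivAt

theorem isOpen_H3 : IsOpen H3 := isOpen_lt continuous_const (coord 2).continuous

theorem norm_sub_axisPoint (c : ℝ) (x : E3) :
    dist (axisPoint c) x ^ 2 = x 0 ^ 2 + x 1 ^ 2 + (x 2 - c) ^ 2 := by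
  rw [EuclideanSpace.dist_eq, Real.sq_sqrt (by positivity)]
  simp [Fin.sum_univ_three, axisPoint, Real.dist_eq, sq_abs]
  ring

theorem eq_axisPoint_iff {x : E3} {c : ℝ} : x = axisPoint c ↔ x 0 = 0 ∧ x 1 = 0 ∧ x 2 = c := by
  constructor
  · rintro rfl; simp [axisPoint]
  · rintro ⟨h0, h1, h2⟩
    ext i; fin_cases i <;> simp [axisPoint, h0, h1, h2]

/-! ### The explicit fundamental solution -/

/-- The quantity `c² + r² + z²`. -/
def poleN (c : ℝ) (x : E3) : ℝ := c ^ 2 + (x 0 ^ 2 + x 1 ^ 2) + x 2 ^ 2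

/-- The product of the Euclidean distances to `(0, 0, c)` and to `(0, 0, -c)`. -/
def poleD (c : ℝ) (x : E3) : ℝ := √(poleN c x ^ 2 - 4 * c ^ 2 * x 2 ^ 2)

/-- The fundamental solution `(coth ρ - 1) / 2`. -/
def green (c : ℝ) (x : E3) : ℝ := (poleN c x / poleD c x - 1) / 2

/-- The function `f_c`. -/
def fPole (c : ℝ) (x : E3) : ℝ := (2 * c ^ 2 - poleN c x) / (2 * poleD c x)

/-- The radicand factors as `(r² + (z - c)²)(r² + (z + c)²)`. In the half-space only the first
factor can vanish, and only at the pole. -/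
theorem poleQ_pos {c : ℝ} (hc : 0 < c) {x : E3} (hx : x ∈ H3 \ {axisPoint c}) :
    0 < poleN c x ^ 2 - 4 * c ^ 2 * x 2 ^ 2 := by
  have hz : 0 < x 2 := hx.1
  have hne : ¬ (x 0 = 0 ∧ x 1 = 0 ∧ x 2 = c) := fun h => hx.2 (eq_axisPoint_iff.2 h)
  have : poleN c x ^ 2 - 4 * c ^ 2 * x 2 ^ 2 = ((x 0 ^ 2 + x 1 ^ 2) + (x 2 - c) ^ 2) *
    ((x 0 ^ 2 + x 1 ^ 2) + (x 2 + c) ^ 2) := by rw [poleN]; ring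
  rw [this]
  refine mul_pos ?_ (by positivity)
  refine lt_of_le_of_ne (by positivity) fun h => hne ?_
  refine ⟨?_, ?_, ?_⟩
  · nlinarith [sq_nonneg (x 0), sq_nonneg (x 1), sq_nonneg (x 2 - c)]
  · nlinarith [sq_nonneg (x 0), sq_nonneg (x 1), sq_nonneg (x 2 - c)]
  · nlinarith [sq_nonneg (x 0), sq_nonneg (x 1), sq_nonneg (x 2 - c)]

theorem poleD_pos {c : ℝ} (hc : 0 < c) {x : E3} (hx : x ∈ H3 \ {axisPoint c}) : 0 < poleD c x :=
  Real.sqrt_pos.2 (poleQ_pos hc hx)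

theorem poleD_sq {c : ℝ} (hc : 0 < c) {x : E3} (hx : x ∈ H3 \ {axisPoint c}) :
    poleD c x ^ 2 = poleN c x ^ 2 - 4 * c ^ 2 * x 2 ^ 2 :=
  Real.sq_sqrt (poleQ_pos hc hx).le

theorem poleN_pos {c : ℝ} (hc : 0 < c) (x : E3) : 0 < poleN c x := by
  unfold poleN; positivity

theorem isOpen_H3_diff (p : E3) : IsOpen (H3 \ {p}) := isOpen_H3.sdiff isClosed_singleton

theorem contDiff_poleN (c : ℝ) : ContDiff ℝ ∞ (poleN c) := by
  unfold poleN; fun_prop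

theorem contDiffOn_poleD {c : ℝ} (hc : 0 < c) : ContDiffOn ℝ ∞ (poleD c) (H3 \ {axisPoint c}) := by
  refine ContDiffOn.sqrt ?_ fun x hx => (poleQ_pos hc hx).ne'
  have := contDiff_poleN c
  exact ContDiff.contDiffOn (by fun_prop)

theorem contDiffOn_green {c : ℝ} (hc : 0 < c) : ContDiffOn ℝ ∞ (green c) (H3 \ {axisPoint c}) := by
  have h := (contDiff_poleN c).contDiffOn.div (contDiffOn_poleD hc)
    fun x hx => (poleD_pos hc hx).ne'
  exact (h.sub contDiffOn_const).div_const 2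

theorem hasFDerivAt_poleN (c : ℝ) (x : E3) : HasFDerivAt (poleN c)
    ((2 * x 0) • coord 0 + (2 * x 1) • coord 1 + (2 * x 2) • coord 2) x := by
  have h0 := (hasFDerivAt_coord 0 x).pow 2
  have h1 := (hasFDerivAt_coord 1 x).pow 2
  have h2 := (hasFDerivAt_coord 2 x).pow 2
  refine (((hasFDerivAt_const (c ^ 2) x).add (h0.add h1)).add h2).congr_fderiv ?_
  ext v; simp

theorem hasFDerivAt_poleD {c : ℝ} (hc : 0 < c) {x : E3} (hx : x ∈ H3 \ {axisPoint c}) :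
    HasFDerivAt (poleD c) ((2 * poleN c x * x 0 / poleD c x) • coord 0 +
      (2 * poleN c x * x 1 / poleD c x) • coord 1 +
      (2 * x 2 * (poleN c x - 2 * c ^ 2) / poleD c x) • coord 2) x := by
  have hD := poleD_pos hc hx
  have h := ((((hasFDerivAt_poleN c x).pow 2).sub
    (((hasFDerivAt_coord 2 x).pow 2).const_mul (4 * c ^ 2))).sqrt (poleQ_pos hc hx).ne')
  refine h.congr_fderiv ?_
  change (1 / (2 * poleD c x)) • _ = _
  ext v
  simp
  field_simp
  ring

theorem hasFDerivAt_green {c : ℝ} (hc : 0 < c) {x : E3} (hx : x ∈ H3 \ {axisPoint c}) :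
    HasFDerivAt (green c) ((-4 * c ^ 2 * x 2 ^ 2 * x 0 / poleD c x ^ 3) • coord 0 +
      (-4 * c ^ 2 * x 2 ^ 2 * x 1 / poleD c x ^ 3) • coord 1 +
      (2 * c ^ 2 * x 2 * (poleN c x - 2 * x 2 ^ 2) / poleD c x ^ 3) • coord 2) x := by
  have hD := poleD_pos hc hx
  have hs := poleD_sq hc hx
  have h := ((HasFDerivAt.div_real (hasFDerivAt_poleN c x) (hasFDerivAt_poleD hc hx) hD.ne').sub_const 1).mul_const
    (2⁻¹ : ℝ)
  simp only [← div_eq_mul_inv] at h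
  refine h.congr_fderiv ?_
  ext v
  simp
  field_simp
  rw [hs]
  ring

/-- Compared with `hasFDerivAt_green`, this says `∂_r f_c = -(r/z) ∂_z Γ` and `∂_z f_c = (r/z) ∂_r
Γ`, the two relations behind the curvature identity. -/
theorem hasFDerivAt_fPole {c : ℝ} (hc : 0 < c) {x : E3} (hx : x ∈ H3 \ {axisPoint c}) :
    HasFDerivAt (fPole c) ((-2 * c ^ 2 * x 0 * (poleN c x - 2 * x 2 ^ 2) / poleD c x ^ 3) • coord 0 +
      (-2 * c ^ 2 * x 1 * (poleN c x - 2 * x 2 ^ 2) / poleD c x ^ 3) • coord 1 +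
      (-4 * c ^ 2 * x 2 * (x 0 ^ 2 + x 1 ^ 2) / poleD c x ^ 3) • coord 2) x := by
  have hD := poleD_pos hc hx
  have hs := poleD_sq hc hx
  have h := HasFDerivAt.div_real ((hasFDerivAt_poleN c x).const_sub (2 * c ^ 2))
    ((hasFDerivAt_poleD hc hx).const_mul 2) (by positivity)
  refine h.congr_fderiv ?_
  have hN : x 0 ^ 2 + x 1 ^ 2 = poleN c x - c ^ 2 - x 2 ^ 2 := by rw [poleN]; ring
  rw [hN]
  ext v
  simp
  field_simp
  rw [hs]
  ring

theorem two_le_infty : (2 : WithTop ℕ∞) ≤ ∞ := WithTop.coe_le_coe.2 (le_top (a := (2 : ℕ∞)))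

/-! ### The explicit function is a fundamental solution -/

theorem laplacian_eq_sum_fderiv {u : E3 → ℝ} {x : E3} (h : ContDiffAt ℝ 2 u x) :
    Laplacian.laplacian u x =
      ∑ i, fderiv ℝ (fun y => fderiv ℝ u y (EuclideanSpace.single i 1)) x
        (EuclideanSpace.single i 1) := by
  rw [congrFun (InnerProductSpace.laplacian_eq_iteratedFDeriv_orthonormalBasis u
    (EuclideanSpace.basisFun (Fin 3) ℝ)) x]
  refine Finset.sum_congr rfl fun i _ => ?_
  have hd : DifferentiableAt ℝ (fderiv ℝ u) x :=
    (h.fderiv_right (m := 1) (by norm_num)).differentiableAt (by norm_num)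
  rw [iteratedFDeriv_two_apply, fderiv_clm_apply hd (differentiableAt_const _)]
  simp

theorem harmonic_green {c : ℝ} (hc : 0 < c) {x : E3} (hx : x ∈ H3 \ {axisPoint c}) :
    hypLaplacian (green c) x = 0 := by
  have hD := poleD_pos hc hx
  have hs := poleD_sq hc hx
  have hO : H3 \ {axisPoint c} ∈ 𝓝 x := (isOpen_H3_diff _).mem_nhds hx
  have hdiff : ContDiffAt ℝ 2 (green c) x :=
    ((contDiffOn_green hc).contDiffAt hO).of_le two_le_infty
  have hN := hasFDerivAt_poleN c x
  have hD3 := (hasFDerivAt_poleD hc hx).pow 3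
  have hx0 := hasFDerivAt_coord 0 x
  have hx1 := hasFDerivAt_coord 1 x
  have hx2 := hasFDerivAt_coord 2 x
  have e0 : fderiv ℝ (fun y => fderiv ℝ (green c) y (EuclideanSpace.single 0 1)) x
      (EuclideanSpace.single 0 1) = -4 * c ^ 2 * x 2 ^ 2 *
        (poleD c x ^ 2 - 6 * poleN c x * x 0 ^ 2) / poleD c x ^ 5 := by
    have h := HasFDerivAt.div_real (((hx2.pow 2).const_mul (-4 * c ^ 2)).mul hx0) hD3 (by positivity)
    have he : (fun y => fderiv ℝ (green c) y (EuclideanSpace.single 0 1)) =ᶠ[𝓝 x]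
        fun y => (-4 * c ^ 2 * y 2 ^ 2 * y 0) / poleD c y ^ 3 := by
      filter_upwards [hO] with y hy
      rw [(hasFDerivAt_green hc hy).fderiv]; simp
    rw [(h.congr_of_eventuallyEq he).fderiv]
    simp
    field_simp
    ring
  have e1 : fderiv ℝ (fun y => fderiv ℝ (green c) y (EuclideanSpace.single 1 1)) x
      (EuclideanSpace.single 1 1) = -4 * c ^ 2 * x 2 ^ 2 *
        (poleD c x ^ 2 - 6 * poleN c x * x 1 ^ 2) / poleD c x ^ 5 := by
    have h := HasFDerivAt.div_real (((hx2.pow 2).const_mul (-4 * c ^ 2)).mul hx1) hD3 (by positivity)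
    have he : (fun y => fderiv ℝ (green c) y (EuclideanSpace.single 1 1)) =ᶠ[𝓝 x]
        fun y => (-4 * c ^ 2 * y 2 ^ 2 * y 1) / poleD c y ^ 3 := by
      filter_upwards [hO] with y hy
      rw [(hasFDerivAt_green hc hy).fderiv]; simp
    rw [(h.congr_of_eventuallyEq he).fderiv]
    simp
    field_simp
    ring
  have e2 : fderiv ℝ (fun y => fderiv ℝ (green c) y (EuclideanSpace.single 2 1)) x
      (EuclideanSpace.single 2 1) = 2 * c ^ 2 * ((poleN c x - 4 * x 2 ^ 2) * poleD c x ^ 2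
        - 6 * x 2 ^ 2 * (poleN c x - 2 * x 2 ^ 2) * (poleN c x - 2 * c ^ 2)) / poleD c x ^ 5 := by
    have h := HasFDerivAt.div_real ((hx2.const_mul (2 * c ^ 2)).mul
      (hN.sub ((hx2.pow 2).const_mul 2))) hD3 (by positivity)
    have he : (fun y => fderiv ℝ (green c) y (EuclideanSpace.single 2 1)) =ᶠ[𝓝 x]
        fun y => (2 * c ^ 2 * y 2 * (poleN c y - 2 * y 2 ^ 2)) / poleD c y ^ 3 := by
      filter_upwards [hO] with y hy
      rw [(hasFDerivAt_green hc hy).fderiv]; simp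
    rw [(h.congr_of_eventuallyEq he).fderiv]
    simp
    field_simp
    ring
  have e3 : fderiv ℝ (green c) x (EuclideanSpace.single 2 1) =
      2 * c ^ 2 * x 2 * (poleN c x - 2 * x 2 ^ 2) / poleD c x ^ 3 := by
    rw [(hasFDerivAt_green hc hx).fderiv]; simp
  -- Eliminating `x 0 ^ 2` in favour of N, and then `D²`, leaves a polynomial identity.
  have hN' : x 0 ^ 2 = poleN c x - c ^ 2 - x 2 ^ 2 - x 1 ^ 2 := by rw [poleN]; ring
  rw [hypLaplacian, laplacian_eq_sum_fderiv hdiff, Fin.sum_univ_three, e0, e1, e2, e3, hN']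
  field_simp
  rw [hs]
  ring

/-- In terms of `q = 2cz / N = 1 / cosh ρ` the function is `(1 / √(1 - q²) - 1) / 2`, which is
continuous and vanishes at `q = 0`. The compact set is a superlevel set of q, a closed hyperbolic
ball about the pole. -/
theorem decay_green {c : ℝ} (hc : 0 < c) :
    ∀ ε > 0, ∃ K ⊆ H3, IsCompact K ∧ ∀ x ∈ H3 \ K, |green c x| < ε := by
  intro ε hε
  have hcont : ContinuousAt (fun q : ℝ => (1 / √(1 - q ^ 2) - 1) / 2) 0 := by
    refine ContinuousAt.div_const (ContinuousAt.sub (ContinuousAt.div continuousAt_const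
      (Continuous.continuousAt (by fun_prop)) ?_) continuousAt_const) 2
    simp
  obtain ⟨δ, hδ, hball⟩ := Metric.continuousAt_iff.1 hcont ε hε
  set K : Set E3 := {x | min δ 1 * poleN c x ≤ 2 * c * x 2}
  have hm : 0 < min δ 1 := by positivity
  refine ⟨K, fun x hx => ?_, ?_, fun x hx => ?_⟩
  · have h1 : 0 < min δ 1 * poleN c x := mul_pos hm (poleN_pos hc x)
    have h2 : 0 < 2 * c * x 2 := h1.trans_le hx
    exact (mul_pos_iff_of_pos_left (by positivity)).1 h2
  · refine Metric.isCompact_of_isClosed_isBounded ?_ ?_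
    · have h1 := (contDiff_poleN c).continuous
      have h2 : Continuous fun x : E3 => x 2 := (coord 2).continuous
      exact isClosed_le (by fun_prop) (by fun_prop)
    -- With `m = min δ 1`, the bounds `‖x‖² ≤ N` and `z ≤ ‖x‖` give `m ‖x‖² ≤ 2c ‖x‖`.
    · refine (Metric.isBounded_closedBall (x := (0 : E3)) (r := 2 * c / min δ 1)).subset fun x hx => ?_
      rw [mem_closedBall_zero_iff]
      have hn : ‖x‖ ^ 2 = x 0 ^ 2 + x 1 ^ 2 + x 2 ^ 2 := by
        rw [EuclideanSpace.norm_sq_eq]; simp [Fin.sum_univ_three]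
      have h1 : min δ 1 * poleN c x ≤ 2 * c * x 2 := hx
      have h2 : x 2 ≤ ‖x‖ := by
        refine le_of_sq_le_sq ?_ (norm_nonneg _)
        rw [hn]; nlinarith [sq_nonneg (x 0), sq_nonneg (x 1)]
      have h3 : poleN c x = c ^ 2 + ‖x‖ ^ 2 := by rw [hn, poleN]; ring
      rw [le_div_iff₀ hm]
      rcases (norm_nonneg x).eq_or_lt with h0 | h0
      · rw [← h0]; simp; positivity
      refine le_of_mul_le_mul_right ?_ h0
      calc ‖x‖ * min δ 1 * ‖x‖ ≤ min δ 1 * poleN c x := by rw [h3]; nlinarith [sq_nonneg c]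
        _ ≤ 2 * c * x 2 := h1
        _ ≤ 2 * c * ‖x‖ := by gcongr
  · have hz : 0 < x 2 := hx.1
    have hN := poleN_pos hc x
    have hlt : 2 * c * x 2 < min δ 1 * poleN c x := not_le.1 hx.2
    set q := 2 * c * x 2 / poleN c x with hq
    have hq0 : 0 < q := by positivity
    have hqm : q < min δ 1 := by rw [hq, div_lt_iff₀ hN]; exact hlt
    have h := hball (x := q) (by
      rw [Real.dist_eq, sub_zero, abs_of_pos hq0]; exact hqm.trans_le (min_le_left _ _))
    have hD : poleD c x = poleN c x * √(1 - q ^ 2) := by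
      have : poleN c x ^ 2 - 4 * c ^ 2 * x 2 ^ 2 = poleN c x ^ 2 * (1 - q ^ 2) := by
        rw [hq]; field_simp; ring
      rw [poleD, this, Real.sqrt_mul (by positivity), Real.sqrt_sq hN.le]
    have hg : green c x = (1 / √(1 - q ^ 2) - 1) / 2 := by
      have : poleN c x / poleD c x = 1 / √(1 - q ^ 2) := by
        rw [hD, div_mul_eq_div_div, div_self hN.ne']
      rw [green, this]
    rw [hg]
    have h0 : (1 / √(1 - (0 : ℝ) ^ 2) - 1) / 2 = 0 := by simp
    rw [h0, Real.dist_eq, sub_zero] at h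
    exact h

theorem pole_green {c : ℝ} (hc : 0 < c) :
    Tendsto (fun x => hypDist (axisPoint c) x * green c x) (𝓝[≠] (axisPoint c)) (𝓝 (1 / 2)) := by
  set p := axisPoint c with hp
  have hp2 : p 2 = c := by simp [hp, axisPoint]
  -- This is `sinh (ρ / 2)`. In this variable `ρ = 2 arsinh a`, `cosh ρ = 1 + 2a²` and `sinh ρ = 2a
  -- √(1 + a²)`, so `ρΓ` becomes a function of a alone.
  set a : E3 → ℝ := fun x => dist p x / (2 * √(p 2 * x 2)) with ha
  have hpH : p ∈ H3 := by change 0 < p 2; rw [hp2]; exact hc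
  have hcoord : Continuous fun x : E3 => x 2 := (coord 2).continuous
  have ha0 : Tendsto a (𝓝[≠] p) (𝓝[≠] 0) := by
    refine tendsto_nhdsWithin_iff.2 ⟨?_, ?_⟩
    · have : ContinuousAt a p := by
        refine ContinuousAt.div (by fun_prop) (by fun_prop) ?_
        rw [hp2]; positivity
      have h0 : a p = 0 := by simp [ha]
      rw [← h0]
      exact this.mono_left nhdsWithin_le_nhds
    · filter_upwards [self_mem_nhdsWithin, mem_nhdsWithin_of_mem_nhds (isOpen_H3.mem_nhds hpH)]
        with x hx hxH
      have hx2 : 0 < x 2 := hxH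
      have hd : 0 < dist p x := dist_pos.2 (Ne.symm hx)
      have : 0 < a x := by simp only [ha]; rw [hp2]; positivity
      exact this.ne'
  have hlim : Tendsto (fun t : ℝ => t⁻¹ * Real.arsinh t * ((1 + 2 * t ^ 2) / (2 * √(1 + t ^ 2)))
      - Real.arsinh t) (𝓝[≠] 0) (𝓝 (1 / 2)) := by
    have h1 : Tendsto (fun t : ℝ => t⁻¹ * Real.arsinh t) (𝓝[≠] 0) (𝓝 1) := by
      have := (Real.hasDerivAt_arsinh 0).tendsto_slope_zero
      simpa using this
    have h2 : Tendsto (fun t : ℝ => (1 + 2 * t ^ 2) / (2 * √(1 + t ^ 2))) (𝓝[≠] 0) (𝓝 (1 / 2)) := by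
      have : ContinuousAt (fun t : ℝ => (1 + 2 * t ^ 2) / (2 * √(1 + t ^ 2))) 0 :=
        ContinuousAt.div (by fun_prop) (by fun_prop) (by simp)
      have h := this.tendsto.mono_left (nhdsWithin_le_nhds (s := {0}ᶜ))
      simpa using h
    have h3 : Tendsto Real.arsinh (𝓝[≠] 0) (𝓝 0) := by
      have h := (Real.continuous_arsinh.tendsto 0).mono_left (nhdsWithin_le_nhds (s := {0}ᶜ))
      simpa using h
    simpa using (h1.mul h2).sub h3
  refine (hlim.comp ha0).congr' ?_
  filter_upwards [self_mem_nhdsWithin, mem_nhdsWithin_of_mem_nhds (isOpen_H3.mem_nhds hpH),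
    ha0 self_mem_nhdsWithin] with x hx hxH hax
  have hx2 : 0 < x 2 := hxH
  have hne : a x ≠ 0 := hax
  have hdp : 0 < dist p x := dist_pos.2 (Ne.symm hx)
  have hpos : 0 < a x := by simp only [ha]; rw [hp2]; positivity
  have hd : dist p x ^ 2 = 4 * (c * x 2) * a x ^ 2 := by
    simp only [ha, div_pow, mul_pow]
    rw [hp2, Real.sq_sqrt (by positivity)]
    field_simp
    ring
  have hN : poleN c x = 2 * c * x 2 * (1 + 2 * a x ^ 2) := by
    have := norm_sub_axisPoint c x
    rw [← hp, hd] at this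
    rw [poleN]
    linarith
  have hD : poleD c x = 2 * c * x 2 * (2 * a x * √(1 + a x ^ 2)) := by
    have hsq : poleN c x ^ 2 - 4 * c ^ 2 * x 2 ^ 2 =
        (2 * c * x 2 * (2 * a x * √(1 + a x ^ 2))) ^ 2 := by
      rw [hN]
      simp only [mul_pow]
      rw [Real.sq_sqrt (by positivity)]
      ring
    rw [poleD, hsq, Real.sqrt_sq (by positivity)]
  have hS : 0 < √(1 + a x ^ 2) := by positivity
  have hdist : hypDist p x = 2 * Real.arsinh (a x) := rfl
  rw [Function.comp_apply, hdist, green, hN, hD]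
  field_simp

theorem isFundamentalSolution_green {c : ℝ} (hc : 0 < c) :
    IsFundamentalSolution (axisPoint c) (green c) where
  smooth := contDiffOn_green hc
  harmonic _ := harmonic_green hc
  pole := pole_green hc
  decay := decay_green hc

/-! ### Uniqueness of the fundamental solution -/

/-- A positive second derivative would make the critical point a local minimum as well, so the
function would be locally constant and its second derivative zero. -/
theorem IsLocalMax.second_deriv_nonpos {g : ℝ → ℝ} {t : ℝ} (h : IsLocalMax g t)
    (hg : ContinuousAt g t) : deriv (deriv g) t ≤ 0 := by
  by_contra! hpos
  have hmin := isLocalMin_of_deriv_deriv_pos hpos h.deriv_eq_zero hg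
  have hconst : g =ᶠ[𝓝 t] fun _ => g t := by
    filter_upwards [h, hmin] with s h1 h2 using le_antisymm h1 h2
  have : deriv g =ᶠ[𝓝 t] fun _ => 0 := by simpa using hconst.deriv
  rw [this.deriv_eq] at hpos
  simp at hpos

/-- At a critical point the first-order term drops out, and what remains is a sum of second
derivatives along the coordinate lines. -/
theorem IsLocalMax.hypLaplacian_nonpos {u : E3 → ℝ} {x : E3} (h : IsLocalMax u x)
    (hu : ContDiffAt ℝ 2 u x) : hypLaplacian u x ≤ 0 := by
  rw [hypLaplacian, h.fderiv_eq_zero, laplacian_eq_sum_fderiv hu]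
  simp only [zero_apply, mul_zero, sub_zero]
  refine mul_nonpos_of_nonneg_of_nonpos (by positivity) (Finset.sum_nonpos fun i _ => ?_)
  set e : E3 := EuclideanSpace.single i 1
  set l : ℝ → E3 := fun t => x + t • e with hl
  have hl0 : l 0 = x := by simp [hl]
  have hld : ∀ t, HasDerivAt l e t := fun t => by
    simpa [hl] using ((hasDerivAt_id t).smul_const e).const_add x
  have hlt : Tendsto l (𝓝 0) (𝓝 x) := by
    have := (hld 0).continuousAt.tendsto
    rwa [hl0] at this
  have hmax : IsLocalMax (u ∘ l) 0 := by
    have := hlt.eventually h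
    rw [← hl0] at this
    exact this
  have hcont : ContinuousAt (u ∘ l) 0 := by
    refine ContinuousAt.comp ?_ (hld 0).continuousAt
    rw [hl0]; exact hu.continuousAt
  have hder : deriv (u ∘ l) =ᶠ[𝓝 0] fun t => fderiv ℝ u (l t) e := by
    have h1 : ∀ᶠ y in 𝓝 x, DifferentiableAt ℝ u y :=
      (hu.eventually (by simp)).mono fun y hy => hy.differentiableAt (by norm_num)
    filter_upwards [hlt.eventually h1] with t ht
    exact (ht.hasFDerivAt.comp_hasDerivAt t (hld t)).deriv
  have hd2 : DifferentiableAt ℝ (fun y => fderiv ℝ u y e) x :=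
    ((hu.fderiv_right (m := 1) (by norm_num)).differentiableAt (by norm_num)).clm_apply
      (differentiableAt_const _)
  have h2 := IsLocalMax.second_deriv_nonpos hmax hcont
  rw [hder.deriv_eq] at h2
  rw [← hl0] at hd2
  have h3 := (hd2.hasFDerivAt.comp_hasDerivAt 0 (hld 0)).deriv
  rw [hl0] at h3
  rw [← h3]
  exact h2

theorem hypLaplacian_add_smul {u v : E3 → ℝ} {x : E3} (hu : ContDiffAt ℝ 2 u x)
    (hv : ContDiffAt ℝ 2 v x) (k : ℝ) :
    hypLaplacian (u + k • v) x = hypLaplacian u x + k * hypLaplacian v x := by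
  have hkv : ContDiffAt ℝ 2 (k • v) x := by exact hv.const_smul k
  rw [hypLaplacian, hu.laplacian_add hkv, fderiv_add (hu.differentiableAt (by norm_num))
    (hkv.differentiableAt (by norm_num)), InnerProductSpace.laplacian_smul k hv,
    fderiv_const_smul (hv.differentiableAt (by norm_num)), hypLaplacian, hypLaplacian]
  simp; ring

/-- This makes `-δz` strictly subharmonic on the half-space; it is the perturbation used in the
maximum principle. -/
theorem hypLaplacian_coord (x : E3) : hypLaplacian (coord 2) x = -x 2 := by
  have h : ContDiffAt ℝ 2 (coord 2) x := (coord 2).contDiff.contDiffAt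
  rw [hypLaplacian, laplacian_eq_sum_fderiv h]
  simp only [ContinuousLinearMap.fderiv]
  simp

/-- The weak maximum principle on punctured hyperbolic space. -/
theorem nonpos_of_hypLaplacian_eq_zero {p : E3} {u : E3 → ℝ} (hu : ContDiffOn ℝ 2 u (H3 \ {p}))
    (harm : ∀ x ∈ H3 \ {p}, hypLaplacian u x = 0) (hpole : ∀ᶠ x in 𝓝[≠] p, u x < 0)
    (hdecay : ∀ ε > 0, ∃ K ⊆ H3, IsCompact K ∧ ∀ x ∈ H3 \ K, u x < ε) :
    ∀ x ∈ H3 \ {p}, u x ≤ 0 := by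
  intro x₀ hx₀
  by_contra! hpos
  obtain ⟨K, hKH, hK, hKu⟩ := hdecay (u x₀ / 2) (by positivity)
  obtain ⟨O, hO, hpO, hOu⟩ := mem_nhdsWithin.1 hpole
  -- All points where u is at least half the supposed positive value lie in this compact set, away
  -- from infinity and from the pole.
  have hK' : IsCompact (K \ O) := hK.diff hO
  have hsub : K \ O ⊆ H3 \ {p} := fun x hx => ⟨hKH hx.1, fun h => hx.2 (by rw [h]; exact hpO)⟩
  have hlarge : ∀ x ∈ H3 \ {p}, u x₀ / 2 ≤ u x → x ∈ K \ O := by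
    intro x hx hux
    refine ⟨by_contra fun h => (hKu x ⟨hx.1, h⟩).not_ge hux, fun h => ?_⟩
    have : u x < 0 := hOu ⟨h, hx.2⟩
    linarith
  have hcoord : Continuous fun x : E3 => x 2 := (coord 2).continuous
  obtain ⟨C, hC⟩ := (hK.image hcoord).bddAbove
  have hC' : ∀ x ∈ K, x 2 ≤ C := fun x hx => hC (mem_image_of_mem _ hx)
  have hx₀K := hlarge x₀ hx₀ (by linarith)
  have hCpos : 0 < C := lt_of_lt_of_le hx₀.1 (hC' _ hx₀K.1)
  -- C bounds the height on K, so the perturbation is at most `u x₀ / 4` there. A maximum of `u -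
  -- δz` then still has `u > u x₀ / 2`, hence is a genuine local maximum.
  set δ := u x₀ / (4 * C) with hδ
  have hδpos : 0 < δ := by positivity
  set w : E3 → ℝ := u + (-δ) • (coord 2) with hw
  have hwapp : ∀ x, w x = u x - δ * x 2 := fun x => by simp [hw, sub_eq_add_neg]
  have hucont := hu.continuousOn
  have hwcont : ContinuousOn w (K \ O) :=
    (hucont.mono hsub).add (continuousOn_const.smul (coord 2).continuous.continuousOn)
  obtain ⟨x₁, hx₁, hmax⟩ := hK'.exists_isMaxOn ⟨x₀, hx₀K⟩ hwcont
  have hx₁' := hsub hx₁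
  have hδC : δ * C = u x₀ / 4 := by rw [hδ]; field_simp
  have h1 : u x₀ - δ * x₀ 2 ≤ u x₁ - δ * x₁ 2 := by
    have := hmax hx₀K
    simpa [hwapp] using this
  have h2 : δ * x₀ 2 ≤ u x₀ / 4 := by rw [← hδC]; gcongr; exact hC' _ hx₀K.1
  have h3 : 0 < δ * x₁ 2 := mul_pos hδpos hx₁'.1
  have hO₁ : H3 \ {p} ∈ 𝓝 x₁ := (isOpen_H3_diff p).mem_nhds hx₁'
  have hux₁ := hu.contDiffAt hO₁
  have hloc : IsLocalMax w x₁ := by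
    have : ∀ᶠ x in 𝓝 x₁, u x₀ / 2 < u x :=
      (hux₁.continuousAt.tendsto).eventually (lt_mem_nhds (by linarith))
    filter_upwards [this, hO₁] with x hx hxH
    exact hmax (hlarge x hxH hx.le)
  have hcd : ContDiffAt ℝ 2 (coord 2) x₁ := (coord 2).contDiff.contDiffAt
  -- At the maximum the Laplacian of `u - δz` is `δz > 0`, a contradiction.
  have hneg := IsLocalMax.hypLaplacian_nonpos hloc (hux₁.add (hcd.const_smul (-δ)))
  rw [hypLaplacian_add_smul hux₁ hcd, harm x₁ hx₁', hypLaplacian_coord] at hneg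
  linarith

/-- Both poles have the same leading coefficient, so `Γ - Γ'` has no evident sign near p. The factor
`1 + ε` makes `Γ - (1 + ε)Γ'` negative there: ρ times it tends to `-ε / 2`. The maximum principle
applies, and then ε tends to 0. -/
theorem IsFundamentalSolution.le_green {c : ℝ} (hc : 0 < c) {Γ Γ' : E3 → ℝ}
    (h : IsFundamentalSolution (axisPoint c) Γ) (h' : IsFundamentalSolution (axisPoint c) Γ')
    {x : E3} (hx : x ∈ H3 \ {axisPoint c}) : Γ x ≤ Γ' x := by
  set p := axisPoint c with hp
  have hpH : p ∈ H3 := by change 0 < p 2; simpa [hp, axisPoint] using hc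
  have key : ∀ ε : ℝ, 0 < ε → Γ x + (-(1 + ε)) * Γ' x ≤ 0 := by
    intro ε hε
    have hsm : ∀ {G : E3 → ℝ}, IsFundamentalSolution p G → ContDiffOn ℝ 2 G (H3 \ {p}) :=
      fun hG => hG.smooth.of_le two_le_infty
    have hk : ContDiffOn ℝ 2 ((-(1 + ε)) • Γ') (H3 \ {p}) := by
      exact (hsm h').const_smul (-(1 + ε))
    refine nonpos_of_hypLaplacian_eq_zero (p := p) (u := Γ + (-(1 + ε)) • Γ')
      ((hsm h).add hk) ?_ ?_ ?_ x hx
    · intro y hy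
      have hO := (isOpen_H3_diff p).mem_nhds hy
      rw [hypLaplacian_add_smul ((hsm h).contDiffAt hO) ((hsm h').contDiffAt hO),
        h.harmonic y hy, h'.harmonic y hy]
      simp
    · have hlim := h.pole.add (h'.pole.const_mul (-(1 + ε)))
      have hlt : (1 / 2 : ℝ) + (-(1 + ε)) * (1 / 2) < 0 := by linarith
      filter_upwards [hlim.eventually (gt_mem_nhds hlt), self_mem_nhdsWithin,
        mem_nhdsWithin_of_mem_nhds (isOpen_H3.mem_nhds hpH)] with y hy hne hyH
      have hρ : 0 < hypDist p y := by
        have h1 : 0 < p 2 := hpH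
        have h2 : 0 < y 2 := hyH
        have h3 : 0 < dist p y := dist_pos.2 (Ne.symm hne)
        have : 0 < Real.arsinh (dist p y / (2 * √(p 2 * y 2))) :=
          Real.arsinh_pos_iff.2 (by positivity)
        rw [hypDist]; positivity
      have : hypDist p y * (Γ y + (-(1 + ε)) * Γ' y) < 0 := by linarith
      exact (pos_iff_neg_of_mul_neg this).1 hρ
    · intro η hη
      obtain ⟨K, hKH, hK, hKu⟩ := h.decay (η / 2) (by positivity)
      obtain ⟨K', hKH', hK', hKu'⟩ := h'.decay (η / (2 * (1 + ε))) (by positivity)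
      refine ⟨K ∪ K', union_subset hKH hKH', hK.union hK', fun y hy => ?_⟩
      have h1 := (abs_lt.1 (hKu y ⟨hy.1, fun hh => hy.2 (Or.inl hh)⟩)).2
      have h2 := (abs_lt.1 (hKu' y ⟨hy.1, fun hh => hy.2 (Or.inr hh)⟩)).1
      have h3 : (1 + ε) * (η / (2 * (1 + ε))) = η / 2 := by field_simp
      have h4 : (1 + ε) * (-(η / (2 * (1 + ε)))) < (1 + ε) * Γ' y := by gcongr
      simp only [Pi.add_apply, Pi.smul_apply, smul_eq_mul]
      linarith
  have hlim : Tendsto (fun ε : ℝ => Γ x + (-(1 + ε)) * Γ' x) (𝓝[>] 0) (𝓝 (Γ x + (-(1 + 0)) * Γ' x)) :=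
    (Continuous.tendsto (by fun_prop) 0).mono_left nhdsWithin_le_nhds
  have := le_of_tendsto hlim (by filter_upwards [self_mem_nhdsWithin] with ε hε using key ε hε)
  linarith

theorem IsFundamentalSolution.eqOn_green {c : ℝ} (hc : 0 < c) {Γ : E3 → ℝ}
    (h : IsFundamentalSolution (axisPoint c) Γ) : EqOn Γ (green c) (H3 \ {axisPoint c}) :=
  fun _ hx => le_antisymm (h.le_green hc (isFundamentalSolution_green hc) hx)
    ((isFundamentalSolution_green hc).le_green hc h hx)

/-! ### The domains -/

theorem mem_U_iff {x : E3} : x ∈ U ↔ x ∈ H3 ∧ (x 0 = 0 → x 1 ≠ 0) := by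
  simp [U]

theorem mem_U₁_iff {c : ℝ} {x : E3} : x ∈ U₁ c ↔ x ∈ H3 ∧ (x 0 = 0 → x 1 = 0 → x 2 < c) := by
  simp only [U₁, mem_union, mem_U_iff, mem_ofPred_eq, eq_axisPoint_iff, H3]
  constructor
  · rintro (⟨h, h'⟩ | ⟨z, hz, hzc, -, -, h2⟩)
    · exact ⟨h, fun h0 h1 => absurd h1 (h' h0)⟩
    · exact ⟨h2 ▸ hz, fun _ _ => h2 ▸ hzc⟩
  · rintro ⟨h, h'⟩
    by_cases hax : x 0 = 0 ∧ x 1 = 0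
    · exact Or.inr ⟨x 2, h, h' hax.1 hax.2, hax.1, hax.2, rfl⟩
    · exact Or.inl ⟨h, fun h0 h1 => hax ⟨h0, h1⟩⟩

theorem mem_U₂_iff {c₁ c₂ : ℝ} (h₁ : 0 < c₁) {x : E3} :
    x ∈ U₂ c₁ c₂ ↔ x ∈ H3 ∧ (x 0 = 0 → x 1 = 0 → c₁ < x 2 ∧ x 2 < c₂) := by
  simp only [U₂, mem_union, mem_U_iff, mem_ofPred_eq, eq_axisPoint_iff, H3]
  constructor
  · rintro (⟨h, h'⟩ | ⟨z, hz, hzc, -, -, h2⟩)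
    · exact ⟨h, fun h0 h1 => absurd h1 (h' h0)⟩
    · exact ⟨h2 ▸ h₁.trans hz, fun _ _ => h2 ▸ ⟨hz, hzc⟩⟩
  · rintro ⟨h, h'⟩
    by_cases hax : x 0 = 0 ∧ x 1 = 0
    · exact Or.inr ⟨x 2, (h' hax.1 hax.2).1, (h' hax.1 hax.2).2, hax.1, hax.2, rfl⟩
    · exact Or.inl ⟨h, fun h0 h1 => hax ⟨h0, h1⟩⟩

theorem mem_U₃_iff {c : ℝ} (hc : 0 < c) {x : E3} :
    x ∈ U₃ c ↔ x ∈ H3 ∧ (x 0 = 0 → x 1 = 0 → c < x 2) := by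
  simp only [U₃, mem_union, mem_U_iff, mem_ofPred_eq, eq_axisPoint_iff, H3]
  constructor
  · rintro (⟨h, h'⟩ | ⟨z, hz, -, -, h2⟩)
    · exact ⟨h, fun h0 h1 => absurd h1 (h' h0)⟩
    · exact ⟨h2 ▸ hc.trans hz, fun _ _ => h2 ▸ hz⟩
  · rintro ⟨h, h'⟩
    by_cases hax : x 0 = 0 ∧ x 1 = 0
    · exact Or.inr ⟨x 2, h' hax.1 hax.2, hax.1, hax.2, rfl⟩
    · exact Or.inl ⟨h, fun h0 h1 => hax ⟨h0, h1⟩⟩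

theorem mem_M_iff {c₁ c₂ : ℝ} {x : E3} :
    x ∈ M c₁ c₂ ↔ x ∈ H3 ∧ (x 0 = 0 → x 1 = 0 → x 2 ≠ c₁ ∧ x 2 ≠ c₂) := by
  simp only [M, Set.mem_sdiff, mem_insert_iff, mem_singleton_iff, eq_axisPoint_iff]
  tauto

theorem M_eq_union {c₁ c₂ : ℝ} (h₁ : 0 < c₁) (h₁₂ : c₁ < c₂) :
    M c₁ c₂ = U₁ c₁ ∪ U₂ c₁ c₂ ∪ U₃ c₂ := by
  ext x
  simp only [mem_union, mem_M_iff, mem_U₁_iff, mem_U₂_iff h₁, mem_U₃_iff (h₁.trans h₁₂)]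
  constructor
  · rintro ⟨h, h'⟩
    by_cases hax : x 0 = 0 ∧ x 1 = 0
    · obtain ⟨n1, n2⟩ := h' hax.1 hax.2
      rcases lt_or_gt_of_ne n1 with g | g
      · exact Or.inl (Or.inl ⟨h, fun _ _ => g⟩)
      rcases lt_or_gt_of_ne n2 with g' | g'
      · exact Or.inl (Or.inr ⟨h, fun _ _ => ⟨g, g'⟩⟩)
      · exact Or.inr ⟨h, fun _ _ => g'⟩
    · exact Or.inl (Or.inl ⟨h, fun h0 h1 => absurd ⟨h0, h1⟩ hax⟩)
  · rintro ((⟨h, h'⟩ | ⟨h, h'⟩) | ⟨h, h'⟩)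
    · exact ⟨h, fun h0 h1 => ⟨(h' h0 h1).ne, ((h' h0 h1).trans h₁₂).ne⟩⟩
    · exact ⟨h, fun h0 h1 => ⟨(h' h0 h1).1.ne', (h' h0 h1).2.ne⟩⟩
    · exact ⟨h, fun h0 h1 => ⟨(h₁₂.trans (h' h0 h1)).ne', (h' h0 h1).ne'⟩⟩

/-- The half-space minus a closed part of the axis. `U` and the three patches all have this shape,
with P cutting out the part of the axis that is kept. -/
theorem isOpen_axis_condition {P : ℝ → Prop} (hP : IsOpen {t | P t}) :
    IsOpen {x : E3 | x ∈ H3 ∧ (x 0 = 0 → x 1 = 0 → P (x 2))} := by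
  have h0 : Continuous fun x : E3 => x 0 := (coord 0).continuous
  have h1 : Continuous fun x : E3 => x 1 := (coord 1).continuous
  have h2 : Continuous fun x : E3 => x 2 := (coord 2).continuous
  have : {x : E3 | x ∈ H3 ∧ (x 0 = 0 → x 1 = 0 → P (x 2))} =
      H3 ∩ ({x : E3 | x 0 ≠ 0} ∪ {x : E3 | x 1 ≠ 0} ∪ {x : E3 | P (x 2)}) := by
    ext x
    simp only [mem_ofPred_eq, mem_inter_iff, mem_union, ne_eq]
    tauto
  rw [this]
  exact isOpen_H3.inter (((isOpen_ne_fun h0 continuous_const).union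
    (isOpen_ne_fun h1 continuous_const)).union (hP.preimage h2))

theorem isOpen_U₁ (c : ℝ) : IsOpen (U₁ c) := by
  convert isOpen_axis_condition (P := fun t => t < c) isOpen_Iio using 1
  ext x; exact mem_U₁_iff

theorem isOpen_U₂ {c₁ c₂ : ℝ} (h₁ : 0 < c₁) : IsOpen (U₂ c₁ c₂) := by
  convert isOpen_axis_condition (P := fun t => c₁ < t ∧ t < c₂) isOpen_Ioo using 1
  ext x; exact mem_U₂_iff h₁

theorem isOpen_U₃ {c : ℝ} (hc : 0 < c) : IsOpen (U₃ c) := by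
  convert isOpen_axis_condition (P := fun t => c < t) isOpen_Ioi using 1
  ext x; exact mem_U₃_iff hc

theorem isOpen_U : IsOpen U := by
  convert isOpen_axis_condition (P := fun _ => False) (by simp) using 1
  ext x; rw [mem_U_iff]; rfl

/-- Identities between continuous quantities, verified off the axis, extend across it. -/
theorem H3_subset_closure_U : H3 ⊆ closure U := by
  intro x hx
  by_cases hax : x 0 = 0 ∧ x 1 = 0
  · have hlim : Tendsto (fun t : ℝ => x + t • (EuclideanSpace.single 0 1 : E3)) (𝓝[≠] 0) (𝓝 x) := by
      have : Tendsto (fun t : ℝ => x + t • (EuclideanSpace.single 0 1 : E3)) (𝓝 0)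
          (𝓝 (x + (0 : ℝ) • (EuclideanSpace.single 0 1 : E3))) :=
        Continuous.tendsto (by fun_prop) 0
      simp only [zero_smul, add_zero] at this
      exact this.mono_left nhdsWithin_le_nhds
    refine mem_closure_of_tendsto hlim ?_
    filter_upwards [self_mem_nhdsWithin] with t ht
    rw [mem_U_iff]
    refine ⟨?_, fun h0 => absurd h0 ?_⟩
    · change 0 < (x + t • (EuclideanSpace.single 0 1 : E3)) 2
      have hx' : 0 < x 2 := hx
      simpa using hx'
    · simpa [hax.1] using ht
  · exact subset_closure ⟨hx, hax⟩

/-! ### The real gauge forms -/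

theorem f_eq (c₁ c₂ : ℝ) (x : E3) : f c₁ c₂ x = fPole c₁ x + fPole c₂ x := by
  have hr : cylR x ^ 2 = x 0 ^ 2 + x 1 ^ 2 := Real.sq_sqrt (by positivity)
  simp only [f, fc, hr, fPole, poleD, poleN]
  congr 2 <;> ring

/-- The form `x dy - y dx`. -/
def rotForm (x : E3) : E3 →L[ℝ] ℝ := x 0 • coord 1 - x 1 • coord 0

theorem contDiff_rotForm : ContDiff ℝ ∞ rotForm := by
  have h (i : Fin 3) : ContDiff ℝ ∞ fun x : E3 => x i := (coord i).contDiff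
  exact ((h 0).smul contDiff_const).sub ((h 1).smul contDiff_const)

/-- The smooth function `(f_c - 1/2) / r²` on the complement of the axis above `c`. -/
def fPoleLow (c : ℝ) (x : E3) : ℝ := -2 * c ^ 2 / (poleD c x * (poleD c x + (2 * c ^ 2 - poleN c x)))

/-- The smooth function `(f_c + 1/2) / r²` on the complement of the axis below `c`. -/
def fPoleHigh (c : ℝ) (x : E3) : ℝ := 2 * c ^ 2 / (poleD c x * (poleD c x - (2 * c ^ 2 - poleN c x)))

/-- Hence `|2c² - N| ≤ D` with equality only on the axis. This is why `f_c` is ±1/2 there, and it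
exhibits r² as a factor when a numerator `(2c² - N) ∓ D` is rationalized. -/
theorem poleD_sq' {c : ℝ} (hc : 0 < c) {x : E3} (hx : x ∈ H3 \ {axisPoint c}) :
    poleD c x ^ 2 = (2 * c ^ 2 - poleN c x) ^ 2 + 4 * c ^ 2 * (x 0 ^ 2 + x 1 ^ 2) := by
  rw [poleD_sq hc hx, poleN]; ring

/-- Off the axis `|2c² - N| < D`; on the axis below the pole `2c² - N = c² - z²` is itself positive.
-/
theorem low_pos {c : ℝ} (hc : 0 < c) {x : E3} (hx : x ∈ H3) (h : x 0 = 0 → x 1 = 0 → x 2 < c) :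
    x ∈ H3 \ {axisPoint c} ∧ 0 < poleD c x + (2 * c ^ 2 - poleN c x) := by
  have hx' : x ∈ H3 \ {axisPoint c} := ⟨hx, fun hp => by
    obtain ⟨h0, h1, h2⟩ := eq_axisPoint_iff.1 hp
    exact (h h0 h1).ne h2⟩
  refine ⟨hx', ?_⟩
  have hD := poleD_pos hc hx'
  have hs := poleD_sq' hc hx'
  have hz : 0 < x 2 := hx
  by_cases hax : x 0 = 0 ∧ x 1 = 0
  · have := h hax.1 hax.2
    have : 0 < 2 * c ^ 2 - poleN c x := by rw [poleN, hax.1, hax.2]; nlinarith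
    linarith
  · have hr : 0 < x 0 ^ 2 + x 1 ^ 2 := by
      rcases not_and_or.1 hax with h | h <;> positivity
    have : |2 * c ^ 2 - poleN c x| < poleD c x := by
      refine abs_lt_of_sq_lt_sq ?_ hD.le
      rw [hs]; nlinarith [mul_pos (pow_pos hc 2) hr]
    linarith [(abs_lt.1 this).1]

theorem high_pos {c : ℝ} (hc : 0 < c) {x : E3} (hx : x ∈ H3) (h : x 0 = 0 → x 1 = 0 → c < x 2) :
    x ∈ H3 \ {axisPoint c} ∧ 0 < poleD c x - (2 * c ^ 2 - poleN c x) := by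
  have hx' : x ∈ H3 \ {axisPoint c} := ⟨hx, fun hp => by
    obtain ⟨h0, h1, h2⟩ := eq_axisPoint_iff.1 hp
    exact (h h0 h1).ne' h2⟩
  refine ⟨hx', ?_⟩
  have hD := poleD_pos hc hx'
  have hs := poleD_sq' hc hx'
  have hz : 0 < x 2 := hx
  by_cases hax : x 0 = 0 ∧ x 1 = 0
  · have := h hax.1 hax.2
    have : 2 * c ^ 2 - poleN c x < 0 := by rw [poleN, hax.1, hax.2]; nlinarith
    linarith
  · have hr : 0 < x 0 ^ 2 + x 1 ^ 2 := by
      rcases not_and_or.1 hax with h | h <;> positivity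
    have : |2 * c ^ 2 - poleN c x| < poleD c x := by
      refine abs_lt_of_sq_lt_sq ?_ hD.le
      rw [hs]; nlinarith [mul_pos (pow_pos hc 2) hr]
    linarith [(abs_lt.1 this).2]

theorem contDiffOn_fPoleLow {c : ℝ} (hc : 0 < c) {W : Set E3}
    (hW : ∀ x ∈ W, x ∈ H3 ∧ (x 0 = 0 → x 1 = 0 → x 2 < c)) : ContDiffOn ℝ ∞ (fPoleLow c) W := by
  have hD := (contDiffOn_poleD hc).mono fun x hx => (low_pos hc (hW x hx).1 (hW x hx).2).1
  have hN := (contDiff_poleN c).contDiffOn (s := W)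
  refine contDiffOn_const.div (hD.mul (hD.add (contDiffOn_const.sub hN))) fun x hx => ?_
  have h := low_pos hc (hW x hx).1 (hW x hx).2
  exact (mul_pos (poleD_pos hc h.1) h.2).ne'

theorem contDiffOn_fPoleHigh {c : ℝ} (hc : 0 < c) {W : Set E3}
    (hW : ∀ x ∈ W, x ∈ H3 ∧ (x 0 = 0 → x 1 = 0 → c < x 2)) : ContDiffOn ℝ ∞ (fPoleHigh c) W := by
  have hD := (contDiffOn_poleD hc).mono fun x hx => (high_pos hc (hW x hx).1 (hW x hx).2).1
  have hN := (contDiff_poleN c).contDiffOn (s := W)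
  refine contDiffOn_const.div (hD.mul (hD.sub (contDiffOn_const.sub hN))) fun x hx => ?_
  have h := high_pos hc (hW x hx).1 (hW x hx).2
  exact (mul_pos (poleD_pos hc h.1) h.2).ne'

/-- Rationalization: `(2c² - N) - D = -4c²r² / (D + (2c² - N))`, whose denominator is positive by
`low_pos`. -/
theorem fPole_eq_low {c : ℝ} (hc : 0 < c) {x : E3} (hx : x ∈ H3)
    (h : x 0 = 0 → x 1 = 0 → x 2 < c) :
    fPole c x = 1 / 2 + (x 0 ^ 2 + x 1 ^ 2) * fPoleLow c x := by
  obtain ⟨hx', hp⟩ := low_pos hc hx h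
  have hD := poleD_pos hc hx'
  have hs := poleD_sq' hc hx'
  rw [fPole, fPoleLow]
  field_simp
  linear_combination (-1 : ℝ) * hs

theorem fPole_eq_high {c : ℝ} (hc : 0 < c) {x : E3} (hx : x ∈ H3)
    (h : x 0 = 0 → x 1 = 0 → c < x 2) :
    fPole c x = -(1 / 2) + (x 0 ^ 2 + x 1 ^ 2) * fPoleHigh c x := by
  obtain ⟨hx', hp⟩ := high_pos hc hx h
  have hD := poleD_pos hc hx'
  have hs := poleD_sq' hc hx'
  rw [fPole, fPoleHigh]
  field_simp
  linear_combination hs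

/-- The real one-form `(k + f) dθ₃`. -/
def realGaugeForm (c₁ c₂ k : ℝ) (x : E3) : E3 →L[ℝ] ℝ := (k + f c₁ c₂ x) • dθ₃ x

/-- The factor r² cancels the singularity of dθ₃. On the axis both sides are zero: the left because
division by zero gives 0, the right because `rotForm` vanishes there. -/
theorem smul_dθ₃_eq {h g : ℝ} {x : E3} (e : h = (x 0 ^ 2 + x 1 ^ 2) * g) :
    h • dθ₃ x = g • rotForm x := by
  change h • ((x 0 ^ 2 + x 1 ^ 2)⁻¹ • rotForm x) = _
  by_cases hax : x 0 = 0 ∧ x 1 = 0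
  · have : rotForm x = 0 := by simp [rotForm, hax]
    simp [this]
  · have hr : x 0 ^ 2 + x 1 ^ 2 ≠ 0 := by
      rcases not_and_or.1 hax with h | h <;> positivity
    rw [smul_smul, e]
    congr 1
    field_simp

/-- Below both poles the axis values of the two `f_c` are 1/2 and 1/2, between them -1/2 and 1/2,
above both -1/2 and -1/2. The constants -1, 0, 1 cancel these sums and leave a smooth multiple of
r². -/
theorem contDiffOn_realGaugeForm_U₁ {c₁ c₂ : ℝ} (h₁ : 0 < c₁) (h₁₂ : c₁ < c₂) :
    ContDiffOn ℝ ∞ (realGaugeForm c₁ c₂ (-1)) (U₁ c₁) := by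
  have hW : ∀ x ∈ U₁ c₁, x ∈ H3 ∧ (x 0 = 0 → x 1 = 0 → x 2 < c₁) := fun x hx => mem_U₁_iff.1 hx
  have hW' : ∀ x ∈ U₁ c₁, x ∈ H3 ∧ (x 0 = 0 → x 1 = 0 → x 2 < c₂) := fun x hx =>
    ⟨(hW x hx).1, fun h0 h1 => ((hW x hx).2 h0 h1).trans h₁₂⟩
  refine (((contDiffOn_fPoleLow h₁ hW).add (contDiffOn_fPoleLow (h₁.trans h₁₂) hW')).smul
    contDiff_rotForm.contDiffOn).congr fun x hx => smul_dθ₃_eq ?_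
  rw [f_eq, fPole_eq_low h₁ (hW x hx).1 (hW x hx).2,
    fPole_eq_low (h₁.trans h₁₂) (hW' x hx).1 (hW' x hx).2]
  ring

theorem contDiffOn_realGaugeForm_U₂ {c₁ c₂ : ℝ} (h₁ : 0 < c₁) (h₁₂ : c₁ < c₂) :
    ContDiffOn ℝ ∞ (realGaugeForm c₁ c₂ 0) (U₂ c₁ c₂) := by
  have hW : ∀ x ∈ U₂ c₁ c₂, x ∈ H3 ∧ (x 0 = 0 → x 1 = 0 → c₁ < x 2) := fun x hx =>
    ⟨((mem_U₂_iff h₁).1 hx).1, fun h0 h1 => (((mem_U₂_iff h₁).1 hx).2 h0 h1).1⟩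
  have hW' : ∀ x ∈ U₂ c₁ c₂, x ∈ H3 ∧ (x 0 = 0 → x 1 = 0 → x 2 < c₂) := fun x hx =>
    ⟨((mem_U₂_iff h₁).1 hx).1, fun h0 h1 => (((mem_U₂_iff h₁).1 hx).2 h0 h1).2⟩
  refine (((contDiffOn_fPoleHigh h₁ hW).add (contDiffOn_fPoleLow (h₁.trans h₁₂) hW')).smul
    contDiff_rotForm.contDiffOn).congr fun x hx => smul_dθ₃_eq ?_
  rw [f_eq, fPole_eq_high h₁ (hW x hx).1 (hW x hx).2,
    fPole_eq_low (h₁.trans h₁₂) (hW' x hx).1 (hW' x hx).2]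
  ring

theorem contDiffOn_realGaugeForm_U₃ {c₁ c₂ : ℝ} (h₁ : 0 < c₁) (h₁₂ : c₁ < c₂) :
    ContDiffOn ℝ ∞ (realGaugeForm c₁ c₂ 1) (U₃ c₂) := by
  have hW' : ∀ x ∈ U₃ c₂, x ∈ H3 ∧ (x 0 = 0 → x 1 = 0 → c₂ < x 2) := fun x hx =>
    (mem_U₃_iff (h₁.trans h₁₂)).1 hx
  have hW : ∀ x ∈ U₃ c₂, x ∈ H3 ∧ (x 0 = 0 → x 1 = 0 → c₁ < x 2) := fun x hx =>
    ⟨(hW' x hx).1, fun h0 h1 => h₁₂.trans ((hW' x hx).2 h0 h1)⟩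
  refine (((contDiffOn_fPoleHigh h₁ hW).add (contDiffOn_fPoleHigh (h₁.trans h₁₂) hW')).smul
    contDiff_rotForm.contDiffOn).congr fun x hx => smul_dθ₃_eq ?_
  rw [f_eq, fPole_eq_high h₁ (hW x hx).1 (hW x hx).2,
    fPole_eq_high (h₁.trans h₁₂) (hW' x hx).1 (hW' x hx).2]
  ring

theorem ContDiffOn.iMul_comp {α : E3 → E3 →L[ℝ] ℝ} {W : Set E3} {n : WithTop ℕ∞}
    (h : ContDiffOn ℝ n α W) : ContDiffOn ℝ n (fun x => iMul.comp (α x)) W :=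
  contDiffOn_const.clm_comp h

theorem dOne_iMul_comp {α : E3 → E3 →L[ℝ] ℝ} {x : E3} (h : DifferentiableAt ℝ α x) :
    dOne (fun y => iMul.comp (α y)) x = iMul.compContinuousAlternatingMap (dOne α x) := by
  have hd : HasFDerivAt (fun y => iMul.comp (α y))
      ((ContinuousLinearMap.compL ℝ E3 ℝ ℂ iMul).comp (fderiv ℝ α x)) x :=
    ((ContinuousLinearMap.compL ℝ E3 ℝ ℂ iMul).hasFDerivAt (x := α x)).comp x h.hasFDerivAt
  ext v
  rw [dOne_apply hd.differentiableAt, hd.fderiv]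
  simp [dOne_apply h]

/-! ### The curvature identity `d((k + f) dθ₃) = *dV` -/

theorem hasFDerivAt_potential {c₁ c₂ : ℝ} (h₁ : 0 < c₁) (h₂ : 0 < c₂) {Γ₁ Γ₂ : E3 → ℝ}
    (hΓ₁ : IsFundamentalSolution (axisPoint c₁) Γ₁) (hΓ₂ : IsFundamentalSolution (axisPoint c₂) Γ₂)
    {x : E3} (hx : x ∈ M c₁ c₂) :
    HasFDerivAt (potential Γ₁ Γ₂) (fderiv ℝ (green c₁) x + fderiv ℝ (green c₂) x) x := by
  have hx₁ : x ∈ H3 \ {axisPoint c₁} := ⟨hx.1, fun h => hx.2 (Or.inl h)⟩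
  have hx₂ : x ∈ H3 \ {axisPoint c₂} := ⟨hx.1, fun h => hx.2 (Or.inr h)⟩
  have h := (((hasFDerivAt_green h₁ hx₁).differentiableAt.hasFDerivAt).const_add 1).add
    ((hasFDerivAt_green h₂ hx₂).differentiableAt.hasFDerivAt)
  refine h.congr_of_eventuallyEq ?_
  filter_upwards [(isOpen_H3_diff _).mem_nhds hx₁, (isOpen_H3_diff _).mem_nhds hx₂] with y hy₁ hy₂
  simp [potential, hΓ₁.eqOn_green h₁ hy₁, hΓ₂.eqOn_green h₂ hy₂]

theorem toDual_symm_coord (α : E3 →L[ℝ] ℝ) (i : Fin 3) :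
    (InnerProductSpace.toDual ℝ E3).symm α i = α (EuclideanSpace.single i 1) := by
  rw [← InnerProductSpace.toDual_symm_apply (𝕜 := ℝ), EuclideanSpace.inner_single_right]
  simp

/-- The factor `z⁻³` of the volume form and `z²` of the metric dual combine to `z⁻¹`; the sign is
that of the orientation. -/
theorem starD_apply {V : E3 → ℝ} {V' : E3 →L[ℝ] ℝ} {x : E3} (hx : x ∈ H3)
    (h : fderiv ℝ V x = V') (v : Fin 2 → E3) :
    starD V x v = -(x 2)⁻¹ * (V' (EuclideanSpace.single 0 1) * (v 0 1 * v 1 2 - v 0 2 * v 1 1)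
      - V' (EuclideanSpace.single 1 1) * (v 0 0 * v 1 2 - v 0 2 * v 1 0)
      + V' (EuclideanSpace.single 2 1) * (v 0 0 * v 1 1 - v 0 1 * v 1 0)) := by
  have hz : x 2 ≠ 0 := ne_of_gt hx
  change hypVol x (Matrix.vecCons (hypSharp x (fderiv ℝ V x)) v) = _
  rw [hypVol_apply, Matrix.det_fin_three, h]
  simp [hypSharp, toDual_symm_coord]
  field_simp
  ring

/-- Since dθ₃ is closed off the axis, only `dh ∧ dθ₃` remains. -/
theorem dOne_smul_dθ₃ {h : E3 → ℝ} {h' : E3 →L[ℝ] ℝ} {x : E3} (hx : x ∈ U)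
    (hh : HasFDerivAt h h' x) (v : Fin 2 → E3) :
    dOne (fun y => h y • dθ₃ y) x v =
      (h' (v 0) * (x 0 * v 1 1 - x 1 * v 1 0) - h' (v 1) * (x 0 * v 0 1 - x 1 * v 0 0)) /
        (x 0 ^ 2 + x 1 ^ 2) := by
  have hr : x 0 ^ 2 + x 1 ^ 2 ≠ 0 := by
    rcases not_and_or.1 hx.2 with h | h <;> positivity
  have hrd := ((hasFDerivAt_coord 0 x).pow 2).add ((hasFDerivAt_coord 1 x).pow 2)
  have hrot : DifferentiableAt ℝ rotForm x := contDiff_rotForm.differentiable (by simp) x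
  have hd : DifferentiableAt ℝ (fun y => h y • dθ₃ y) x :=
    hh.differentiableAt.smul ((hrd.differentiableAt.inv hr).smul hrot)
  have key : ∀ w u : E3, fderiv ℝ (fun y => h y • dθ₃ y) x u w =
      h' u * ((x 0 * w 1 - x 1 * w 0) / (x 0 ^ 2 + x 1 ^ 2)) + h x *
      ((x 0 ^ 2 + x 1 ^ 2)⁻¹ * (u 0 * w 1 - u 1 * w 0) -
        (x 0 * w 1 - x 1 * w 0) / (x 0 ^ 2 + x 1 ^ 2) ^ 2 * (2 * x 0 * u 0 + 2 * x 1 * u 1)) := by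
    intro w u
    have h1 : fderiv ℝ (fun y => h y • dθ₃ y) x u w = fderiv ℝ (fun y => (h y • dθ₃ y) w) x u := by
      rw [fderiv_clm_apply hd (differentiableAt_const _)]
      simp
    have h2 := hh.mul (HasFDerivAt.div_real (((hasFDerivAt_coord 0 x).mul_const (w 1)).sub
      ((hasFDerivAt_coord 1 x).mul_const (w 0))) hrd hr)
    have h3 : (fun y => (h y • dθ₃ y) w) =
        h * fun y => (y 0 * w 1 - y 1 * w 0) / (y 0 ^ 2 + y 1 ^ 2) := by
      ext y
      change h y * ((y 0 ^ 2 + y 1 ^ 2)⁻¹ * (y 0 * w 1 - y 1 * w 0)) =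
        h y * ((y 0 * w 1 - y 1 * w 0) / (y 0 ^ 2 + y 1 ^ 2))
      ring
    rw [h1, h3]
    refine (congrArg (fun L : E3 →L[ℝ] ℝ => L u) h2.fderiv).trans ?_
    simp
    field_simp
    ring
  rw [dOne_apply hd, key, key]
  field_simp
  ring

/-- The constant k contributes nothing as dθ₃ is closed; the rest is the conjugacy of `f_c` and
`green c`, read off from their derivatives. -/
theorem dOne_realGaugeForm_of_mem_U {c₁ c₂ : ℝ} (h₁ : 0 < c₁) (h₂ : 0 < c₂) (k : ℝ) {Γ₁ Γ₂ : E3 → ℝ}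
    (hΓ₁ : IsFundamentalSolution (axisPoint c₁) Γ₁) (hΓ₂ : IsFundamentalSolution (axisPoint c₂) Γ₂)
    {x : E3} (hx : x ∈ U) : dOne (realGaugeForm c₁ c₂ k) x = starD (potential Γ₁ Γ₂) x := by
  have hx₁ : x ∈ H3 \ {axisPoint c₁} := ⟨hx.1, fun h => hx.2
    ⟨(eq_axisPoint_iff.1 h).1, (eq_axisPoint_iff.1 h).2.1⟩⟩
  have hx₂ : x ∈ H3 \ {axisPoint c₂} := ⟨hx.1, fun h => hx.2
    ⟨(eq_axisPoint_iff.1 h).1, (eq_axisPoint_iff.1 h).2.1⟩⟩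
  have hxM : x ∈ M c₁ c₂ := ⟨hx.1, fun h => h.elim hx₁.2 hx₂.2⟩
  have hf := ((hasFDerivAt_fPole h₁ hx₁).add (hasFDerivAt_fPole h₂ hx₂)).const_add k
  have hform : realGaugeForm c₁ c₂ k = fun y => (k + (fPole c₁ + fPole c₂) y) • dθ₃ y := by
    ext y; simp [realGaugeForm, f_eq]
  have hr : x 0 ^ 2 + x 1 ^ 2 ≠ 0 := by
    rcases not_and_or.1 hx.2 with h | h <;> positivity
  have hz : x 2 ≠ 0 := ne_of_gt hx.1
  have hD₁ := (poleD_pos h₁ hx₁).ne'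
  have hD₂ := (poleD_pos h₂ hx₂).ne'
  ext v
  rw [hform]
  refine (dOne_smul_dθ₃ hx hf v).trans ?_
  rw [starD_apply hx.1 (hasFDerivAt_potential h₁ h₂ hΓ₁ hΓ₂ hxM).fderiv,
    (hasFDerivAt_green h₁ hx₁).fderiv, (hasFDerivAt_green h₂ hx₂).fderiv]
  simp
  field_simp
  ring

theorem M_open (c₁ c₂ : ℝ) : IsOpen (M c₁ c₂) :=
  isOpen_H3.sdiff (by simp)

theorem continuousOn_starD_potential {c₁ c₂ : ℝ} {Γ₁ Γ₂ : E3 → ℝ}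
    (hΓ₁ : IsFundamentalSolution (axisPoint c₁) Γ₁) (hΓ₂ : IsFundamentalSolution (axisPoint c₂) Γ₂)
    (v : Fin 2 → E3) : ContinuousOn (fun x => starD (potential Γ₁ Γ₂) x v) (M c₁ c₂) := by
  have hsub₁ : M c₁ c₂ ⊆ H3 \ {axisPoint c₁} := fun x hx => ⟨hx.1, fun h => hx.2 (Or.inl h)⟩
  have hsub₂ : M c₁ c₂ ⊆ H3 \ {axisPoint c₂} := fun x hx => ⟨hx.1, fun h => hx.2 (Or.inr h)⟩
  have hV : ContDiffOn ℝ ∞ (potential Γ₁ Γ₂) (M c₁ c₂) :=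
    (contDiffOn_const.add (hΓ₁.smooth.mono hsub₁)).add (hΓ₂.smooth.mono hsub₂)
  have hV' := hV.continuousOn_fderiv_of_isOpen (M_open c₁ c₂) (by simp)
  have h2 : Continuous fun x : E3 => x 2 := (coord 2).continuous
  have hinv : ContinuousOn (fun x : E3 => (x 2)⁻¹) (M c₁ c₂) :=
    h2.continuousOn.inv₀ fun x hx => ne_of_gt hx.1
  have happ (w : E3) : ContinuousOn (fun x => fderiv ℝ (potential Γ₁ Γ₂) x w) (M c₁ c₂) :=
    hV'.clm_apply continuousOn_const
  refine ContinuousOn.congr ?_ fun x hx => starD_apply hx.1 rfl v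
  exact hinv.neg.mul ((((happ _).mul continuousOn_const).sub ((happ _).mul continuousOn_const)).add
    ((happ _).mul continuousOn_const))

/-- The curvature identity, extended from `U` to an open set on which the gauge form is smooth. -/
theorem dOne_gaugeForm {c₁ c₂ : ℝ} (h₁ : 0 < c₁) (h₂ : 0 < c₂) {k : ℝ} {Γ₁ Γ₂ : E3 → ℝ}
    (hΓ₁ : IsFundamentalSolution (axisPoint c₁) Γ₁) (hΓ₂ : IsFundamentalSolution (axisPoint c₂) Γ₂)
    {W : Set E3} (hW : IsOpen W) (hUW : U ⊆ W) (hWM : W ⊆ M c₁ c₂)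
    (hsm : ContDiffOn ℝ ∞ (realGaugeForm c₁ c₂ k) W) {x : E3} (hx : x ∈ W) :
    dOne (gaugeForm c₁ c₂ k) x =
      iMul.compContinuousAlternatingMap (starD (potential Γ₁ Γ₂) x) := by
  have hd : ∀ y ∈ W, DifferentiableAt ℝ (realGaugeForm c₁ c₂ k) y := fun y hy =>
    (hsm.contDiffAt (hW.mem_nhds hy)).differentiableAt (by simp)
  have hfd := hsm.continuousOn_fderiv_of_isOpen hW (by simp)
  have key : dOne (realGaugeForm c₁ c₂ k) x = starD (potential Γ₁ Γ₂) x := by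
    ext v
    have heq : EqOn (fun y => dOne (realGaugeForm c₁ c₂ k) y v)
        (fun y => starD (potential Γ₁ Γ₂) y v) U := fun y hy => by
      simp only [dOne_realGaugeForm_of_mem_U h₁ h₂ k hΓ₁ hΓ₂ hy]
    -- Both sides are continuous on W and agree on its dense subset U.
    refine heq.of_subset_closure (t := W) ?_ ?_ hUW ?_ hx
    · refine ContinuousOn.congr ?_ fun y hy => dOne_apply (hd y hy) v
      exact ((hfd.clm_apply continuousOn_const).clm_apply continuousOn_const).sub
        ((hfd.clm_apply continuousOn_const).clm_apply continuousOn_const)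
    · exact (continuousOn_starD_potential hΓ₁ hΓ₂ v).mono hWM
    · exact fun y hy => H3_subset_closure_U (hWM hy).1
  rw [← key]
  exact dOne_iMul_comp (hd x hx)

/-! ### Circle-valued maps -/

theorem contMDiff_circle_coe : ContMDiff (𝓡 1) 𝓘(ℝ, ℂ) ∞ (fun a : Circle => (a : ℂ)) :=
  haveI : Fact (Module.finrank ℝ ℂ = 1 + 1) := ⟨Complex.finrank_real_complex⟩
  contMDiff_coe_sphere (E := ℂ) (n := 1)

theorem contMDiff_circle_mul :
    ContMDiff ((𝓡 1).prod (𝓡 1)) (𝓡 1) ∞ (fun a : Circle × Circle => a.1 * a.2) :=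
  (contMDiff_mul (𝓡 1) ω).of_le le_top

theorem contMDiff_circle_inv : ContMDiff (𝓡 1) (𝓡 1) ∞ (fun a : Circle => a⁻¹) :=
  (contMDiff_inv (𝓡 1) ω).of_le le_top

/-- The derivative of a map into a normed space, evaluated on tangent vectors. -/
def dval {E H N V : Type*} [NormedAddCommGroup E] [NormedSpace ℝ E] [TopologicalSpace H]
    (I : ModelWithCorners ℝ E H) [TopologicalSpace N] [ChartedSpace H N]
    [NormedAddCommGroup V] [NormedSpace ℝ V] (h : N → V) (x : N) : TangentSpace I x →L[ℝ] V :=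
  mfderiv I 𝓘(ℝ, V) h x

section Leibniz

variable {B : Set E3} {X : U1Bundle B} (A : Connection X)

/-- The tangent spaces at p and at q are different types with the same underlying model space.
Regarding both forms as functions on that space allows the base point to be rewritten. -/
theorem Connection.form_heq_apply {p q : X.Total} (h : p = q)
    (v : EuclideanSpace ℝ (Fin 3) × EuclideanSpace ℝ (Fin 1)) :
    (A.form p : (EuclideanSpace ℝ (Fin 3) × EuclideanSpace ℝ (Fin 1)) → ℂ) v =
    (A.form q : (EuclideanSpace ℝ (Fin 3) × EuclideanSpace ℝ (Fin 1)) → ℂ) v := by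
  rw [h]

theorem mdifferentiableAt_smul (q : Circle × X.Total) :
    MDifferentiableAt ((𝓡 1).prod J4) J4 (fun q : Circle × X.Total => q.1 • q.2) q :=
  X.smooth_smul.mdifferentiable (by simp) q

theorem mdifferentiableAt_smul_left (a : Circle) (p : X.Total) :
    MDifferentiableAt (𝓡 1) J4 (fun b : Circle => b • p) a :=
  (mdifferentiableAt_smul (a, p)).comp (I' := (𝓡 1).prod J4) a
    (mdifferentiableAt_id.prodMk mdifferentiableAt_const)

theorem mdifferentiableAt_smul_right (a : Circle) (p : X.Total) :
    MDifferentiableAt J4 J4 (fun q : X.Total => a • q) p :=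
  (mdifferentiableAt_smul (a, p)).comp (I' := (𝓡 1).prod J4) p
    (mdifferentiableAt_const.prodMk mdifferentiableAt_id)

theorem mdifferentiableAt_circle_exp (t : ℝ) : MDifferentiableAt 𝓘(ℝ, ℝ) (𝓡 1) Circle.exp t :=
  (contMDiff_circleExp (m := ∞)).mdifferentiable (by simp) t

theorem mdifferentiableAt_circle_coe (a : Circle) :
    MDifferentiableAt (𝓡 1) 𝓘(ℝ, ℂ) (fun a : Circle => (a : ℂ)) a :=
  contMDiff_circle_coe.mdifferentiable (by simp) a

theorem dval_coe_exp (t : ℝ) :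
    dval (𝓡 1) (fun a : Circle => (a : ℂ)) (Circle.exp t) (mfderiv 𝓘(ℝ, ℝ) (𝓡 1) Circle.exp t (1 : ℝ))
      = Circle.exp t * Complex.I := by
  have h1 := mfderiv_comp_apply (I := 𝓘(ℝ, ℝ)) (I' := 𝓡 1) (I'' := 𝓘(ℝ, ℂ)) t
    (mdifferentiableAt_circle_coe (Circle.exp t)) (mdifferentiableAt_circle_exp t) (1 : ℝ)
  have h2 : HasDerivAt ((fun a : Circle => (a : ℂ)) ∘ Circle.exp) (Circle.exp t * Complex.I) t := by
    have h := ((Complex.ofRealCLM.hasDerivAt (x := t)).mul_const Complex.I).cexp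
    simpa [Function.comp_def, Circle.coe_exp] using h
  refine h1.symm.trans ?_
  rw [mfderiv_eq_fderiv]
  exact h2.deriv

theorem exists_eq_smul_mfderiv_exp (t : ℝ) (ξ : TangentSpace (𝓡 1) (Circle.exp t)) :
    ∃ r : ℝ, ξ = r • (mfderiv 𝓘(ℝ, ℝ) (𝓡 1) Circle.exp t (1 : ℝ) :
      TangentSpace (𝓡 1) (Circle.exp t)) := by
  have hne : (mfderiv 𝓘(ℝ, ℝ) (𝓡 1) Circle.exp t (1 : ℝ) : TangentSpace (𝓡 1) (Circle.exp t)) ≠ 0 := by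
    intro h0
    have hcoe := dval_coe_exp t
    rw [h0, map_zero] at hcoe
    simp at hcoe
  have hfin : Module.finrank ℝ (TangentSpace (𝓡 1) (Circle.exp t)) = 1 :=
    finrank_euclideanSpace_fin (𝕜 := ℝ) (n := 1)
  obtain ⟨r, hr⟩ := exists_smul_eq_of_finrank_eq_one hfin hne ξ
  exact ⟨r, hr.symm⟩

/-- The velocity of `Circle.exp` spans the tangent line of the circle, so by linearity the
normalization `vertical` determines the form on all vertical vectors. -/
theorem form_vertical (a : Circle) (p : X.Total) (ξ : TangentSpace (𝓡 1) a) :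
    A.form (a • p) (mfderiv (𝓡 1) J4 (fun b : Circle => b • p) a ξ) =
      (a : ℂ)⁻¹ * dval (𝓡 1) (fun b : Circle => (b : ℂ)) a ξ := by
  obtain ⟨t, rfl⟩ := Circle.exp_surjective a
  obtain ⟨r, rfl⟩ := exists_eq_smul_mfderiv_exp t ξ
  set e : TangentSpace (𝓡 1) (Circle.exp t) := mfderiv 𝓘(ℝ, ℝ) (𝓡 1) Circle.exp t (1 : ℝ) with he
  have hcoe := dval_coe_exp t
  rw [← he] at hcoe
  have h1 := mfderiv_comp_apply (I := 𝓘(ℝ, ℝ)) (I' := 𝓡 1) (I'' := J4) t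
    (mdifferentiableAt_smul_left (Circle.exp t) p) (mdifferentiableAt_circle_exp t) (1 : ℝ)
  have h2 := A.vertical p t
  have h3 : A.form (Circle.exp t • p)
      (mfderiv (𝓡 1) J4 (fun b : Circle => b • p) (Circle.exp t) e) = Complex.I := by
    rw [← h2]
    exact congrArg (A.form (Circle.exp t • p)) h1.symm
  rw [map_smul, map_smul, map_smul, h3, hcoe]
  have : (Circle.exp t : ℂ) ≠ 0 := Circle.coe_ne_zero _
  simp only [Complex.real_smul]
  field_simp

variable {E H N : Type*} [NormedAddCommGroup E] [NormedSpace ℝ E] [TopologicalSpace H]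
  {I : ModelWithCorners ℝ E H} [TopologicalSpace N] [ChartedSpace H N]

/-- The Leibniz rule for a connection form along the product of a circle-valued map and a map to
the total space. -/
theorem form_smul {g : N → Circle} {s : N → X.Total} {x : N} (hg : MDifferentiableAt I (𝓡 1) g x)
    (hs : MDifferentiableAt I J4 s x) (v : TangentSpace I x) :
    A.form (g x • s x) (mfderiv I J4 (fun y => g y • s y) x v) =
      (g x : ℂ)⁻¹ * dval I (fun y => (g y : ℂ)) x v + A.form (s x) (mfderiv I J4 s x v) := by
  have h1 := mfderiv_comp_apply (I := I) (I' := (𝓡 1).prod J4) (I'' := J4) x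
    (mdifferentiableAt_smul (g x, s x)) (hg.prodMk hs) v
  have h2 := mfderiv_prod_eq_add_apply (v := mfderiv I ((𝓡 1).prod J4) (fun y => (g y, s y)) x v)
    (mdifferentiableAt_smul (g x, s x))
  -- The product rule: a vertical part, evaluated by `form_vertical`, and a translate of the
  -- velocity of s, evaluated by invariance.
  have h3 : mfderiv I J4 (fun y => g y • s y) x v =
      mfderiv (𝓡 1) J4 (fun b : Circle => b • s x) (g x) (mfderiv I (𝓡 1) g x v) +
      mfderiv J4 J4 (fun q : X.Total => g x • q) (s x) (mfderiv I J4 s x v) := by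
    refine (h1.trans h2).trans ?_
    rw [hg.mfderiv_prod hs]
    rfl
  have h4 := mfderiv_comp_apply (I := I) (I' := 𝓡 1) (I'' := 𝓘(ℝ, ℂ)) x
    (mdifferentiableAt_circle_coe (g x)) hg v
  rw [h3, map_add, form_vertical, A.invariant]
  congr 2
  exact h4.symm

end Leibniz

/-! ### Sections and trivializations -/

namespace U1Bundle

variable {B : Set E3} (X : U1Bundle B)

/-- Freeness of the action, and transitivity on fibres in `exists_smul_eq`, are not fields of
`U1Bundle`; both follow from local triviality. -/
theorem smul_left_injective {g h : Circle} {p : X.Total} (e : g • p = h • p) : g = h := by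
  obtain ⟨W, -, hx, -, s, τ, hT⟩ := X.locally_trivial (X.proj p) (X.proj_mem p)
  have hp := hT.smul_apply p hx
  have h1 := hT.apply_smul _ hx (g * τ p)
  have h2 := hT.apply_smul _ hx (h * τ p)
  rw [mul_smul, hp] at h1 h2
  exact mul_right_cancel (h1.symm.trans ((congrArg τ e).trans h2))

theorem exists_smul_eq {p q : X.Total} (e : X.proj p = X.proj q) : ∃ g : Circle, g • p = q := by
  obtain ⟨W, -, hx, -, s, τ, hT⟩ := X.locally_trivial (X.proj p) (X.proj_mem p)
  have hp := hT.smul_apply p hx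
  have hq := hT.smul_apply q (show X.proj q ∈ W from e ▸ hx)
  refine ⟨τ q * (τ p)⁻¹, ?_⟩
  rw [mul_smul]
  nth_rewrite 2 [← hp]
  rw [inv_smul_smul, e, hq]

/-- The fibre component of the trivialization defined by a section. -/
def fibreCoord (s : E3 → X.Total) (p : X.Total) : Circle :=
  open Classical in
  if h : ∃ g : Circle, g • s (X.proj p) = p then h.choose else 1

variable {X}

theorem fibreCoord_smul {W : Set E3} {s : E3 → X.Total} (hs : IsSection X.proj W s) {p : X.Total}
    (hp : X.proj p ∈ W) : X.fibreCoord s p • s (X.proj p) = p := by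
  have h : ∃ g : Circle, g • s (X.proj p) = p := X.exists_smul_eq (hs.proj _ hp)
  rw [fibreCoord, dif_pos h]
  exact h.choose_spec

theorem contMDiffAt_section {W : Set E3} (hW : IsOpen W) {s : E3 → X.Total}
    (hs : IsSection X.proj W s) {x : E3} (hx : x ∈ W) : ContMDiffAt (𝓡 3) J4 ∞ s x :=
  hs.smooth.contMDiffAt (hW.mem_nhds hx)

theorem isTrivialization_fibreCoord {W : Set E3} (hW : IsOpen W) {s : E3 → X.Total}
    (hs : IsSection X.proj W s) : IsTrivialization X.proj W s (X.fibreCoord s) where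
  isSection := hs
  smul_apply p hp := fibreCoord_smul hs hp
  apply_smul x hx g := by
    have hproj : X.proj (g • s x) = x := (X.proj_smul _ _).trans (hs.proj x hx)
    have h := fibreCoord_smul hs (p := g • s x) (by rw [hproj]; exact hx)
    rw [hproj] at h
    exact X.smul_left_injective h
  smooth := by
    intro p hp
    obtain ⟨W', hW', hx, -, s', τ, hT⟩ := X.locally_trivial (X.proj p) (X.proj_mem p)
    have hproj : Continuous X.proj := X.smooth_proj.continuous
    have hsp : X.proj (s (X.proj p)) = X.proj p := hs.proj _ hp
    have h1 : ContMDiffAt J4 (𝓡 1) ∞ τ p := hT.smooth.contMDiffAt ((hW'.preimage hproj).mem_nhds hx)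
    have h2 : ContMDiffAt J4 (𝓡 1) ∞ τ (s (X.proj p)) :=
      hT.smooth.contMDiffAt ((hW'.preimage hproj).mem_nhds (by rw [mem_preimage, hsp]; exact hx))
    have h3 : ContMDiffAt J4 (𝓡 1) ∞ (fun q => τ (s (X.proj q))) p :=
      h2.comp p ((contMDiffAt_section hW hs hp).comp p X.smooth_proj.contMDiffAt)
    -- The choice in `fibreCoord` says nothing about smoothness. Near p, however, the coordinate is
    -- `τ q / τ (s (π q))` for any local trivialization τ, by freeness.
    have h4 : ContMDiffAt J4 (𝓡 1) ∞ (fun q => τ q * (τ (s (X.proj q)))⁻¹) p :=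
      contMDiff_circle_mul.contMDiffAt.comp p
        (h1.prodMk (contMDiff_circle_inv.contMDiffAt.comp p h3))
    refine (h4.congr_of_eventuallyEq ?_).contMDiffWithinAt
    filter_upwards [(hW.preimage hproj).mem_nhds hp, (hW'.preimage hproj).mem_nhds hx] with q hq hq'
    have e1 := fibreCoord_smul hs hq
    have e2 := hT.smul_apply q hq'
    have e3 := hT.smul_apply (s (X.proj q)) (by rw [mem_preimage, hs.proj _ hq]; exact hq')
    rw [hs.proj _ hq] at e3
    refine X.smul_left_injective (p := s (X.proj q)) (e1.trans ?_)
    rw [mul_smul]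
    nth_rewrite 2 [← e3]
    rw [inv_smul_smul, e2]

theorem section_smul {W : Set E3} {s : E3 → X.Total} (hs : IsSection X.proj W s) {g : E3 → Circle}
    (hg : ContMDiffOn (𝓡 3) (𝓡 1) ∞ g W) : IsSection X.proj W (fun x => g x • s x) where
  smooth := X.smooth_smul.comp_contMDiffOn (hg.prodMk hs.smooth)
  proj x hx := (X.proj_smul _ _).trans (hs.proj x hx)

theorem section_mono {W W' : Set E3} {s : E3 → X.Total} (hs : IsSection X.proj W s) (h : W' ⊆ W) :
    IsSection X.proj W' s :=
  ⟨hs.smooth.mono h, fun x hx => hs.proj x (h hx)⟩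

end U1Bundle

theorem IsTrivialization.apply_smul_total {B : Set E3} {X : U1Bundle B} {W : Set E3}
    {s : E3 → X.Total} {τ : X.Total → Circle} (hT : IsTrivialization X.proj W s τ) {p : X.Total}
    (hp : X.proj p ∈ W) (g : Circle) : τ (g • p) = g * τ p := by
  have h := hT.smul_apply p hp
  have h2 := hT.apply_smul _ hp (g * τ p)
  rwa [mul_smul, h] at h2

/-! ### Smoothness of differentials -/

section Smoothness

variable {P : Type} [TopologicalSpace P] [ChartedSpace H4 P] [IsManifold J4 ∞ P]

instance : IsManifold J4 1 P := IsManifold.of_le (n := ∞) (by simp)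

variable {V : Type*} [NormedAddCommGroup V] [NormedSpace ℝ V]

theorem contMDiffOn_dval {h : P → V} {S : Set P} (hS : IsOpen S) (hh : ContMDiffOn J4 𝓘(ℝ, V) ∞ h S) :
    ContMDiffOn J4.tangent 𝓘(ℝ, V) ∞ (fun v : TangentBundle J4 P => dval J4 h v.proj v.snd)
      (Bundle.TotalSpace.proj ⁻¹' S) := by
  have h1 := hh.contMDiffOn_tangentMapWithin (m := ∞) (by simp) hS.uniqueMDiffOn
  have h2 := (contMDiff_snd_tangentBundle_modelSpace V 𝓘(ℝ, V) (n := ∞)).comp_contMDiffOn h1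
  refine h2.congr fun v hv => ?_
  have hd : MDifferentiableAt J4 𝓘(ℝ, V) h v.proj :=
    (hh.contMDiffAt (hS.mem_nhds hv)).mdifferentiableAt (by simp)
  exact congrArg (fun q : TangentBundle 𝓘(ℝ, V) V => (q.snd : V))
    (tangentMapWithin_eq_tangentMap (hS.uniqueMDiffOn _ hv) hd).symm

end Smoothness

section Pullback

variable {B : Set E3} {X : U1Bundle B} (A : Connection X)

theorem contMDiffOn_base_form {V : Type*} [NormedAddCommGroup V] [NormedSpace ℝ V]
    {η : E3 → E3 →L[ℝ] V} {W : Set E3} (hW : IsOpen W) (hη : ContDiffOn ℝ ∞ η W) :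
    ContMDiffOn J4.tangent 𝓘(ℝ, V) ∞
      (fun v : TangentBundle J4 X.Total => η (X.proj v.proj) (dval J4 X.proj v.proj v.snd))
      (Bundle.TotalSpace.proj ⁻¹' (X.proj ⁻¹' W)) := by
  have hp : ContMDiff J4.tangent J4 ∞ (Bundle.TotalSpace.proj : TangentBundle J4 X.Total → X.Total) :=
    Bundle.contMDiff_proj _
  have h1 := contMDiffOn_dval (hW.preimage X.smooth_proj.continuous) X.smooth_proj.contMDiffOn
  have h2 : ContMDiffOn J4.tangent 𝓘(ℝ, E3 →L[ℝ] V) ∞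
      (fun v : TangentBundle J4 X.Total => η (X.proj v.proj))
      (Bundle.TotalSpace.proj ⁻¹' (X.proj ⁻¹' W)) :=
    hη.contMDiffOn.comp (X.smooth_proj.comp hp).contMDiffOn fun v hv => hv
  exact h2.clm_apply h1

/-- For a fixed vector w, the value at x is the connection, as a smooth function on the tangent
bundle, composed with `x ↦ ds(x, w)`. -/
theorem contDiffOn_pullback {W : Set E3} (hW : IsOpen W) {s : E3 → X.Total}
    (hs : IsSection X.proj W s) : ContDiffOn ℝ ∞ (A.pullback s) W := by
  rw [contDiffOn_clm_apply]
  intro w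
  rw [← contMDiffOn_iff_contDiffOn]
  have h1 := hs.smooth.contMDiffOn_tangentMapWithin (m := ∞) (by simp) hW.uniqueMDiffOn
  have h2 : ContMDiffOn (𝓡 3) (𝓡 3).tangent ∞ (fun x : E3 => (⟨x, w⟩ : TangentBundle (𝓡 3) E3)) W :=
    contMDiffOn_vectorSpace_iff_contDiffOn.2 contDiffOn_const
  have h3 := A.smooth.comp_contMDiffOn (h1.comp h2 fun x hx => hx)
  refine h3.congr fun x hx => ?_
  have hd : MDifferentiableAt (𝓡 3) J4 s x :=
    (U1Bundle.contMDiffAt_section hW hs hx).mdifferentiableAt (by simp)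
  rw [Function.comp_apply, Function.comp_apply,
    tangentMapWithin_eq_tangentMap (hW.uniqueMDiffOn _ hx) hd]
  rfl

theorem pullback_re (s : E3 → X.Total) (x w : E3) : (A.pullback s x w).re = 0 := A.imaginary _ _

theorem pullback_congr {s s' : E3 → X.Total} {x : E3} (h : s =ᶠ[𝓝 x] s') :
    A.pullback s x = A.pullback s' x := by
  have h0 := h.eq_of_nhds
  have h1 := h.mfderiv_eq (I := 𝓡 3) (I' := J4)
  ext w
  change A.form (s x) (mfderiv (𝓡 3) J4 s x w) = A.form (s' x) (mfderiv (𝓡 3) J4 s' x w)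
  rw [h1]
  exact A.form_heq_apply h0 _

theorem pullback_smul {s : E3 → X.Total} {g : E3 → Circle} {x : E3}
    (hg : MDifferentiableAt (𝓡 3) (𝓡 1) g x) (hs : MDifferentiableAt (𝓡 3) J4 s x) :
    A.pullback (fun y => g y • s y) x =
      (g x : ℂ)⁻¹ • fderiv ℝ (fun y => (g y : ℂ)) x + A.pullback s x := by
  ext w
  refine (form_smul A hg hs w).trans ?_
  rw [dval, mfderiv_eq_fderiv]
  rfl

/-- In the trivialization defined by a section, the connection has the pullback by the section as
its local form. -/
theorem hasLocalForm_of_pullback_eq {W : Set E3} (hW : IsOpen W) {s : E3 → X.Total}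
    {τ : X.Total → Circle} (hT : IsTrivialization X.proj W s τ) {α : E3 → E3 →L[ℝ] ℂ}
    (h : ∀ x ∈ W, A.pullback s x = α x) : A.HasLocalForm W τ α := by
  intro p hp v
  have hproj : Continuous X.proj := X.smooth_proj.continuous
  have hτ : MDifferentiableAt J4 (𝓡 1) τ p :=
    (hT.smooth.contMDiffAt ((hW.preimage hproj).mem_nhds hp)).mdifferentiableAt (by simp)
  have hs : MDifferentiableAt (𝓡 3) J4 s (X.proj p) :=
    (U1Bundle.contMDiffAt_section hW hT.isSection hp).mdifferentiableAt (by simp)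
  have hπ : MDifferentiableAt J4 (𝓡 3) X.proj p := X.smooth_proj.mdifferentiable (by simp) p
  -- The identity of the total space is `p ↦ τ p • s (π p)`; the Leibniz rule applied to this
  -- product is the local form.
  have key := form_smul A (s := s ∘ X.proj) hτ (hs.comp p hπ) v
  have he : (fun q => τ q • (s ∘ X.proj) q) =ᶠ[𝓝 p] id := by
    filter_upwards [(hW.preimage hproj).mem_nhds hp] with q hq using hT.smul_apply q hq
  rw [he.mfderiv_eq, mfderiv_id, mfderiv_comp_apply p hs hπ] at key
  have e1 : A.form p v = A.form (τ p • (s ∘ X.proj) p) v := A.form_heq_apply he.eq_of_nhds.symm v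
  refine e1.trans (key.trans ?_)
  rw [← h _ hp, add_comm]
  rfl

theorem pullback_eq_of_hasLocalForm {W : Set E3} {τ : X.Total → Circle} {α : E3 → E3 →L[ℝ] ℂ}
    (h : A.HasLocalForm W τ α) (hW : IsOpen W)
    (hτ : ContMDiffOn J4 (𝓡 1) ∞ τ (X.proj ⁻¹' W)) {s : E3 → X.Total}
    (hs : IsSection X.proj W s) {x : E3} (hx : x ∈ W) :
    A.pullback s x = α x + (τ (s x) : ℂ)⁻¹ • fderiv ℝ (fun y => (τ (s y) : ℂ)) x := by
  have hproj : Continuous X.proj := X.smooth_proj.continuous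
  have hsx : X.proj (s x) = x := hs.proj x hx
  have hsd : MDifferentiableAt (𝓡 3) J4 s x :=
    (U1Bundle.contMDiffAt_section hW hs hx).mdifferentiableAt (by simp)
  have hπ : MDifferentiableAt J4 (𝓡 3) X.proj (s x) := X.smooth_proj.mdifferentiable (by simp) _
  have hp : s x ∈ X.proj ⁻¹' W := by rw [mem_preimage, hsx]; exact hx
  have hτd : MDifferentiableAt J4 (𝓡 1) τ (s x) :=
    (hτ.contMDiffAt ((hW.preimage hproj).mem_nhds hp)).mdifferentiableAt (by simp)
  have hτc : MDifferentiableAt J4 𝓘(ℝ, ℂ) (fun q => (τ q : ℂ)) (s x) :=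
    (mdifferentiableAt_circle_coe _).comp (I' := 𝓡 1) (s x) hτd
  ext w
  have key := h (s x) hp (mfderiv (𝓡 3) J4 s x w)
  refine key.trans ?_
  have he : X.proj ∘ s =ᶠ[𝓝 x] id := by
    filter_upwards [hW.mem_nhds hx] with y hy using hs.proj y hy
  have e1 := mfderiv_comp_apply x hπ hsd w
  rw [he.mfderiv_eq, mfderiv_id] at e1
  have e2 := mfderiv_comp_apply x hτc hsd w
  rw [← e1, hsx]
  have e3 : fderiv ℝ (fun y => (τ (s y) : ℂ)) x w =
      dval J4 (fun q => (τ q : ℂ)) (s x) (mfderiv (𝓡 3) J4 s x w) := by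
    rw [← mfderiv_eq_fderiv]
    exact e2
  change α x w + (τ (s x) : ℂ)⁻¹ * dval J4 (fun q => (τ q : ℂ)) (s x) (mfderiv (𝓡 3) J4 s x w) = _
  rw [← e3]
  rfl

end Pullback

/-! ### Sections along which a connection form is prescribed -/

section Flat

variable {B : Set E3} {X : U1Bundle B} (A : Connection X)

/-- A section along which the connection form pulls back to `σ`; it is horizontal for `A - σ`. -/
structure IsFlatSection (σ : E3 → E3 →L[ℝ] ℂ) (W : Set E3) (s : E3 → X.Total) : Prop where
  isSection : IsSection X.proj W s
  pullback_eq : ∀ x ∈ W, A.pullback s x = σ x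

variable {A} {σ : E3 → E3 →L[ℝ] ℂ} {W : Set E3} {s : E3 → X.Total}

theorem IsFlatSection.mono (h : IsFlatSection A σ W s) {W' : Set E3} (hW : W' ⊆ W) :
    IsFlatSection A σ W' s :=
  ⟨U1Bundle.section_mono h.isSection hW, fun x hx => h.pullback_eq x (hW hx)⟩

theorem IsFlatSection.const_smul (hW : IsOpen W) (h : IsFlatSection A σ W s) (g : Circle) :
    IsFlatSection A σ W (fun x => g • s x) where
  isSection := U1Bundle.section_smul h.isSection contMDiffOn_const
  pullback_eq x hx := by
    have hs : MDifferentiableAt (𝓡 3) J4 s x :=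
      (U1Bundle.contMDiffAt_section hW h.isSection hx).mdifferentiableAt (by simp)
    rw [pullback_smul A mdifferentiableAt_const hs, h.pullback_eq x hx]
    have h0 : fderiv ℝ (fun _ : E3 => (g : ℂ)) x = 0 := fderiv_const_apply _
    rw [h0]
    ext v
    simp

theorem isFlatSection_of_locally (hW : ∀ x ∈ W, ∃ s' N, IsOpen N ∧ x ∈ N ∧ EqOn s s' N ∧
    IsFlatSection A σ N s') : IsFlatSection A σ W s := by
  refine ⟨⟨fun x hx => ?_, fun x hx => ?_⟩, fun x hx => ?_⟩ <;>
    obtain ⟨s', N, hN, hxN, he, h⟩ := hW x hx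
  · exact ((U1Bundle.contMDiffAt_section hN h.isSection hxN).congr_of_eventuallyEq
      (he.eventuallyEq_of_mem (hN.mem_nhds hxN))).contMDiffWithinAt
  · rw [he hxN, h.isSection.proj x hxN]
  · rw [pullback_congr A (he.eventuallyEq_of_mem (hN.mem_nhds hxN)), h.pullback_eq x hxN]

/-- Two sections with the same pullback differ by a constant on a preconnected open set. -/
theorem IsFlatSection.exists_eq_smul (hW : IsOpen W) (hc : IsPreconnected W)
    (h : IsFlatSection A σ W s) {s' : E3 → X.Total} (h' : IsFlatSection A σ W s') :
    ∃ g : Circle, ∀ x ∈ W, s' x = g • s x := by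
  rcases W.eq_empty_or_nonempty with rfl | ⟨x₀, hx₀⟩
  · exact ⟨1, by simp⟩
  have hT := U1Bundle.isTrivialization_fibreCoord hW h.isSection
  set τ := X.fibreCoord s
  have hproj : Continuous X.proj := X.smooth_proj.continuous
  have hg : ∀ x ∈ W, ContMDiffAt (𝓡 3) (𝓡 1) ∞ (fun x => τ (s' x)) x := fun x hx =>
    (hT.smooth.contMDiffAt ((hW.preimage hproj).mem_nhds (by
      rw [mem_preimage, h'.isSection.proj x hx]; exact hx))).comp x
      (U1Bundle.contMDiffAt_section hW h'.isSection hx)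
  have heq : ∀ x ∈ W, s' x = τ (s' x) • s x := fun x hx => by
    have := hT.smul_apply (s' x) (by rw [mem_preimage, h'.isSection.proj x hx]; exact hx)
    rw [h'.isSection.proj x hx] at this
    exact this.symm
  have hcoe : ∀ x ∈ W, DifferentiableAt ℝ (fun y => (τ (s' y) : ℂ)) x := fun x hx => by
    have := contMDiff_circle_coe.contMDiffAt.comp x (hg x hx)
    exact this.contDiffAt.differentiableAt (by simp)
  -- By the Leibniz rule, equal pullbacks force the ratio g of the two sections to satisfy `g⁻¹ dg =
  -- 0`.
  have hder : EqOn (fderiv ℝ (fun y => (τ (s' y) : ℂ))) 0 W := by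
    intro x hx
    have hs : MDifferentiableAt (𝓡 3) J4 s x :=
      (U1Bundle.contMDiffAt_section hW h.isSection hx).mdifferentiableAt (by simp)
    have h1 := pullback_smul A ((hg x hx).mdifferentiableAt (by simp)) hs
    have h2 : s' =ᶠ[𝓝 x] fun y => τ (s' y) • s y := by
      filter_upwards [hW.mem_nhds hx] with y hy using heq y hy
    rw [← pullback_congr A h2, h.pullback_eq x hx, h'.pullback_eq x hx] at h1
    have h3 : (τ (s' x) : ℂ)⁻¹ • fderiv ℝ (fun y => (τ (s' y) : ℂ)) x = 0 :=
      right_eq_add.1 h1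
    exact (smul_eq_zero.1 h3).resolve_left (inv_ne_zero (Circle.coe_ne_zero _))
  refine ⟨τ (s' x₀), fun x hx => ?_⟩
  have := hW.is_const_of_fderiv_eq_zero hc (fun y hy => (hcoe y hy).differentiableWithinAt) hder
    hx hx₀
  rw [← Circle.ext this]
  exact heq x hx

theorem IsFlatSection.eqOn (hW : IsOpen W) (hc : IsPreconnected W)
    (h : IsFlatSection A σ W s) {s' : E3 → X.Total} (h' : IsFlatSection A σ W s') {x₀ : E3}
    (hx₀ : x₀ ∈ W) (e : s x₀ = s' x₀) : EqOn s s' W := by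
  obtain ⟨g, hg⟩ := h.exists_eq_smul hW hc h'
  have h1 : (1 : Circle) • s x₀ = g • s x₀ := by rw [one_smul, ← hg x₀ hx₀, e]
  have : (1 : Circle) = g := X.smul_left_injective h1
  intro x hx
  rw [hg x hx, ← this, one_smul]

/-- Gluing along a nonempty preconnected intersection. -/
theorem IsFlatSection.exists_union (hW : IsOpen W) (h : IsFlatSection A σ W s) {W' : Set E3}
    (hW' : IsOpen W') {s' : E3 → X.Total} (h' : IsFlatSection A σ W' s')
    (hc : IsPreconnected (W ∩ W')) : ∃ s'', IsFlatSection A σ (W ∪ W') s'' := by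
  classical
  obtain ⟨g, hg⟩ := (h'.mono inter_subset_right).exists_eq_smul (hW.inter hW') hc
    (h.mono inter_subset_left)
  refine ⟨fun x => if x ∈ W then s x else g • s' x, isFlatSection_of_locally ?_⟩
  rintro x (hx | hx)
  · exact ⟨s, W, hW, hx, fun y hy => if_pos hy, h⟩
  · refine ⟨fun x => g • s' x, W', hW', hx, fun y hy => ?_, h'.const_smul hW' g⟩
    by_cases hyW : y ∈ W
    · simp only [if_pos hyW]; exact hg y ⟨hyW, hy⟩
    · simp only [if_neg hyW]

/-- If the curvature is `dσ`, sections with pullback `σ` exist locally. -/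
theorem exists_isFlatSection_ball {F : E3 → E3 [⋀^Fin 2]→L[ℝ] ℝ} (hA : A.HasCurvature F)
    (hW : IsOpen W) (hWB : W ⊆ B) (hσ : ContDiffOn ℝ ∞ σ W) (hre : ∀ x ∈ W, ∀ v, (σ x v).re = 0)
    (hd : ∀ x ∈ W, dOne σ x = iMul.compContinuousAlternatingMap (F x)) {x : E3} (hx : x ∈ W) :
    ∃ r > 0, Metric.ball x r ⊆ W ∧ ∃ s, IsFlatSection A σ (Metric.ball x r) s := by
  obtain ⟨W', hW', hxW', -, s, τ, hT⟩ := X.locally_trivial x (hWB hx)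
  obtain ⟨r, hr, hball⟩ := Metric.isOpen_iff.1 (hW.inter hW') x ⟨hx, hxW'⟩
  set N := Metric.ball x r
  have hN : IsOpen N := Metric.isOpen_ball
  have hNW : N ⊆ W := hball.trans inter_subset_left
  have hs : IsSection X.proj N s := U1Bundle.section_mono hT.isSection (hball.trans inter_subset_right)
  have hα := contDiffOn_pullback A hN hs
  have hβ : ContDiffOn ℝ ∞ (fun y => A.pullback s y - σ y) N := hα.sub (hσ.mono hNW)
  have hαd : ∀ y ∈ N, DifferentiableAt ℝ (A.pullback s) y := fun y hy =>
    (hα.contDiffAt (hN.mem_nhds hy)).differentiableAt (by simp)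
  have hσd : ∀ y ∈ N, DifferentiableAt ℝ σ y := fun y hy =>
    ((hσ.mono hNW).contDiffAt (hN.mem_nhds hy)).differentiableAt (by simp)
  -- The form `s*A - σ` is closed, since both terms have differential `iF`; the Poincaré lemma on
  -- the ball gives a primitive h.
  obtain ⟨h, hh⟩ := (convex_ball x r).exists_forall_hasFDerivAt_of_fderiv_symmetric hN
    (hβ.differentiableOn (by simp)) (by
      intro a ha v w
      have h1 := hA N hN (hNW.trans hWB) s hs a ha
      rw [← hd a (hNW ha)] at h1
      have h2 := congrArg (fun L : E3 [⋀^Fin 2]→L[ℝ] ℂ => L ![v, w]) h1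
      simp only [dOne_apply (hαd a ha), dOne_apply (hσd a ha)] at h2
      rw [fderiv_fun_sub (hαd a ha) (hσd a ha)]
      simp only [Matrix.cons_val_zero, Matrix.cons_val_one, sub_apply] at h2 ⊢
      linear_combination h2)
  -- As `s*A - σ` is imaginary, `i dφ = -(s*A - σ)`. Multiplying s by `exp (iφ)` therefore changes
  -- its pullback from `s*A` to σ.
  set φ : E3 → ℝ := fun y => -(h y).im
  have hφ : ∀ y ∈ N, HasFDerivAt φ (-(Complex.imCLM.comp (A.pullback s y - σ y))) y := fun y hy =>
    (Complex.imCLM.hasFDerivAt.comp y (hh y hy)).neg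
  have hφs : ContDiffOn ℝ ∞ φ N := by
    rw [contDiffOn_infty_iff_fderiv_of_isOpen hN]
    refine ⟨fun y hy => (hφ y hy).differentiableAt.differentiableWithinAt, ?_⟩
    exact ((contDiffOn_const (c := Complex.imCLM)).clm_comp hβ).neg.congr fun y hy => (hφ y hy).fderiv
  have hg : ContMDiffOn (𝓡 3) (𝓡 1) ∞ (fun y => Circle.exp (φ y)) N :=
    contMDiff_circleExp.comp_contMDiffOn hφs.contMDiffOn
  refine ⟨r, hr, hNW, fun y => Circle.exp (φ y) • s y, U1Bundle.section_smul hs hg, fun y hy => ?_⟩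
  rw [pullback_smul A ((hg.contMDiffAt (hN.mem_nhds hy)).mdifferentiableAt (by simp))
    ((U1Bundle.contMDiffAt_section hN hs hy).mdifferentiableAt (by simp))]
  have hexp : HasFDerivAt (fun y => (Circle.exp (φ y) : ℂ))
      ((Circle.exp (φ y) : ℂ) • (Complex.I • Complex.ofRealCLM.comp
        (-(Complex.imCLM.comp (A.pullback s y - σ y))))) y := by
    have h1 := ((Complex.ofRealCLM.hasFDerivAt.comp y (hφ y hy)).mul_const Complex.I).cexp
    simp only [Circle.coe_exp]
    exact h1
  rw [hexp.fderiv, smul_smul, inv_mul_cancel₀ (Circle.coe_ne_zero _), one_smul]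
  ext v
  have h1 := pullback_re A s y v
  have h2 := hre y (hNW hy) v
  apply Complex.ext <;> simp [h1, h2]

/-- If the curvature is `dσ` on an open star-shaped set, then there is a section with pullback
`σ`. -/
theorem exists_isFlatSection {F : E3 → E3 [⋀^Fin 2]→L[ℝ] ℝ} (hA : A.HasCurvature F)
    (hW : IsOpen W) (hWB : W ⊆ B) (hσ : ContDiffOn ℝ ∞ σ W) (hre : ∀ x ∈ W, ∀ v, (σ x v).re = 0)
    (hd : ∀ x ∈ W, dOne σ x = iMul.compContinuousAlternatingMap (F x)) {x₀ : E3} (hx₀ : x₀ ∈ W)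
    (hstar : StarConvex ℝ x₀ W) : ∃ s, IsFlatSection A σ W s := by
  have hloc := fun x (hx : x ∈ W) => exists_isFlatSection_ball hA hW hWB hσ hre hd hx
  have hray : ∀ x ∈ W, ∃ N, IsOpen N ∧ Convex ℝ N ∧ x₀ ∈ N ∧ x ∈ N ∧ ∃ s, IsFlatSection A σ N s := by
    intro x hx
    set l : ℝ → E3 := fun t => AffineMap.lineMap x₀ x t with hl
    have hlc : Continuous l := AffineMap.lineMap_continuous
    have hlW : ∀ t ∈ Icc (0 : ℝ) 1, l t ∈ W := fun t ht =>
      hstar.segment_subset hx (by rw [segment_eq_image_lineMap]; exact mem_image_of_mem _ ht)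
    -- Continuation along the ray. The neighbourhoods are required to be convex so that all
    -- intersections met below are connected.
    set Q : ℝ → Prop := fun t => ∃ N, IsOpen N ∧ Convex ℝ N ∧ x₀ ∈ N ∧ l t ∈ N ∧
      ∃ s, IsFlatSection A σ N s with hQ
    have hstep : ∀ t ∈ Icc (0 : ℝ) 1, ∀ᶠ u in 𝓝[Icc (0 : ℝ) 1] t, (Q t → Q u) ∧ (Q u → Q t) := by
      intro t ht
      obtain ⟨r, hr, hrW, sb, hsb⟩ := hloc (l t) (hlW t ht)
      have hnear : ∀ᶠ u in 𝓝[Icc (0 : ℝ) 1] t, l u ∈ Metric.ball (l t) r :=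
        (hlc.continuousAt.mono_left nhdsWithin_le_nhds).eventually (Metric.ball_mem_nhds _ hr)
      have hext : ∀ u ∈ Icc (0 : ℝ) 1, ∀ u' ∈ Icc (0 : ℝ) 1, l u ∈ Metric.ball (l t) r →
          l u' ∈ Metric.ball (l t) r → Q u → Q u' := by
        rintro u hu u' hu' hub hub' ⟨N, hN, hNc, h0, h1, s, hs⟩
        obtain ⟨s', hs'⟩ := hs.exists_union hN Metric.isOpen_ball hsb
          (hNc.inter (convex_ball _ _)).isPreconnected
        -- The new segment is covered by the old one together with the part from `l u` to `l u'`;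
        -- the first lies in N, the second in the ball, each by convexity.
        have hseg : segment ℝ x₀ (l u') ⊆ N ∪ Metric.ball (l t) r := by
          rintro y hy
          have hy' : y ∈ segment ℝ x₀ (l u) ∪ segment ℝ (l u) (l u') := by
            rw [segment_eq_image_lineMap] at hy
            obtain ⟨a, ha, rfl⟩ := hy
            have e1 : AffineMap.lineMap x₀ (l u') a = l (a * u') := by
              simp only [hl, AffineMap.lineMap_apply_module']; module
            rw [e1]
            have hau : 0 ≤ a * u' := mul_nonneg ha.1 hu'.1
            by_cases hle : a * u' ≤ u
            · left
              rw [segment_eq_image_lineMap]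
              rcases hu.1.eq_or_lt with h0 | h0
              · refine ⟨0, by simp, ?_⟩
                have : a * u' = 0 := by linarith
                simp [this, hl]
              · refine ⟨a * u' / u, ⟨by positivity, (div_le_one h0).2 hle⟩, ?_⟩
                simp only [hl, AffineMap.lineMap_apply_module', add_sub_cancel_right, smul_smul,
                  div_mul_cancel₀ _ h0.ne']
            · right
              push Not at hle
              have h2 : a * u' ≤ u' := mul_le_of_le_one_left hu'.1 ha.2
              have h3 : 0 < u' - u := by linarith
              rw [segment_eq_image_lineMap]
              refine ⟨(a * u' - u) / (u' - u), ⟨by apply div_nonneg <;> linarith,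
                (div_le_one h3).2 (by linarith)⟩, ?_⟩
              have e2 : (a * u' - u) / (u' - u) * (u' - u) = a * u' - u := div_mul_cancel₀ _ h3.ne'
              have e3 : l u' - l u = (u' - u) • (x - x₀) := by
                simp only [hl, AffineMap.lineMap_apply_module']; module
              rw [AffineMap.lineMap_apply_module', e3, smul_smul, e2]
              simp only [hl, AffineMap.lineMap_apply_module']
              module
          rcases hy' with hy' | hy'
          · exact Or.inl (hNc.segment_subset h0 h1 hy')
          · exact Or.inr ((convex_ball _ _).segment_subset hub hub' hy')
        have hcomp : IsCompact (segment ℝ x₀ (l u')) := by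
          rw [segment_eq_image_lineMap]
          exact isCompact_Icc.image AffineMap.lineMap_continuous
        -- The union need not be convex. A thin thickening of the compact segment is convex, open
        -- and contained in the union.
        obtain ⟨δ, hδ, hthick⟩ := hcomp.exists_thickening_subset_open
          (hN.union Metric.isOpen_ball) hseg
        have hself := Metric.self_subset_thickening hδ (segment ℝ x₀ (l u'))
        exact ⟨Metric.thickening δ (segment ℝ x₀ (l u')), Metric.isOpen_thickening,
          (convex_segment _ _).thickening δ, hself (left_mem_segment _ _ _),
          hself (right_mem_segment _ _ _), s', hs'.mono hthick⟩
      filter_upwards [hnear, self_mem_nhdsWithin] with u hu huI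
      exact ⟨hext t ht u huI (Metric.mem_ball_self hr) hu, hext u huI t ht hu (Metric.mem_ball_self hr)⟩
    -- Q is locally constant along the unit interval, hence holds at 1 once it holds at 0.
    have hall := isPreconnected_Icc.induction₂' (fun t u => Q t → Q u) hstep
      (fun _ _ _ _ _ _ h1 h2 h => h2 (h1 h)) (left_mem_Icc.2 zero_le_one)
      (right_mem_Icc.2 zero_le_one)
    obtain ⟨r, hr, hrW, sb, hsb⟩ := hloc x₀ hx₀
    have h0 : Q 0 := ⟨Metric.ball x₀ r, Metric.isOpen_ball, convex_ball _ _, Metric.mem_ball_self hr,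
      by simp [hl, hr], sb, hsb⟩
    obtain ⟨N, hN, hNc, h0N, h1N, s, hs⟩ := hall h0
    exact ⟨N, hN, hNc, h0N, by simpa [hl] using h1N, s, hs⟩
  obtain ⟨r, hr, hrW, sb, hsb⟩ := hloc x₀ hx₀
  -- Rotating by a constant gives all these sections the same value at `x₀`. Two of them then agree
  -- where both are defined, since that intersection is convex and contains `x₀`.
  have hray' : ∀ x : W, ∃ N, IsOpen N ∧ Convex ℝ N ∧ x₀ ∈ N ∧ (x : E3) ∈ N ∧
      ∃ s, IsFlatSection A σ N s ∧ s x₀ = sb x₀ := by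
    intro x
    obtain ⟨N, hN, hNc, h0, h1, s, hs⟩ := hray x x.2
    obtain ⟨g, hg⟩ := X.exists_smul_eq (p := s x₀) (q := sb x₀) (by
      rw [hs.isSection.proj x₀ h0, hsb.isSection.proj x₀ (Metric.mem_ball_self hr)])
    exact ⟨N, hN, hNc, h0, h1, _, hs.const_smul hN g, hg⟩
  choose N hN hNc h0 h1 s hs hs0 using hray'
  classical
  refine ⟨fun x => if hx : x ∈ W then s ⟨x, hx⟩ x else sb x₀, isFlatSection_of_locally fun x hx => ?_⟩
  refine ⟨s ⟨x, hx⟩, N ⟨x, hx⟩ ∩ W, (hN _).inter hW, ⟨h1 _, hx⟩, fun y hy => ?_,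
    (hs _).mono inter_subset_left⟩
  simp only [dif_pos hy.2]
  exact ((hs ⟨y, hy.2⟩).mono inter_subset_left).eqOn ((hN ⟨y, hy.2⟩).inter (hN ⟨x, hx⟩))
    ((hNc _).inter (hNc _)).isPreconnected ((hs ⟨x, hx⟩).mono inter_subset_right)
    ⟨h0 _, h0 _⟩ ((hs0 _).trans (hs0 _).symm) ⟨h1 ⟨y, hy.2⟩, hy.1⟩

end Flat

/-! ### Changing a connection by a form on the base -/

section Change

variable {B : Set E3} {X : U1Bundle B} (A : Connection X)

theorem dval_proj_vertical (p : X.Total) (t : ℝ) :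
    dval J4 X.proj (Circle.exp t • p)
      (mfderiv 𝓘(ℝ, ℝ) J4 (fun u : ℝ => Circle.exp u • p) t (1 : ℝ)) = 0 := by
  have hπ : MDifferentiableAt J4 (𝓡 3) X.proj (Circle.exp t • p) :=
    X.smooth_proj.mdifferentiable (by simp) _
  have hv : MDifferentiableAt 𝓘(ℝ, ℝ) J4 (fun u : ℝ => Circle.exp u • p) t :=
    (mdifferentiableAt_smul_left (Circle.exp t) p).comp t (mdifferentiableAt_circle_exp t)
  have h := mfderiv_comp_apply t hπ hv (1 : ℝ)
  have hc : X.proj ∘ (fun u : ℝ => Circle.exp u • p) = fun _ => X.proj p := by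
    ext1 u; exact X.proj_smul _ _
  rw [hc, mfderiv_const] at h
  exact h.symm

theorem dval_proj_smul (g : Circle) (p : X.Total) (v : TangentSpace J4 p) :
    dval J4 X.proj (g • p) (mfderiv J4 J4 (fun q : X.Total => g • q) p v) = dval J4 X.proj p v := by
  have hπ : MDifferentiableAt J4 (𝓡 3) X.proj (g • p) := X.smooth_proj.mdifferentiable (by simp) _
  have h := mfderiv_comp_apply p hπ (mdifferentiableAt_smul_right g p) v
  have hc : X.proj ∘ (fun q : X.Total => g • q) = X.proj := by
    ext1 u; exact X.proj_smul _ _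
  rw [hc] at h
  exact h.symm

theorem dval_proj_section {W : Set E3} (hW : IsOpen W) {s : E3 → X.Total}
    (hs : IsSection X.proj W s) {x : E3} (hx : x ∈ W) (w : E3) :
    dval J4 X.proj (s x) (mfderiv (𝓡 3) J4 s x w) = w := by
  have hπ : MDifferentiableAt J4 (𝓡 3) X.proj (s x) := X.smooth_proj.mdifferentiable (by simp) _
  have hsd : MDifferentiableAt (𝓡 3) J4 s x :=
    (U1Bundle.contMDiffAt_section hW hs hx).mdifferentiableAt (by simp)
  have h := mfderiv_comp_apply x hπ hsd w
  have he : X.proj ∘ s =ᶠ[𝓝 x] id := by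
    filter_upwards [hW.mem_nhds hx] with y hy using hs.proj y hy
  rw [he.mfderiv_eq, mfderiv_id] at h
  exact h.symm

/-- The connection `A - iη`. -/
def Connection.subBase (η : E3 → E3 →L[ℝ] ℝ) (hB : IsOpen B) (hη : ContDiffOn ℝ ∞ η B) :
    Connection X where
  form p := A.form p - (iMul.comp (η (X.proj p))).comp (dval J4 X.proj p)
  imaginary p v := by
    have h := A.imaginary p v
    simp [iMul, h]
  smooth := by
    have h1 := contMDiffOn_base_form (X := X) hB (ContDiffOn.iMul_comp hη)
    have h2 : (Bundle.TotalSpace.proj ⁻¹' (X.proj ⁻¹' B) : Set (TangentBundle J4 X.Total)) = univ :=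
      eq_univ_of_forall fun v => X.proj_mem _
    rw [h2, contMDiffOn_univ] at h1
    exact A.smooth.sub h1
  vertical p t := by
    have h := A.vertical p t
    rw [sub_apply, h, ContinuousLinearMap.comp_apply, dval_proj_vertical]
    simp
  invariant g p v := by
    rw [sub_apply, A.invariant, ContinuousLinearMap.comp_apply, dval_proj_smul, X.proj_smul]
    rfl

theorem Connection.pullback_subBase {η : E3 → E3 →L[ℝ] ℝ} (hB : IsOpen B) (hη : ContDiffOn ℝ ∞ η B)
    {W : Set E3} (hW : IsOpen W) {s : E3 → X.Total} (hs : IsSection X.proj W s) {x : E3}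
    (hx : x ∈ W) :
    (A.subBase η hB hη).pullback s x = A.pullback s x - iMul.comp (η x) := by
  ext w
  change A.form (s x) (mfderiv (𝓡 3) J4 s x w) -
    iMul (η (X.proj (s x)) (dval J4 X.proj (s x) (mfderiv (𝓡 3) J4 s x w))) = _
  rw [dval_proj_section hW hs hx, hs.proj x hx]
  rfl

theorem dOne_congr {F : Type*} [NormedAddCommGroup F] [NormedSpace ℝ F] {α β : E3 → E3 →L[ℝ] F}
    {x : E3} (h : α =ᶠ[𝓝 x] β) : dOne α x = dOne β x := by
  refine Filter.EventuallyEq.extDeriv_eq ?_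
  filter_upwards [h] with y hy
  simp only [oneForm, hy]

theorem dOne_add {F : Type*} [NormedAddCommGroup F] [NormedSpace ℝ F] {α β : E3 → E3 →L[ℝ] F}
    {x : E3} (hα : DifferentiableAt ℝ α x) (hβ : DifferentiableAt ℝ β x) :
    dOne (fun y => α y + β y) x = dOne α x + dOne β x := by
  ext v
  rw [dOne_apply (hα.fun_add hβ), fderiv_fun_add hα hβ]
  simp only [add_apply, ContinuousAlternatingMap.add_apply, dOne_apply hα, dOne_apply hβ]
  abel

/-- Every pullback changes by `-iη`, so the curvature changes by `-i dη`. -/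
theorem Connection.hasCurvature_subBase {F : E3 → E3 [⋀^Fin 2]→L[ℝ] ℝ} {η : E3 → E3 →L[ℝ] ℝ}
    (hB : IsOpen B) (hη : ContDiffOn ℝ ∞ η B) (h : A.HasCurvature fun x => F x + dOne η x) :
    (A.subBase η hB hη).HasCurvature F := by
  intro W hW hWB s hs x hx
  have hηd : DifferentiableAt ℝ η x :=
    (hη.contDiffAt (hB.mem_nhds (hWB hx))).differentiableAt (by simp)
  have hd : DifferentiableAt ℝ (A.pullback s) x :=
    ((contDiffOn_pullback A hW hs).contDiffAt (hW.mem_nhds hx)).differentiableAt (by simp)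
  have he : (A.subBase η hB hη).pullback s =ᶠ[𝓝 x]
      fun y => A.pullback s y + iMul.comp ((-η) y) := by
    filter_upwards [hW.mem_nhds hx] with y hy
    rw [A.pullback_subBase hB hη hW hs hy]
    ext v
    simp [sub_eq_add_neg]
  have hηd' : DifferentiableAt ℝ (fun y => iMul.comp ((-η) y)) x :=
    (differentiableAt_const iMul).clm_comp hηd.neg
  rw [dOne_congr he, dOne_add hd hηd', dOne_iMul_comp hηd.neg, h W hW hWB s hs x hx]
  ext v
  have e : dOne (-η) x v = -dOne η x v := by
    rw [dOne_apply hηd.neg, dOne_apply hηd, fderiv_neg]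
    simp; ring
  simp [e]

end Change

/-! ### Spaces charted on a manifold -/

section Tower

variable {E H N : Type*} [NormedAddCommGroup E] [NormedSpace ℝ E] [TopologicalSpace H]
  {I : ModelWithCorners ℝ E H} [TopologicalSpace N] [ChartedSpace H N]

variable (I N) in
/-- The pregroupoid of smooth maps between open subsets of a manifold. -/
def smoothPregroupoid : Pregroupoid N where
  property f u := ContMDiffOn I I ∞ f u
  comp hf hg _ _ _ := hg.comp' hf
  id_mem := contMDiffOn_id
  locality hu h x hx := by
    obtain ⟨v, hv, hxv, hf⟩ := h x hx
    exact (hf.contMDiffAt ((hu.inter hv).mem_nhds ⟨hx, hxv⟩)).contMDiffWithinAt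
  congr _ h hf := hf.congr h

variable {P : Type*} [TopologicalSpace P] [ChartedSpace N P]

variable (I) in
/-- The transition maps of a space charted on a manifold are smooth. -/
def HasSmoothTransitions (_ : ChartedSpace N P) : Prop :=
  ∀ e ∈ atlas N P, ∀ e' ∈ atlas N P,
    ContMDiffOn I I ∞ (e.symm ≫ₕ e' : OpenPartialHomeomorph N N) (e.symm ≫ₕ e').source

/-- Charts into N followed by charts of N have smooth transitions. This allows total spaces to be
given charts in `E3 × Circle`, without choosing charts of the circle by hand. -/
theorem isManifold_comp [IsManifold I ∞ N] (h : HasSmoothTransitions I ‹ChartedSpace N P›) :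
    letI := ChartedSpace.comp H N P
    IsManifold I ∞ P := by
  let _ := ChartedSpace.comp H N P
  have : HasGroupoid P (smoothPregroupoid N I).groupoid :=
    hasGroupoid_of_pregroupoid _ fun {e e'} he he' => h e he e' he'
  have := StructureGroupoid.HasGroupoid.comp (H₁ := H) (H₂ := N) (H₃ := P)
    (G₁ := contDiffGroupoid ∞ I) (smoothPregroupoid N I).groupoid (by
      intro e he
      rw [isLocalStructomorphOn_contDiffGroupoid_iff]
      exact mem_groupoid_of_pregroupoid.1 he)
  exact IsManifold.mk' I ∞ P

theorem contMDiffOn_chart_comp [IsManifold I ∞ N] (h : HasSmoothTransitions I ‹ChartedSpace N P›)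
    {e : OpenPartialHomeomorph P N} (he : e ∈ atlas N P) :
    letI := ChartedSpace.comp H N P
    ContMDiffOn I I ∞ e e.source ∧ ContMDiffOn I I ∞ e.symm e.target := by
  let _ := ChartedSpace.comp H N P
  have : IsManifold I ∞ P := isManifold_comp h
  have hmax : ∀ f ∈ atlas H N, e ≫ₕ f ∈ IsManifold.maximalAtlas I ∞ P := fun f hf =>
    IsManifold.subset_maximalAtlas ⟨e, he, f, hf, rfl⟩
  refine ⟨fun p hp => ?_, fun q hq => ?_⟩
  -- In the composed structure the charts of P are `f ∘ e` with f a chart of N; undoing f shows that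
  -- e itself is smooth.
  · set f := chartAt H (e p)
    have h1 := contMDiffOn_of_mem_maximalAtlas (hmax f (chart_mem_atlas H _))
    have hpf : p ∈ (e ≫ₕ f).source := ⟨hp, mem_chart_source H (e p)⟩
    have h2 := (contMDiffOn_chart_symm (I := I) (n := ∞) (x := e p)).contMDiffAt
      (f.open_target.mem_nhds (f.map_source (mem_chart_source H (e p))))
    have h3 := h2.comp p (h1.contMDiffAt ((e ≫ₕ f).open_source.mem_nhds hpf))
    refine (h3.congr_of_eventuallyEq ?_).contMDiffWithinAt
    filter_upwards [(e ≫ₕ f).open_source.mem_nhds hpf] with p' hp'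
    exact (f.left_inv hp'.2).symm
  · set f := chartAt H q
    have h1 := contMDiffOn_symm_of_mem_maximalAtlas (hmax f (chart_mem_atlas H _))
    have hqf : q ∈ f.source := mem_chart_source H q
    have hfq : f q ∈ (e ≫ₕ f).target := by
      refine ⟨f.map_source hqf, ?_⟩
      change f.symm (f q) ∈ e.target
      rw [f.left_inv hqf]; exact hq
    have h2 := (contMDiffOn_chart (I := I) (n := ∞) (x := q)).contMDiffAt (f.open_source.mem_nhds hqf)
    have h3 := (h1.contMDiffAt ((e ≫ₕ f).open_target.mem_nhds hfq)).comp q h2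
    refine (h3.congr_of_eventuallyEq ?_).contMDiffWithinAt
    filter_upwards [f.open_source.mem_nhds hqf] with q' hq'
    exact congrArg e.symm (f.left_inv hq').symm

end Tower

/-! ### Gluing trivial bundles -/

/-- Transition data of a circle bundle, in the form of a coboundary of (not necessarily continuous)
circle-valued functions. -/
structure GluingData (B : Set E3) where
  ι : Type
  W : ι → Set E3
  isOpen : ∀ i, IsOpen (W i)
  subset : ∀ i, W i ⊆ B
  cover : ∀ x ∈ B, ∃ i, x ∈ W i
  u : ι → E3 → Circle
  smooth : ∀ i j, ContMDiffOn (𝓡 3) (𝓡 1) ∞ (fun x => u i x * (u j x)⁻¹) (W i ∩ W j)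
  pt : B

namespace GluingData

variable {B : Set E3} (D : GluingData B)

/-- The total space of the glued bundle. -/
structure Glued (_ : GluingData B) where
  base : B
  fibre : Circle

variable {D}

/-- The trivialization with index `i`. -/
def chart (i : D.ι) : PartialEquiv D.Glued (E3 × Circle) where
  toFun p := (p.base, D.u i p.base * p.fibre)
  invFun q := open Classical in
    -- Only points over `W i ⊆ B` matter; `D.pt` is a default value.
    ⟨if h : q.1 ∈ B then ⟨q.1, h⟩ else D.pt, (D.u i q.1)⁻¹ * q.2⟩
  source := {p | (p.base : E3) ∈ D.W i}
  target := {q | q.1 ∈ D.W i}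
  map_source' _ hp := hp
  map_target' q hq := by
    have h : q.1 ∈ B := D.subset i hq
    simpa only [dif_pos h, mem_ofPred_eq] using hq
  left_inv' p _ := by simp
  right_inv' q hq := by
    have h : q.1 ∈ B := D.subset i hq
    simp [dif_pos h]

theorem chart_symm_base {i : D.ι} {q : E3 × Circle} (h : q.1 ∈ B) :
    ((chart i).symm q).base = ⟨q.1, h⟩ :=
  dif_pos h

theorem transition_source (i j : D.ι) :
    ((chart i).symm.trans (chart j)).source = {q : E3 × Circle | q.1 ∈ D.W i ∩ D.W j} := by
  ext q
  simp only [PartialEquiv.trans_source, PartialEquiv.symm_source, mem_inter_iff, mem_preimage,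
    mem_ofPred_eq]
  refine and_congr_right fun hq => ?_
  have h : q.1 ∈ B := D.subset i hq
  change (((chart i).symm q).base : E3) ∈ D.W j ↔ _
  rw [chart_symm_base h]

/-- Only the ratios `u j / u i` enter the transitions. The functions u need not be continuous, and
in that form the cocycle condition is automatic. -/
theorem transition_apply (i j : D.ι) {q : E3 × Circle} (hq : q.1 ∈ D.W i ∩ D.W j) :
    (chart i).symm.trans (chart j) q = (q.1, D.u j q.1 * (D.u i q.1)⁻¹ * q.2) := by
  have h : q.1 ∈ B := D.subset i hq.1
  change ((((chart i).symm q).base : E3), D.u j ((chart i).symm q).base * ((D.u i q.1)⁻¹ * q.2)) = _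
  rw [chart_symm_base h, mul_assoc]

theorem isOpen_transition_source (i j : D.ι) :
    IsOpen ((chart i).symm.trans (chart j)).source := by
  rw [transition_source]
  exact ((D.isOpen i).inter (D.isOpen j)).preimage continuous_fst

theorem contMDiffOn_transition (i j : D.ι) : ContMDiffOn J4 J4 ∞ ((chart i).symm.trans (chart j))
    ((chart i).symm.trans (chart j)).source := by
  have h : ContMDiffOn J4 J4 ∞ (fun q : E3 × Circle => (q.1, D.u j q.1 * (D.u i q.1)⁻¹ * q.2))
      {q : E3 × Circle | q.1 ∈ D.W i ∩ D.W j} := by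
    have h1 : ContMDiffOn J4 (𝓡 1) ∞ (fun q : E3 × Circle => D.u j q.1 * (D.u i q.1)⁻¹)
        {q : E3 × Circle | q.1 ∈ D.W i ∩ D.W j} :=
      (D.smooth j i).comp contMDiffOn_fst fun q hq => hq.symm
    exact contMDiffOn_fst.prodMk (contMDiff_circle_mul.comp_contMDiffOn (h1.prodMk contMDiffOn_snd))
  rw [transition_source]
  exact h.congr fun q hq => transition_apply i j hq

variable (D)

/-- The index of a trivialization around a point. -/
def index (p : D.Glued) : D.ι := (D.cover p.base p.base.2).choose

theorem index_mem (p : D.Glued) : (p.base : E3) ∈ D.W (D.index p) :=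
  (D.cover p.base p.base.2).choose_spec

/-- The charts of the total space, with values in the product of the base and the circle. -/
def core : ChartedSpaceCore (E3 × Circle) D.Glued where
  atlas := range chart
  chartAt p := chart (D.index p)
  mem_chart_source p := D.index_mem p
  chart_mem_atlas p := mem_range_self _
  open_source := by
    rintro _ _ ⟨i, rfl⟩ ⟨j, rfl⟩
    exact isOpen_transition_source i j
  continuousOn_toFun := by
    rintro _ _ ⟨i, rfl⟩ ⟨j, rfl⟩
    exact (contMDiffOn_transition i j).continuousOn

instance : TopologicalSpace D.Glued := D.core.toTopologicalSpace

instance chartedProd : ChartedSpace (E3 × Circle) D.Glued := D.core.toChartedSpace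

theorem hasSmoothTransitions : HasSmoothTransitions J4 D.chartedProd := by
  intro e he e' he'
  obtain ⟨_, ⟨i, rfl⟩, he⟩ := mem_iUnion₂.1 he
  obtain ⟨_, ⟨j, rfl⟩, he'⟩ := mem_iUnion₂.1 he'
  obtain rfl := he
  obtain rfl := he'
  exact contMDiffOn_transition i j

instance chartedGlued : ChartedSpace H4 D.Glued := ChartedSpace.comp H4 (E3 × Circle) D.Glued

instance : IsManifold J4 ∞ (E3 × Circle) :=
  have : IsManifold (𝓡 1) ∞ Circle := IsManifold.of_le (n := ω) le_top
  IsManifold.prod E3 Circle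

instance : IsManifold J4 ∞ D.Glued := isManifold_comp D.hasSmoothTransitions

variable {D}

theorem chart_smooth (i : D.ι) :
    ContMDiffOn J4 J4 ∞ (chart (D := D) i) {p | (p.base : E3) ∈ D.W i} ∧
    ContMDiffOn J4 J4 ∞ (chart (D := D) i).symm {q | q.1 ∈ D.W i} := by
  have hmem : D.core.openPartialHomeomorph (chart i) (mem_range_self i) ∈ atlas (E3 × Circle) D.Glued := by
    refine mem_iUnion.2 ⟨chart i, mem_iUnion.2 ⟨mem_range_self i, rfl⟩⟩
  exact contMDiffOn_chart_comp D.hasSmoothTransitions hmem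

theorem isOpen_source (i : D.ι) : IsOpen {p : D.Glued | (p.base : E3) ∈ D.W i} :=
  D.core.open_source' (mem_range_self i)

instance : MulAction Circle D.Glued where
  smul g p := ⟨p.base, g * p.fibre⟩
  one_smul p := congrArg (Glued.mk p.base) (one_mul _)
  mul_smul _ _ p := congrArg (Glued.mk p.base) (mul_assoc _ _ _)

theorem smul_def (g : Circle) (p : D.Glued) : g • p = ⟨p.base, g * p.fibre⟩ := rfl

/-- The projection to the base. -/
def proj (p : D.Glued) : E3 := p.base

theorem smooth_proj : ContMDiff J4 (𝓡 3) ∞ (proj (D := D)) := by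
  intro p
  exact contMDiffAt_fst.comp p
    ((chart_smooth (D.index p)).1.contMDiffAt ((isOpen_source _).mem_nhds (D.index_mem p)))

theorem chart_symm_chart (i : D.ι) {p : D.Glued} (hp : (p.base : E3) ∈ D.W i) :
    (chart i).symm (chart i p) = p := (chart i).left_inv hp

theorem smooth_smul :
    ContMDiff ((𝓡 1).prod J4) J4 ∞ (fun q : Circle × D.Glued => q.1 • q.2) := by
  rintro ⟨g, p⟩
  set i := D.index p
  have hp : (p.base : E3) ∈ D.W i := D.index_mem p
  have h1 : ContMDiffAt ((𝓡 1).prod J4) J4 ∞ (fun q : Circle × D.Glued => chart i q.2) (g, p) :=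
    ((chart_smooth i).1.contMDiffAt ((isOpen_source i).mem_nhds hp)).comp (g, p) contMDiffAt_snd
  have h2 : ContMDiffAt ((𝓡 1).prod J4) J4 ∞
      (fun q : Circle × D.Glued => ((chart i q.2).1, q.1 * (chart i q.2).2)) (g, p) :=
    (contMDiffAt_fst.comp (g, p) h1).prodMk (contMDiff_circle_mul.contMDiffAt.comp (g, p)
      (contMDiffAt_fst.prodMk (contMDiffAt_snd.comp (g, p) h1)))
  have hO : IsOpen {q : E3 × Circle | q.1 ∈ D.W i} := (D.isOpen i).preimage continuous_fst
  have h3 := ((chart_smooth i).2.contMDiffAt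
    (hO.mem_nhds (show ((chart i p).1, g * (chart i p).2) ∈ {q : E3 × Circle | q.1 ∈ D.W i} from hp))).comp
    (g, p) h2
  refine h3.congr_of_eventuallyEq ?_
  filter_upwards [((isOpen_source i).preimage continuous_snd).mem_nhds hp] with q hq
  rw [Function.comp_apply, ← chart_symm_chart i (p := q.1 • q.2) hq]
  congr 1
  change (_, _) = (_, _)
  rw [smul_def]
  congr 1
  exact mul_left_comm _ _ _

variable (D) in
/-- The local section with index `i`. -/
def sec (i : D.ι) (x : E3) : D.Glued := (chart i).symm (x, 1)

variable (D) in
/-- The fibre coordinate with index `i`. -/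
def fib (i : D.ι) (p : D.Glued) : Circle := (chart i p).2

theorem sec_eq {i : D.ι} {x : E3} (hx : x ∈ D.W i) :
    D.sec i x = ⟨⟨x, D.subset i hx⟩, (D.u i x)⁻¹⟩ :=
  congrArg₂ Glued.mk (dif_pos (D.subset i hx)) (mul_one _)

theorem isTrivialization (i : D.ι) : IsTrivialization (proj (D := D)) (D.W i) (D.sec i) (D.fib i) where
  isSection :=
    { smooth := (chart_smooth i).2.comp (contMDiffOn_id.prodMk contMDiffOn_const) fun x hx => hx
      proj := fun x hx => by rw [sec_eq hx, proj] }
  smooth := contMDiff_snd.comp_contMDiffOn (chart_smooth i).1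
  apply_smul x hx g := by
    rw [sec_eq hx]
    change D.u i x * (g * (D.u i x)⁻¹) = g
    exact (mul_left_comm _ _ _).trans (by rw [mul_inv_cancel, mul_one])
  smul_apply p hp := by
    have hp' : (p.base : E3) ∈ D.W i := hp
    rw [proj, sec_eq hp', smul_def, fib]
    change Glued.mk p.base (D.u i p.base * p.fibre * (D.u i p.base)⁻¹) = p
    rw [mul_right_comm, mul_inv_cancel, one_mul]

variable (D) in
/-- The glued bundle. -/
def bundle : U1Bundle B where
  Total := D.Glued
  proj := proj
  proj_mem p := p.base.2
  smooth_proj := smooth_proj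
  smooth_smul := smooth_smul
  proj_smul _ _ := rfl
  locally_trivial x hx := by
    obtain ⟨i, hi⟩ := D.cover x hx
    exact ⟨D.W i, D.isOpen i, hi, D.subset i, D.sec i, D.fib i, isTrivialization i⟩

theorem fib_eq (i j : D.ι) (p : D.Glued) :
    D.fib i p = D.u i (proj p) * (D.u j (proj p))⁻¹ * D.fib j p := by
  change D.u i p.base * p.fibre = D.u i p.base * (D.u j p.base)⁻¹ * (D.u j p.base * p.fibre)
  rw [mul_assoc, inv_mul_cancel_left]

end GluingData

/-! ### The angular form of a trivialization -/

section Angular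

theorem circle_inv_mul_dval_re (a : Circle) (ξ : TangentSpace (𝓡 1) a) :
    ((a : ℂ)⁻¹ * dval (𝓡 1) (fun b : Circle => (b : ℂ)) a ξ).re = 0 := by
  obtain ⟨t, rfl⟩ := Circle.exp_surjective a
  obtain ⟨r, rfl⟩ := exists_eq_smul_mfderiv_exp t ξ
  rw [map_smul, dval_coe_exp]
  have : (Circle.exp t : ℂ) ≠ 0 := Circle.coe_ne_zero _
  have h : (Circle.exp t : ℂ)⁻¹ * (r • ((Circle.exp t : ℂ) * Complex.I)) = r * Complex.I := by
    rw [Complex.real_smul]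
    field_simp
  rw [h]
  simp

variable {P : Type} [TopologicalSpace P] [ChartedSpace H4 P]

theorem angularForm_apply (τ : P → Circle) (p : P) (v : TangentSpace J4 p) :
    angularForm τ p v = (τ p : ℂ)⁻¹ * dval J4 (fun q => (τ q : ℂ)) p v := rfl

theorem angularForm_re {τ : P → Circle} {p : P} (hτ : MDifferentiableAt J4 (𝓡 1) τ p)
    (v : TangentSpace J4 p) : (angularForm τ p v).re = 0 := by
  have h := mfderiv_comp_apply p (mdifferentiableAt_circle_coe (τ p)) hτ v
  have h2 := circle_inv_mul_dval_re (τ p) (mfderiv J4 (𝓡 1) τ p v)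
  rw [angularForm_apply]
  rw [← h2]
  exact congrArg (fun z : ℂ => ((τ p : ℂ)⁻¹ * z).re) h

end Angular

section LocalForms

variable {B : Set E3} {X : U1Bundle B}

theorem U1Bundle.mdifferentiableAt_of_isTrivialization {W : Set E3} (hW : IsOpen W)
    {s : E3 → X.Total} {τ : X.Total → Circle} (hT : IsTrivialization X.proj W s τ) {p : X.Total}
    (hp : X.proj p ∈ W) : MDifferentiableAt J4 (𝓡 1) τ p :=
  (hT.smooth.contMDiffAt ((hW.preimage X.smooth_proj.continuous).mem_nhds hp)).mdifferentiableAt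
    (by simp)

/-- Local connection forms that agree on overlaps define a connection. -/
theorem exists_connection_of_localForms {ι : Type} [Nonempty ι] {W : ι → Set E3} (hW : ∀ i, IsOpen (W i))
    (hcov : ∀ x ∈ B, ∃ i, x ∈ W i) {s : ι → E3 → X.Total} {τ : ι → X.Total → Circle}
    (hT : ∀ i, IsTrivialization X.proj (W i) (s i) (τ i)) {α : ι → E3 → E3 →L[ℝ] ℂ}
    (hα : ∀ i, ContDiffOn ℝ ∞ (α i) (W i)) (hre : ∀ i, ∀ x ∈ W i, ∀ v, (α i x v).re = 0)
    (hcompat : ∀ i j p, X.proj p ∈ W i → X.proj p ∈ W j → ∀ v : TangentSpace J4 p,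
      α i (X.proj p) (dval J4 X.proj p v) + angularForm (τ i) p v =
        α j (X.proj p) (dval J4 X.proj p v) + angularForm (τ j) p v) :
    ∃ A : Connection X, ∀ i, A.HasLocalForm (W i) (τ i) (α i) := by
  choose! k hk using hcov
  have hkp : ∀ p, X.proj p ∈ W (k (X.proj p)) := fun p => hk _ (X.proj_mem p)
  have hτ : ∀ {i p}, X.proj p ∈ W i → MDifferentiableAt J4 (𝓡 1) (τ i) p := fun hp =>
    U1Bundle.mdifferentiableAt_of_isTrivialization (hW _) (hT _) hp
  have hτc : ∀ {i p}, X.proj p ∈ W i → MDifferentiableAt J4 𝓘(ℝ, ℂ) (fun q => (τ i q : ℂ)) p :=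
    fun {i p} hp => (mdifferentiableAt_circle_coe _).comp (I' := 𝓡 1) p (hτ hp)
  -- The chosen index may jump from point to point. By `hcompat` the value does not depend on it, so
  -- near each point one fixed index may be used.
  let form : ∀ p : X.Total, TangentSpace J4 p →L[ℝ] ℂ := fun p =>
    (α (k (X.proj p)) (X.proj p)).comp (dval J4 X.proj p) + angularForm (τ (k (X.proj p))) p
  have hform : ∀ i p, X.proj p ∈ W i → ∀ v : TangentSpace J4 p,
      form p v = α i (X.proj p) (dval J4 X.proj p v) + angularForm (τ i) p v :=
    fun i p hp v => hcompat _ i p (hkp p) hp v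
  refine ⟨⟨form, fun p v => ?_, fun v₀ => ?_, fun p t => ?_, fun g p v => ?_⟩, hform⟩
  · rw [hform _ p (hkp p), Complex.add_re, hre _ _ (hkp p), angularForm_re (hτ (hkp p)), add_zero]
  · set i := k (X.proj v₀.proj)
    have hO : IsOpen (X.proj ⁻¹' W i) := (hW i).preimage X.smooth_proj.continuous
    have hO' : IsOpen (Bundle.TotalSpace.proj ⁻¹' (X.proj ⁻¹' W i) : Set (TangentBundle J4 X.Total)) :=
      hO.preimage (Bundle.contMDiff_proj (n := ∞) (IB := J4) (TangentSpace J4 (M := X.Total))).continuous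
    have hmem : v₀ ∈ (Bundle.TotalSpace.proj ⁻¹' (X.proj ⁻¹' W i) : Set (TangentBundle J4 X.Total)) :=
      hkp v₀.proj
    have h1 := (contMDiffOn_base_form (X := X) (hW i) (hα i)).contMDiffAt (hO'.mem_nhds hmem)
    have hc : ContMDiffOn J4 𝓘(ℝ, ℂ) ∞ (fun q => (τ i q : ℂ)) (X.proj ⁻¹' W i) :=
      contMDiff_circle_coe.comp_contMDiffOn (hT i).smooth
    have h2 := (contMDiffOn_dval hO hc).contMDiffAt (hO'.mem_nhds hmem)
    have hp : ContMDiff J4.tangent J4 ∞ (Bundle.TotalSpace.proj : TangentBundle J4 X.Total → X.Total) :=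
      Bundle.contMDiff_proj _
    have h3 : ContMDiffAt J4.tangent (𝓡 1) ∞ (fun v : TangentBundle J4 X.Total => (τ i v.proj)⁻¹) v₀ :=
      contMDiff_circle_inv.contMDiffAt.comp v₀
        (((hT i).smooth.contMDiffAt (hO.mem_nhds hmem)).comp v₀ hp.contMDiffAt)
    have h4 : ContMDiffAt J4.tangent 𝓘(ℝ, ℂ) ∞
        (fun v : TangentBundle J4 X.Total => (((τ i v.proj)⁻¹ : Circle) : ℂ)) v₀ :=
      contMDiff_circle_coe.contMDiffAt.comp v₀ h3
    have hmul : ContDiff ℝ ∞ fun z : ℂ × ℂ => z.1 * z.2 := contDiff_fst.mul contDiff_snd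
    have h5 : ContMDiffAt J4.tangent 𝓘(ℝ, ℂ) ∞ (fun v : TangentBundle J4 X.Total =>
        (((τ i v.proj)⁻¹ : Circle) : ℂ) * dval J4 (fun q => (τ i q : ℂ)) v.proj v.snd) v₀ :=
      hmul.contMDiff.contMDiffAt.comp v₀ (h4.prodMk_space h2)
    refine (h1.add h5).congr_of_eventuallyEq ?_
    filter_upwards [hO'.mem_nhds hmem] with v hv
    rw [hform i v.proj hv, angularForm_apply, ← Circle.coe_inv]
    rfl
  · set q := Circle.exp t • p
    have hq := hkp q
    set i := k (X.proj q)
    have hpi : X.proj p ∈ W i := by rw [← X.proj_smul (Circle.exp t) p]; exact hq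
    rw [hform i q hq, dval_proj_vertical, map_zero, zero_add, angularForm_apply]
    have hv : MDifferentiableAt 𝓘(ℝ, ℝ) J4 (fun u : ℝ => Circle.exp u • p) t :=
      (mdifferentiableAt_smul_left (Circle.exp t) p).comp t (mdifferentiableAt_circle_exp t)
    have h1 := mfderiv_comp_apply t (hτc hq) hv (1 : ℝ)
    have h2 : (fun q => (τ i q : ℂ)) ∘ (fun u : ℝ => Circle.exp u • p) =
        fun u : ℝ => (Circle.exp u : ℂ) * τ i p := by
      ext1 u
      rw [Function.comp_apply, (hT i).apply_smul_total hpi, Circle.coe_mul]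
    have h3 : HasDerivAt (fun u : ℝ => (Circle.exp u : ℂ) * τ i p)
        (Circle.exp t * Complex.I * τ i p) t := by
      have h := (((Complex.ofRealCLM.hasDerivAt (x := t)).mul_const Complex.I).cexp).mul_const
        (τ i p : ℂ)
      simpa [Function.comp_def, Circle.coe_exp] using h
    have h4 : dval J4 (fun q => (τ i q : ℂ)) q
        (mfderiv 𝓘(ℝ, ℝ) J4 (fun u : ℝ => Circle.exp u • p) t (1 : ℝ)) =
          Circle.exp t * Complex.I * τ i p := by
      refine h1.symm.trans ?_
      rw [h2, mfderiv_eq_fderiv]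
      exact h3.deriv
    have h5 : (τ i q : ℂ) = Circle.exp t * τ i p := by
      rw [(hT i).apply_smul_total hpi, Circle.coe_mul]
    rw [h4, h5]
    have n1 : (Circle.exp t : ℂ) ≠ 0 := Circle.coe_ne_zero _
    have n2 : (τ i p : ℂ) ≠ 0 := Circle.coe_ne_zero _
    field_simp
  · have hp := hkp p
    set i := k (X.proj p)
    have hgp : X.proj (g • p) ∈ W i := by rw [X.proj_smul]; exact hp
    rw [hform i _ hgp, hform i p hp, dval_proj_smul, X.proj_smul, angularForm_apply,
      angularForm_apply]
    congr 1
    have h1 := mfderiv_comp_apply p (hτc hgp) (mdifferentiableAt_smul_right g p) v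
    have h2 : (fun q => (τ i q : ℂ)) ∘ (fun q : X.Total => g • q) =ᶠ[𝓝 p]
        fun q => (g : ℂ) * τ i q := by
      filter_upwards [((hW i).preimage X.smooth_proj.continuous).mem_nhds hp] with q hq
      rw [Function.comp_apply, (hT i).apply_smul_total hq, Circle.coe_mul]
    have h3 : MDifferentiableAt 𝓘(ℝ, ℂ) 𝓘(ℝ, ℂ) (fun z : ℂ => (g : ℂ) * z) (τ i p) :=
      ((differentiableAt_id (𝕜 := ℝ)).const_mul (g : ℂ)).mdifferentiableAt
    have h4 := mfderiv_comp_apply p h3 (hτc hp) v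
    have h5 : dval J4 (fun q => (τ i q : ℂ)) (g • p) (mfderiv J4 J4 (fun q : X.Total => g • q) p v) =
        g * dval J4 (fun q => (τ i q : ℂ)) p v := by
      refine h1.symm.trans ?_
      rw [h2.mfderiv_eq]
      refine h4.trans ?_
      rw [mfderiv_eq_fderiv, fderiv_const_mul (differentiableAt_id (𝕜 := ℝ))]
      have h6 : fderiv ℝ (fun z : ℂ => z) (τ i p : ℂ) = ContinuousLinearMap.id ℝ ℂ := fderiv_id
      change ((g : ℂ) • fderiv ℝ (fun z : ℂ => z) (τ i p : ℂ)) _ = _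
      rw [h6]
      rfl
    have h7 : (τ i (g • p) : ℂ) = g * τ i p := by
      rw [(hT i).apply_smul_total hp, Circle.coe_mul]
    rw [h5, h7]
    have n1 : (g : ℂ) ≠ 0 := Circle.coe_ne_zero _
    have n2 : (τ i p : ℂ) ≠ 0 := Circle.coe_ne_zero _
    field_simp

/-- The derivative of `G⁻¹` contributes a multiple of `dG ∧ dG = 0`, and the remaining term vanishes
by symmetry of the second derivative. -/
theorem dOne_logarithmic {G : E3 → ℂ} {x : E3} (hG : ContDiffAt ℝ ∞ G x) (h0 : G x ≠ 0) :
    DifferentiableAt ℝ (fun y => (G y)⁻¹ • fderiv ℝ G y) x ∧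
      dOne (fun y => (G y)⁻¹ • fderiv ℝ G y) x = 0 := by
  have hd : DifferentiableAt ℝ (fderiv ℝ G) x :=
    ((hG.of_le two_le_infty).fderiv_right (m := 1) (by norm_num)).differentiableAt (by norm_num)
  have hGd : DifferentiableAt ℝ G x := hG.differentiableAt (by simp)
  have hinv : HasFDerivAt (fun y => (G y)⁻¹) (-(G x ^ 2)⁻¹ • fderiv ℝ G x) x :=
    (hasDerivAt_inv h0).comp_hasFDerivAt x hGd.hasFDerivAt
  have h : HasFDerivAt (fun y => (G y)⁻¹ • fderiv ℝ G y) _ x := hinv.smul hd.hasFDerivAt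
  refine ⟨h.differentiableAt, ?_⟩
  have hsym : IsSymmSndFDerivAt ℝ G x := hG.isSymmSndFDerivAt (by simpa using two_le_infty)
  ext v
  rw [dOne_apply h.differentiableAt]
  have hf : fderiv ℝ (fun y => (G y)⁻¹ • fderiv ℝ G y) x = _ := h.fderiv
  rw [hf]
  have := hsym (v 0) (v 1)
  simp [this]
  ring

theorem hasCurvature_of_localForms (A : Connection X) {ι : Type} {W : ι → Set E3}
    (hW : ∀ i, IsOpen (W i)) (hcov : ∀ x ∈ B, ∃ i, x ∈ W i) {s : ι → E3 → X.Total}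
    {τ : ι → X.Total → Circle} (hT : ∀ i, IsTrivialization X.proj (W i) (s i) (τ i))
    {α : ι → E3 → E3 →L[ℝ] ℂ} (hα : ∀ i, ContDiffOn ℝ ∞ (α i) (W i))
    (hA : ∀ i, A.HasLocalForm (W i) (τ i) (α i)) {F : E3 → E3 [⋀^Fin 2]→L[ℝ] ℝ}
    (hF : ∀ i, ∀ x ∈ W i, dOne (α i) x = iMul.compContinuousAlternatingMap (F x)) :
    A.HasCurvature F := by
  intro N hN hNB t ht x hx
  obtain ⟨i, hi⟩ := hcov x (hNB hx)
  have hO : IsOpen (N ∩ W i) := hN.inter (hW i)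
  have hsub : X.proj ⁻¹' (N ∩ W i) ⊆ X.proj ⁻¹' W i := preimage_mono inter_subset_right
  have hform : A.HasLocalForm (N ∩ W i) (τ i) (α i) := fun p hp v => hA i p (hsub hp) v
  have ht' : IsSection X.proj (N ∩ W i) t := U1Bundle.section_mono ht inter_subset_left
  -- An arbitrary section t differs from the reference section by the phase `τ i ∘ t`, and the
  -- logarithmic differential of that phase is closed.
  have he : A.pullback t =ᶠ[𝓝 x] fun y => α i y +
      (τ i (t y) : ℂ)⁻¹ • fderiv ℝ (fun y => (τ i (t y) : ℂ)) y := by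
    filter_upwards [hO.mem_nhds ⟨hx, hi⟩] with y hy
    exact pullback_eq_of_hasLocalForm A hform hO ((hT i).smooth.mono hsub) ht' hy
  have hG : ContDiffAt ℝ ∞ (fun y => (τ i (t y) : ℂ)) x := by
    have h1 : ContMDiffAt J4 (𝓡 1) ∞ (τ i) (t x) := (hT i).smooth.contMDiffAt
      (((hW i).preimage X.smooth_proj.continuous).mem_nhds (by
        rw [mem_preimage, ht.proj x hx]; exact hi))
    exact (contMDiff_circle_coe.contMDiffAt.comp x
      (h1.comp x (U1Bundle.contMDiffAt_section hN ht hx))).contDiffAt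
  obtain ⟨hld, hl0⟩ := dOne_logarithmic hG (Circle.coe_ne_zero _)
  have hαd : DifferentiableAt ℝ (α i) x :=
    ((hα i).contDiffAt ((hW i).mem_nhds hi)).differentiableAt (by simp)
  rw [dOne_congr he, dOne_add hαd hld, hl0, add_zero, hF i x hi]

end LocalForms

/-! ### The angular coordinate -/

/-- The horizontal coordinates, as a complex number. -/
def horiz : E3 →L[ℝ] ℂ := Complex.ofRealCLM.comp (coord 0) + Complex.I • Complex.ofRealCLM.comp (coord 1)

theorem horiz_apply (x : E3) : horiz x = x 0 + Complex.I * x 1 := by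
  simp [horiz]

/-- The phase `exp (i θ₃)`. -/
def phase (x : E3) : Circle := Circle.exp (Complex.arg (horiz x))

theorem coe_phase {x : E3} (hx : horiz x ≠ 0) : (phase x : ℂ) = horiz x / ‖horiz x‖ := by
  rw [phase, Circle.coe_exp, eq_div_iff (by simpa using hx), mul_comm]
  exact Complex.norm_mul_exp_arg_mul_I _

theorem horiz_ne_zero {x : E3} (hx : x ∈ U) : horiz x ≠ 0 := by
  intro h
  have h1 := congrArg Complex.re h
  have h2 := congrArg Complex.im h
  rw [horiz_apply] at h1 h2
  exact hx.2 ⟨by simpa using h1, by simpa using h2⟩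

/-- Near a point off the axis, the phase is the exponential of a smooth angle, whose differential is
`dθ₃`. -/
theorem exists_angle {x : E3} (hx : x ∈ U) : ∃ φ : E3 → ℝ, ContDiffAt ℝ ∞ φ x ∧
    phase =ᶠ[𝓝 x] (fun y => Circle.exp (φ y)) ∧ HasFDerivAt φ (dθ₃ x) x := by
  have hx0 := horiz_ne_zero hx
  -- The principal argument jumps across a half-plane. Dividing by the value at x moves the argument
  -- of the logarithm close to 1, away from its cut.
  set φ : E3 → ℝ := fun y => Complex.arg (horiz x) + (Complex.log (horiz y / horiz x)).im with hφ
  have hcont : ContinuousAt (fun y => horiz y / horiz x) x := by fun_prop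
  have h1 : horiz x / horiz x = 1 := div_self hx0
  have hslit : horiz x / horiz x ∈ Complex.slitPlane := by rw [h1]; exact Complex.one_mem_slitPlane
  have hlog : ContDiffAt ℝ ∞ Complex.log (horiz x / horiz x) :=
    (Complex.contDiffAt_log hslit (n := ∞)).restrict_scalars ℝ
  refine ⟨φ, ?_, ?_, ?_⟩
  · have h2 : ContDiffAt ℝ ∞ (fun y => horiz y / horiz x) x := horiz.contDiff.contDiffAt.div_const _
    have h3 : ContDiffAt ℝ ∞ (fun y => Complex.log (horiz y / horiz x)) x :=
      ContDiffAt.comp (g := Complex.log) x hlog h2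
    have h4 : ContDiffAt ℝ ∞ (fun y => (Complex.log (horiz y / horiz x)).im) x :=
      Complex.imCLM.contDiff.contDiffAt.comp x h3
    exact contDiffAt_const.add h4
  · filter_upwards [isOpen_U.mem_nhds hx] with y hy
    have hy0 := horiz_ne_zero hy
    have hq : horiz y / horiz x ≠ 0 := div_ne_zero hy0 hx0
    refine Circle.ext ?_
    rw [coe_phase hy0, Circle.coe_exp]
    simp only [hφ, Complex.log_im]
    push_cast
    rw [add_mul, Complex.exp_add]
    have e1 := Complex.norm_mul_exp_arg_mul_I (horiz x)
    have e2 := Complex.norm_mul_exp_arg_mul_I (horiz y / horiz x)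
    have n1 : (‖horiz x‖ : ℂ) ≠ 0 := by simpa using hx0
    have n2 : (‖horiz y‖ : ℂ) ≠ 0 := by simpa using hy0
    rw [norm_div] at e2
    push_cast at e2
    rw [div_eq_iff n2]
    have e3 : horiz y = (‖horiz x‖ * Complex.exp ((horiz x).arg * Complex.I)) *
        (‖horiz y‖ / ‖horiz x‖ * Complex.exp ((horiz y / horiz x).arg * Complex.I)) := by
      rw [e1, e2]; field_simp
    nth_rewrite 1 [e3]
    field_simp
  · have h2 : HasFDerivAt (fun y => horiz y / horiz x) ((horiz x)⁻¹ • horiz) x := by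
      simp only [div_eq_mul_inv]
      exact horiz.hasFDerivAt.mul_const _
    have h3 := ((Complex.hasDerivAt_log hslit).hasFDerivAt.restrictScalars ℝ).comp x h2
    have h4 := (Complex.imCLM.hasFDerivAt.comp x h3).const_add (Complex.arg (horiz x))
    refine h4.congr_fderiv ?_
    ext v
    have hr : x 0 ^ 2 + x 1 ^ 2 ≠ 0 := by
      rcases not_and_or.1 hx.2 with h | h <;> positivity
    simp only [h1, inv_one, ContinuousLinearMap.comp_apply, smul_apply, smul_eq_mul,
      Complex.imCLM_apply, ContinuousLinearMap.coe_restrictScalars',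
      ContinuousLinearMap.toSpanSingleton_apply, mul_one]
    rw [Complex.mul_im, Complex.inv_re, Complex.inv_im, horiz_apply, horiz_apply]
    simp [dθ₃, Complex.normSq_apply]
    field_simp
    ring

/-- Integrality of n is essential: `exp (i n θ₃)` is single-valued around the axis, and its
logarithmic differential is `i n dθ₃`. -/
theorem phase_zpow_local {x : E3} (hx : x ∈ U) (n : ℤ) :
    ContMDiffAt (𝓡 3) (𝓡 1) ∞ (fun y => phase y ^ n) x ∧
    ((phase x ^ n : Circle) : ℂ)⁻¹ • fderiv ℝ (fun y => ((phase y ^ n : Circle) : ℂ)) x =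
      iMul.comp ((n : ℝ) • dθ₃ x) := by
  obtain ⟨φ, hφ, he, hd⟩ := exists_angle hx
  have he' : (fun y => phase y ^ n) =ᶠ[𝓝 x] fun y => Circle.exp (n * φ y) := by
    filter_upwards [he] with y hy
    rw [hy, ← zsmul_eq_mul, Circle.exp_zsmul]
  have hs : ContDiffAt ℝ ∞ (fun y => (n : ℝ) * φ y) x := contDiffAt_const.mul hφ
  refine ⟨(contMDiff_circleExp.contMDiffAt.comp x hs.contMDiffAt).congr_of_eventuallyEq he', ?_⟩
  have hexp : HasFDerivAt (fun y => (Circle.exp (n * φ y) : ℂ))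
      ((Circle.exp (n * φ x) : ℂ) • (Complex.I • Complex.ofRealCLM.comp ((n : ℝ) • dθ₃ x))) x := by
    have h1 := ((Complex.ofRealCLM.hasFDerivAt.comp x (hd.const_mul (n : ℝ))).mul_const
      Complex.I).cexp
    simp only [Circle.coe_exp]
    exact h1
  have he'' : (fun y => ((phase y ^ n : Circle) : ℂ)) =ᶠ[𝓝 x] fun y => (Circle.exp (n * φ y) : ℂ) :=
    he'.mono fun y hy => congrArg (fun a : Circle => (a : ℂ)) hy
  rw [he''.fderiv_eq, hexp.fderiv, he''.eq_of_nhds, smul_smul,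
    inv_mul_cancel₀ (Circle.coe_ne_zero _), one_smul]
  rfl

theorem angularForm_base_mul {B : Set E3} {X : U1Bundle B} {τ τ' : X.Total → Circle} {w : E3 → Circle}
    {p : X.Total} (hτ' : MDifferentiableAt J4 (𝓡 1) τ' p)
    (hw : ContMDiffAt (𝓡 3) (𝓡 1) ∞ w (X.proj p))
    (h : τ =ᶠ[𝓝 p] fun q => w (X.proj q) * τ' q) (v : TangentSpace J4 p) :
    angularForm τ p v = (w (X.proj p) : ℂ)⁻¹ * fderiv ℝ (fun y => (w y : ℂ)) (X.proj p)
      (dval J4 X.proj p v) + angularForm τ' p v := by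
  have hwc : MDifferentiableAt (𝓡 3) 𝓘(ℝ, ℂ) (fun y => (w y : ℂ)) (X.proj p) :=
    (mdifferentiableAt_circle_coe _).comp (I' := 𝓡 1) _ (hw.mdifferentiableAt (by simp))
  have hτc : MDifferentiableAt J4 𝓘(ℝ, ℂ) (fun q => (τ' q : ℂ)) p :=
    (mdifferentiableAt_circle_coe _).comp (I' := 𝓡 1) p hτ'
  have hπ : MDifferentiableAt J4 (𝓡 3) X.proj p := X.smooth_proj.mdifferentiableAt (by simp)
  have h1 := (hwc.comp p hπ).hasMFDerivAt.mul hτc.hasMFDerivAt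
  have he : (fun q => (τ q : ℂ)) =ᶠ[𝓝 p]
      ((fun y => (w y : ℂ)) ∘ X.proj) * fun q => (τ' q : ℂ) := by
    filter_upwards [h] with q hq
    rw [hq, Circle.coe_mul]
    rfl
  have h2 : dval J4 (fun q => (τ q : ℂ)) p v = (w (X.proj p) : ℂ) * dval J4 (fun q => (τ' q : ℂ)) p v +
      τ' p * dval J4 ((fun y => (w y : ℂ)) ∘ X.proj) p v := by
    have h3 := he.mfderiv_eq.trans h1.mfderiv
    exact congrArg (fun L => L v) h3
  have h4 : dval J4 ((fun y => (w y : ℂ)) ∘ X.proj) p v =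
      fderiv ℝ (fun y => (w y : ℂ)) (X.proj p) (dval J4 X.proj p v) := by
    refine (mfderiv_comp_apply p hwc hπ v).trans ?_
    rw [mfderiv_eq_fderiv]
    rfl
  have h5 : (τ p : ℂ) = w (X.proj p) * τ' p := he.eq_of_nhds
  rw [angularForm_apply, angularForm_apply, h2, h4, h5]
  have n1 : (w (X.proj p) : ℂ) ≠ 0 := Circle.coe_ne_zero _
  have n2 : (τ' p : ℂ) ≠ 0 := Circle.coe_ne_zero _
  field_simp
  ring

/-! ### The three patches -/

/-- A segment from a point of the axis to a point off it meets the axis only at its starting point;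
a segment within the axis stays in the convex set of allowed heights. -/
theorem starConvex_axis_condition {P : ℝ → Prop} (hP : Convex ℝ {t | P t}) {z : ℝ} (hz : 0 < z)
    (hPz : P z) : StarConvex ℝ (axisPoint z) {x : E3 | x ∈ H3 ∧ (x 0 = 0 → x 1 = 0 → P (x 2))} := by
  rintro y ⟨hy, hy'⟩ a b ha hb hab
  have e0 : (a • axisPoint z + b • y) 0 = b * y 0 := by simp [axisPoint]
  have e1 : (a • axisPoint z + b • y) 1 = b * y 1 := by simp [axisPoint]
  have e2 : (a • axisPoint z + b • y) 2 = a * z + b * y 2 := by simp [axisPoint]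
  have hy2 : 0 < y 2 := hy
  rcases hb.eq_or_lt with rfl | hb
  · obtain rfl : a = 1 := by simpa using hab
    refine ⟨?_, fun _ _ => ?_⟩
    · change 0 < (1 • axisPoint z + (0 : ℝ) • y) 2
      rw [e2]; simpa
    · rw [e2]; simpa
  · refine ⟨?_, fun h0 h1 => ?_⟩
    · change 0 < (a • axisPoint z + b • y) 2
      rw [e2]; positivity
    · rw [e0, mul_eq_zero, or_iff_right hb.ne'] at h0
      rw [e1, mul_eq_zero, or_iff_right hb.ne'] at h1
      rw [e2]
      exact hP hPz (hy' h0 h1) ha hb.le hab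

theorem starConvex_U₁ {c : ℝ} (hc : 0 < c) : StarConvex ℝ (axisPoint (c / 2)) (U₁ c) := by
  convert starConvex_axis_condition (P := fun t => t < c) (convex_Iio c) (half_pos hc)
    (half_lt_self hc) using 1
  ext x; exact mem_U₁_iff

theorem starConvex_U₂ {c₁ c₂ : ℝ} (h₁ : 0 < c₁) (h₁₂ : c₁ < c₂) :
    StarConvex ℝ (axisPoint ((c₁ + c₂) / 2)) (U₂ c₁ c₂) := by
  convert starConvex_axis_condition (P := fun t => c₁ < t ∧ t < c₂) (convex_Ioo c₁ c₂)
    (z := (c₁ + c₂) / 2) (by linarith) ⟨by linarith, by linarith⟩ using 1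
  ext x; exact mem_U₂_iff h₁

theorem starConvex_U₃ {c : ℝ} (hc : 0 < c) : StarConvex ℝ (axisPoint (c + 1)) (U₃ c) := by
  convert starConvex_axis_condition (P := fun t => c < t) (convex_Ioi c) (z := c + 1) (by linarith)
    (by linarith) using 1
  ext x; exact mem_U₃_iff hc

/-- The sets `U₁`, `U₂`, `U₃`. -/
def patch (c₁ c₂ : ℝ) : Fin 3 → Set E3 := ![U₁ c₁, U₂ c₁ c₂, U₃ c₂]

/-- The constants of the gauge forms on the three patches. -/
def level : Fin 3 → ℤ := ![-1, 0, 1]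

section Patch

variable {c₁ c₂ : ℝ}

theorem isOpen_patch (h₁ : 0 < c₁) (h₁₂ : c₁ < c₂) : ∀ i, IsOpen (patch c₁ c₂ i)
  | 0 => isOpen_U₁ c₁
  | 1 => isOpen_U₂ h₁
  | 2 => isOpen_U₃ (h₁.trans h₁₂)

theorem patch_subset_M (h₁ : 0 < c₁) (h₁₂ : c₁ < c₂) (i : Fin 3) : patch c₁ c₂ i ⊆ M c₁ c₂ := by
  rw [M_eq_union h₁ h₁₂]
  match i with
  | 0 => exact fun x hx => Or.inl (Or.inl hx)
  | 1 => exact fun x hx => Or.inl (Or.inr hx)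
  | 2 => exact fun x hx => Or.inr hx

theorem exists_mem_patch (h₁ : 0 < c₁) (h₁₂ : c₁ < c₂) {x : E3} (hx : x ∈ M c₁ c₂) :
    ∃ i, x ∈ patch c₁ c₂ i := by
  rw [M_eq_union h₁ h₁₂] at hx
  rcases hx with (hx | hx) | hx
  exacts [⟨0, hx⟩, ⟨1, hx⟩, ⟨2, hx⟩]

theorem U_subset_patch : ∀ i, U ⊆ patch c₁ c₂ i
  | 0 => subset_union_left
  | 1 => subset_union_left
  | 2 => subset_union_left

/-- The three intervals of the axis are disjoint, so distinct patches meet only where the phase is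
smooth. -/
theorem patch_inter_subset_U (h₁ : 0 < c₁) (h₁₂ : c₁ < c₂) {i j : Fin 3} (hij : i ≠ j) :
    patch c₁ c₂ i ∩ patch c₁ c₂ j ⊆ U := by
  rintro x ⟨hi, hj⟩
  have hax : ∀ i, x ∈ patch c₁ c₂ i → x 0 = 0 → x 1 = 0 →
      (i = 0 ∧ x 2 < c₁) ∨ (i = 1 ∧ c₁ < x 2 ∧ x 2 < c₂) ∨ (i = 2 ∧ c₂ < x 2) := fun i hi h0 h1 =>
    match i with
    | 0 => Or.inl ⟨rfl, (mem_U₁_iff.1 hi).2 h0 h1⟩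
    | 1 => Or.inr (Or.inl ⟨rfl, ((mem_U₂_iff h₁).1 hi).2 h0 h1⟩)
    | 2 => Or.inr (Or.inr ⟨rfl, ((mem_U₃_iff (h₁.trans h₁₂)).1 hi).2 h0 h1⟩)
  refine mem_U_iff.2 ⟨(patch_subset_M h₁ h₁₂ i hi).1, fun h0 h1 => hij ?_⟩
  rcases hax i hi h0 h1 with ⟨rfl, _⟩ | ⟨rfl, _, _⟩ | ⟨rfl, _⟩ <;>
  rcases hax j hj h0 h1 with ⟨rfl, _⟩ | ⟨rfl, _, _⟩ | ⟨rfl, _⟩ <;>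
  first | rfl | (exfalso; linarith)

theorem contDiffOn_realGaugeForm_patch (h₁ : 0 < c₁) (h₁₂ : c₁ < c₂) :
    ∀ i, ContDiffOn ℝ ∞ (realGaugeForm c₁ c₂ (level i)) (patch c₁ c₂ i)
  | 0 => by simpa [level, patch] using contDiffOn_realGaugeForm_U₁ h₁ h₁₂
  | 1 => by simpa [level, patch] using contDiffOn_realGaugeForm_U₂ h₁ h₁₂
  | 2 => by simpa [level, patch] using contDiffOn_realGaugeForm_U₃ h₁ h₁₂

theorem contDiffOn_gaugeForm_patch (h₁ : 0 < c₁) (h₁₂ : c₁ < c₂) (i : Fin 3) :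
    ContDiffOn ℝ ∞ (gaugeForm c₁ c₂ (level i)) (patch c₁ c₂ i) :=
  ContDiffOn.iMul_comp (contDiffOn_realGaugeForm_patch h₁ h₁₂ i)

theorem gaugeForm_re (k : ℝ) (x v : E3) : (gaugeForm c₁ c₂ k x v).re = 0 := by
  simp [gaugeForm, iMul]

theorem exists_starConvex_patch (h₁ : 0 < c₁) (h₁₂ : c₁ < c₂) (i : Fin 3) :
    ∃ x₀ ∈ patch c₁ c₂ i, StarConvex ℝ x₀ (patch c₁ c₂ i) := by
  have h : ∀ i, ∃ z, StarConvex ℝ (axisPoint z) (patch c₁ c₂ i) := fun i =>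
    match i with
    | 0 => ⟨_, starConvex_U₁ h₁⟩
    | 1 => ⟨_, starConvex_U₂ h₁ h₁₂⟩
    | 2 => ⟨_, starConvex_U₃ (h₁.trans h₁₂)⟩
  obtain ⟨z, hz⟩ := h i
  -- Any point of U serves here: it shows the patch nonempty, so that the star centre belongs to it.
  have hU : (!₂[1, 0, 1] : E3) ∈ U := by
    rw [mem_U_iff]
    exact ⟨by simp [H3], by simp⟩
  exact ⟨_, hz.mem ⟨_, U_subset_patch i hU⟩, hz⟩

variable {Γ₁ Γ₂ : E3 → ℝ}

theorem dOne_gaugeForm_patch (h₁ : 0 < c₁) (h₁₂ : c₁ < c₂)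
    (hΓ₁ : IsFundamentalSolution (axisPoint c₁) Γ₁) (hΓ₂ : IsFundamentalSolution (axisPoint c₂) Γ₂)
    (i : Fin 3) {x : E3} (hx : x ∈ patch c₁ c₂ i) :
    dOne (gaugeForm c₁ c₂ (level i)) x =
      iMul.compContinuousAlternatingMap (starD (potential Γ₁ Γ₂) x) :=
  dOne_gaugeForm h₁ (h₁.trans h₁₂) hΓ₁ hΓ₂ (isOpen_patch h₁ h₁₂ i) (U_subset_patch i)
    (patch_subset_M h₁ h₁₂ i) (contDiffOn_realGaugeForm_patch h₁ h₁₂ i) hx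

/-- A connection with curvature `*dV` has the local forms `gaugeForm` in suitable
trivializations. -/
theorem exists_trivialization_patch (h₁ : 0 < c₁) (h₁₂ : c₁ < c₂)
    (hΓ₁ : IsFundamentalSolution (axisPoint c₁) Γ₁) (hΓ₂ : IsFundamentalSolution (axisPoint c₂) Γ₂)
    {X : U1Bundle (M c₁ c₂)} {A : Connection X} (hA : A.HasCurvature (starD (potential Γ₁ Γ₂)))
    (i : Fin 3) : ∃ s τ, IsTrivialization X.proj (patch c₁ c₂ i) s τ ∧
      A.HasLocalForm (patch c₁ c₂ i) τ (gaugeForm c₁ c₂ (level i)) := by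
  have hW := isOpen_patch h₁ h₁₂ i
  obtain ⟨x₀, hx₀, hstar⟩ := exists_starConvex_patch h₁ h₁₂ i
  obtain ⟨s, hs⟩ := exists_isFlatSection hA hW (patch_subset_M h₁ h₁₂ i)
    (contDiffOn_gaugeForm_patch h₁ h₁₂ i) (fun x _ v => gaugeForm_re _ x v)
    (fun x hx => dOne_gaugeForm_patch h₁ h₁₂ hΓ₁ hΓ₂ i hx) hx₀ hstar
  have hT := U1Bundle.isTrivialization_fibreCoord hW hs.isSection
  exact ⟨s, _, hT, hasLocalForm_of_pullback_eq A hW hT hs.pullback_eq⟩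

/-! ### Existence of a bundle with class `[*dV] / 2π` -/

theorem phase_transition (i j : Fin 3) (x : E3) :
    phase x ^ (-level i) * (phase x ^ (-level j))⁻¹ = phase x ^ (level j - level i) := by
  rw [← zpow_neg, neg_neg, ← zpow_add, neg_add_eq_sub]

/-- The transition data of the two-monopole bundle. -/
def gluingData (h₁ : 0 < c₁) (h₁₂ : c₁ < c₂) : GluingData (M c₁ c₂) where
  ι := Fin 3
  W := patch c₁ c₂
  isOpen := isOpen_patch h₁ h₁₂
  subset := patch_subset_M h₁ h₁₂
  cover _ := exists_mem_patch h₁ h₁₂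
  u i x := phase x ^ (-level i)
  smooth i j := by
    rcases eq_or_ne i j with rfl | hij
    · simp only [mul_inv_cancel]
      exact contMDiffOn_const
    · intro x hx
      simp only [phase_transition]
      exact (phase_zpow_local (patch_inter_subset_U h₁ h₁₂ hij hx) _).1.contMDiffWithinAt
  pt := ⟨_, patch_subset_M h₁ h₁₂ 0 (exists_starConvex_patch h₁ h₁₂ 0).choose_spec.1⟩

/-- The gauge forms differ by `(level i - level j) i dθ₃`, and the angular forms of `τ i` and `τ j`
by the opposite multiple. -/
theorem gaugeForm_compat (h₁ : 0 < c₁) (h₁₂ : c₁ < c₂) {X : U1Bundle (M c₁ c₂)}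
    {s : Fin 3 → E3 → X.Total} {τ : Fin 3 → X.Total → Circle}
    (hT : ∀ i, IsTrivialization X.proj (patch c₁ c₂ i) (s i) (τ i))
    (hτ : ∀ i j q, τ i q = phase (X.proj q) ^ (level j - level i) * τ j q) (i j : Fin 3) (p : X.Total)
    (hi : X.proj p ∈ patch c₁ c₂ i) (hj : X.proj p ∈ patch c₁ c₂ j) (v : TangentSpace J4 p) :
    gaugeForm c₁ c₂ (level i) (X.proj p) (dval J4 X.proj p v) + angularForm (τ i) p v =
      gaugeForm c₁ c₂ (level j) (X.proj p) (dval J4 X.proj p v) + angularForm (τ j) p v := by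
  rcases eq_or_ne i j with rfl | hij
  · rfl
  obtain ⟨hw, hdw⟩ := phase_zpow_local (patch_inter_subset_U h₁ h₁₂ hij ⟨hi, hj⟩) (level j - level i)
  rw [angularForm_base_mul
    (U1Bundle.mdifferentiableAt_of_isTrivialization (isOpen_patch h₁ h₁₂ j) (hT j) hj) hw
    (Eventually.of_forall (hτ i j)) v]
  have h := congrArg (fun L : E3 →L[ℝ] ℂ => L (dval J4 X.proj p v)) hdw
  simp only [smul_apply, smul_eq_mul] at h
  rw [h, ← add_assoc]
  congr 1
  simp [gaugeForm, iMul]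
  ring

/-- The two-monopole bundle has the class of `*dV`. -/
theorem hasClass_gluingData (h₁ : 0 < c₁) (h₁₂ : c₁ < c₂)
    (hΓ₁ : IsFundamentalSolution (axisPoint c₁) Γ₁)
    (hΓ₂ : IsFundamentalSolution (axisPoint c₂) Γ₂) :
    (gluingData h₁ h₁₂).bundle.HasClass (starD (potential Γ₁ Γ₂)) := by
  set D := gluingData h₁ h₁₂
  set X := D.bundle
  have hW := isOpen_patch h₁ h₁₂
  have hT : ∀ i : Fin 3, IsTrivialization X.proj (patch c₁ c₂ i) (D.sec i) (D.fib i) := fun i =>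
    GluingData.isTrivialization (D := D) i
  have hfib : ∀ (i j : Fin 3) (q : X.Total),
      D.fib i q = phase (X.proj q) ^ (level j - level i) * D.fib j q := fun i j q =>
    (GluingData.fib_eq (D := D) i j q).trans
      (congrArg (· * D.fib j q) (phase_transition i j (X.proj q)))
  obtain ⟨A, hA⟩ := exists_connection_of_localForms hW (fun _ => exists_mem_patch h₁ h₁₂) hT
    (contDiffOn_gaugeForm_patch h₁ h₁₂) (fun i x _ v => gaugeForm_re _ x v)
    (gaugeForm_compat h₁ h₁₂ hT hfib)
  have hcurv := hasCurvature_of_localForms A hW (fun _ => exists_mem_patch h₁ h₁₂) hT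
    (contDiffOn_gaugeForm_patch h₁ h₁₂) hA
    (fun i x hx => dOne_gaugeForm_patch h₁ h₁₂ hΓ₁ hΓ₂ i hx)
  -- The glued connection has curvature exactly `i *dV`, so the exact correction is zero.
  refine ⟨A, fun _ => 0, contDiffOn_const, ?_⟩
  have h0 : ∀ x, dOne (fun _ : E3 => (0 : E3 →L[ℝ] ℝ)) x = 0 := by
    intro x
    ext v
    rw [dOne_apply (differentiableAt_const _)]
    simp
  simpa only [h0, add_zero] using hcurv

end Patch

end MonopoleConnection
end

/-! ### The theorem -/

open MonopoleConnection in
theorem theorem3p1 (c₁ c₂ : ℝ) (h₁ : 0 < c₁) (h₁₂ : c₁ < c₂) :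
    (∃ Γ, IsFundamentalSolution (axisPoint c₁) Γ) ∧
    (∃ Γ, IsFundamentalSolution (axisPoint c₂) Γ) ∧
    M c₁ c₂ = U₁ c₁ ∪ U₂ c₁ c₂ ∪ U₃ c₂ ∧
    ContDiffOn ℝ ∞ (gaugeForm c₁ c₂ (-1)) (U₁ c₁) ∧
    ContDiffOn ℝ ∞ (gaugeForm c₁ c₂ 0) (U₂ c₁ c₂) ∧
    ContDiffOn ℝ ∞ (gaugeForm c₁ c₂ 1) (U₃ c₂) ∧
    ∀ Γ₁ Γ₂ : E3 → ℝ,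
      IsFundamentalSolution (axisPoint c₁) Γ₁ → IsFundamentalSolution (axisPoint c₂) Γ₂ →
      (∀ x ∈ U, dOne (fun y => f c₁ c₂ y • dθ₃ y) x = starD (potential Γ₁ Γ₂) x) ∧
      (∃ X₀ : U1Bundle (M c₁ c₂), X₀.HasClass (starD (potential Γ₁ Γ₂))) ∧
      ∀ X₀ : U1Bundle (M c₁ c₂), X₀.HasClass (starD (potential Γ₁ Γ₂)) →
        ∃ A : Connection X₀, A.HasCurvature (starD (potential Γ₁ Γ₂)) ∧
          (∃ s τ, IsTrivialization X₀.proj (U₁ c₁) s τ ∧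
            A.HasLocalForm (U₁ c₁) τ (gaugeForm c₁ c₂ (-1))) ∧
          (∃ s τ, IsTrivialization X₀.proj (U₂ c₁ c₂) s τ ∧
            A.HasLocalForm (U₂ c₁ c₂) τ (gaugeForm c₁ c₂ 0)) ∧
          (∃ s τ, IsTrivialization X₀.proj (U₃ c₂) s τ ∧
            A.HasLocalForm (U₃ c₂) τ (gaugeForm c₁ c₂ 1)) := by
  have h₂ := h₁.trans h₁₂
  refine ⟨⟨_, isFundamentalSolution_green h₁⟩, ⟨_, isFundamentalSolution_green h₂⟩,
    M_eq_union h₁ h₁₂, ContDiffOn.iMul_comp (contDiffOn_realGaugeForm_U₁ h₁ h₁₂),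
    ContDiffOn.iMul_comp (contDiffOn_realGaugeForm_U₂ h₁ h₁₂),
    ContDiffOn.iMul_comp (contDiffOn_realGaugeForm_U₃ h₁ h₁₂), fun Γ₁ Γ₂ hΓ₁ hΓ₂ => ⟨?_,
    ⟨_, hasClass_gluingData h₁ h₁₂ hΓ₁ hΓ₂⟩, ?_⟩⟩
  · intro x hx
    have he : realGaugeForm c₁ c₂ 0 = fun y => f c₁ c₂ y • dθ₃ y := by
      ext1 y
      rw [realGaugeForm, zero_add]
    rw [← he]
    exact dOne_realGaugeForm_of_mem_U h₁ h₂ 0 hΓ₁ hΓ₂ hx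
  · rintro X₀ ⟨A, η, hη, hA⟩
    -- The connection `A - iη` is global; the three trivializations below are all normal forms of
    -- this one connection.
    have hcurv := A.hasCurvature_subBase (M_open c₁ c₂) hη hA
    have h := exists_trivialization_patch h₁ h₁₂ hΓ₁ hΓ₂ hcurv
    exact ⟨_, hcurv, by simpa [patch, level] using h 0, by simpa [patch, level] using h 1,
      by simpa [patch, level] using h 2⟩
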